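/- **Theorem 3.1.** *Setting.* Let $\mathfrak g$ be a real (or complex, viewed as real) semisimple Lie algebra with a fixed system of simple (restricted) roots, let $\mathfrak q\subset\mathfrak p\subset\mathfrak g$ be the standard parabolic subalgebras given by sets $\Sigma_{\mathfrak p}\subset\Sigma_{\mathfrak q}$ of simple (restricted) roots, and let $\mathfrak g_{(i',i'')}$ be the sum of all weight spaces of $\Sigma_{\mathfrak p}$-height $i'$ and $\Sigma_{\mathfrak q}$-height $i'+i''$. Put $$\mathfrak g^{(i',*)}=\bigoplus_{j'\ge i',\,j''}\mathfrak g_{(j',j'')},\qquad\text{so}\qquad \mathfrak p=\mathfrak g^{(0,*)},\quad \mathfrak p_+=\mathfrak g^{(1,*)},$$ and $\mathbb V_{i'}=\mathfrak g^{(i',*)}/\mathfrak g^{(i'+1,*)}$. Let $G$ be a Lie group with Lie algebra $\mathfrak g$, let $P$ lie between the normalizer $N_G(\mathfrak p)$ and its identity component, and let $Q\subset P$ be a Lie subgroup with Lie algebra $\mathfrak q$ lying between $N_P(\mathfrak q)$ and its identity component. Let $(p\colon\mathcal G\to M,\omega)$ be a smooth parabolic geometry of type $(G,Q)$, where $M$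 is Hausdorff and second countable, with adjoint tractor bundle $\mathcal AM=\mathcal G\times_Q\mathfrak g$, subbundles $\mathcal A^{(i',*)}M=\mathcal G\times_Q\mathfrak g^{(i',*)}$, quotients $\mathcal V_{i'}M=\mathcal A^{(i',*)}M/\mathcal A^{(i'+1,*)}M=\mathcal G\times_Q\mathbb V_{i'}$ and relative adjoint tractor bundle $\mathcal A_\rho M=\mathcal G\times_Q(\mathfrak p/\mathfrak p_+)$. Let $\Pi\colon\mathcal AM\to TM\cong\mathcal G\times_Q(\mathfrak g/\mathfrak q)$ be the canonical projection. For $i'\le 0$ let $T^{i'}_PM\subset TM$ be the subbundle corresponding to $\mathfrak g^{(i',*)}/\mathfrak q$, and let $T_\rho M=T^0_PM$ be the relative tangent bundle. Sections of an associated bundle $\mathcal G\times_Q\mathbb W$ are identified with $Q$-equivariant smooth functions $\mathcal G\to\mathbb W$. For $s\in\Gamma(\mathcal AM)$ let $D_s$ be the fundamental derivative (differentiation of equivariant functions along the vector field $\omega^{-1}(s)$), and let $\{\ ,\ \}$ be induced by the Lie bracket of $\mathfrak g$. The adjoint tractor connection is determined by $\nabla^{\mathcal A}_{\Pi(s)}t=D_st+\{s,t\}$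 for $s,t\in\Gamma(\mathcal AM)$. On $\mathcal V_{i'}M$ the operator $D_s$, for $s\in\Gamma(\mathcal A^{(0,*)}M)$, depends only on the class $\underline s\in\Gamma(\mathcal A_\rho M)$ of $s$ and is denoted by $D^\rho_{\underline s}$; the relative tractor connection of Čap–Souček on $\mathcal V_{i'}M$ is determined by $\nabla^{\rho,\mathcal V_{i'}}_{\Pi(s)}\sigma=D^\rho_{\underline s}\sigma+\underline s\bullet\sigma$, where $\bullet$ is induced by the action $\mathfrak p/\mathfrak p_+\times\mathbb V_{i'}\to\mathbb V_{i'}$ coming from the adjoint representation. (That $\Pi$, $\nabla^{\mathcal A}$, $D^\rho$ and $\nabla^{\rho,\mathcal V_{i'}}$ are well defined by these formulae is part of the claim.) *Claim.* Let $i'\le 0$. 1. For $s\in\Gamma(\mathcal A^{(0,*)}M)$ and $t\in\Gamma(\mathcal A^{(i',*)}M)$ one has $\nabla^{\mathcal A}_{\Pi(s)}t\in\Gamma(\mathcal A^{(i',*)}M)$. 2. Hence $\nabla^{\mathcal A}$ restricts to a partial connection $\Gamma(T_\rho M)\times\Gamma(\mathcal A^{(i',*)}M)\to\Gamma(\mathcal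 A^{(i',*)}M)$, that is, an operation which is linear over $C^\infty(M,\mathbb R)$ in the first argument, and additive and satisfying the Leibniz rule in the second one. In terms of $T^{i'}_PM$: the map $\Pi$ sends $\Gamma(\mathcal A^{(i',*)}M)$ onto $\Gamma(T^{i'}_PM)$; for $\xi\in\Gamma(T_\rho M)$ and $t\in\Gamma(\mathcal A^{(i',*)}M)$ one has $\Pi(\nabla^{\mathcal A}_\xi t)\in\Gamma(T^{i'}_PM)$, and modulo $\Gamma(T_\rho M)$ this depends only on the class of $\Pi(t)$ modulo $\Gamma(T_\rho M)$. 3. The projection $\Gamma(\mathcal A^{(i',*)}M)\to\Gamma(\mathcal V_{i'}M)$ is well defined and surjective, and there is a (therefore unique) partial connection $\Gamma(T_\rho M)\times\Gamma(\mathcal V_{i'}M)\to\Gamma(\mathcal V_{i'}M)$ induced by $\nabla^{\mathcal A}$, i.e. sending $(\xi,[t])$ to $[\nabla^{\mathcal A}_\xi t]$. It coincides with the relative tractor connection $\nabla^{\rho,\mathcal V_{i'}}$. -/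

import Mathlib

open scoped Manifold ContDiff

namespace RelTractor

noncomputable section

/-! ### Restricted roots, standard parabolics and the bigrading -/

section Algebra

variable {L : Type*} [LieRing L] [LieAlgebra ℝ L]

/-- The simultaneous eigenspace `{x | [a, x] = α(a) x for all a ∈ 𝔞}`. -/
def weightSpace (𝔞 : Submodule ℝ L) (α : Module.Dual ℝ 𝔞) : Submodule ℝ L where
  carrier := {x | ∀ a : 𝔞, ⁅(a : L), x⁆ = α a • x}
  add_mem' := by
    intro x y hx hy a
    rw [lie_add, hx a, hy a, smul_add]
  zero_mem' := by
    intro a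
    simp
  smul_mem' := by
    intro c x hx a
    rw [lie_smul, hx a, smul_comm]

/-- `α` is a restricted root with respect to `𝔞`. -/
def IsRestrictedRoot (𝔞 : Submodule ℝ L) (α : Module.Dual ℝ 𝔞) : Prop :=
  α ≠ 0 ∧ weightSpace 𝔞 α ≠ ⊥

variable (L) in
/-- The standard choices for a real semisimple Lie algebra `L`: a Cartan involution `θ`, a maximal
abelian subspace `𝔞` of its `-1`-eigenspace, and a system of simple restricted roots, indexed by
`ι`.  For a complex semisimple Lie algebra (viewed as a real one) the restricted roots are the
roots, `𝔞` being the real span of the coroots in a Cartan subalgebra, and the zero weight space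
is that Cartan subalgebra. -/
structure RestrictedRootSystem (ι : Type*) [Fintype ι] where
  θ : L ≃ₗ⁅ℝ⁆ L
  θ_involutive : ∀ x, θ (θ x) = x
  killing_θ_neg : ∀ x, x ≠ 0 → killingForm ℝ L x (θ x) < 0
  𝔞 : Submodule ℝ L
  θ_𝔞 : ∀ a ∈ 𝔞, θ a = -a
  abelian : ∀ a ∈ 𝔞, ∀ b ∈ 𝔞, ⁅a, b⁆ = 0
  maximal : ∀ x, θ x = -x → (∀ a ∈ 𝔞, ⁅a, x⁆ = 0) → x ∈ 𝔞
  simple : Module.Basis ι ℝ (Module.Dual ℝ 𝔞)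
  simple_isRoot : ∀ i, IsRestrictedRoot 𝔞 (simple i)
  root_sign : ∀ α, IsRestrictedRoot 𝔞 α →
    (∃ n : ι → ℕ, α = ∑ i, (n i : ℝ) • simple i) ∨ (∃ n : ι → ℕ, α = -∑ i, (n i : ℝ) • simple i)

namespace RestrictedRootSystem

variable {ι : Type*} [Fintype ι] (R : RestrictedRootSystem L ι)

/-- The `S`-height of `α`: the sum of the coefficients of the simple roots belonging to `S`. -/
def height (S : Finset ι) (α : Module.Dual ℝ R.𝔞) : ℝ := ∑ i ∈ S, R.simple.repr α i

/-- The standard parabolic subalgebra determined by the set `S` of simple roots: the sum of all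
grading components of non-negative degree, where `α` has degree equal to its `S`-height (the zero
weight space, i.e. the centralizer of `𝔞`, has degree zero). -/
def parabolic (S : Finset ι) : Submodule ℝ L :=
  ⨆ (α : Module.Dual ℝ R.𝔞) (_ : 0 ≤ R.height S α), weightSpace R.𝔞 α

/-- The component `𝔤_(i', i'')` of the bigrading determined by `Sp ⊆ Sq`: the sum of all weight
spaces of `Sp`-height `i'` and `Sq`-height `i' + i''`. (The weight space is zero unless `α` is a
root or `0`, and the component is zero if `i'` and `i''` have opposite signs.) -/
def bigrading (Sp Sq : Finset ι) (i' i'' : ℤ) : Submodule ℝ L :=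
  ⨆ (α : Module.Dual ℝ R.𝔞) (_ : R.height Sp α = i' ∧ R.height Sq α = i' + i''), weightSpace R.𝔞 α

/-- `𝔤^(i', *)`: the sum of all `𝔤_(j', j'')` with `j' ≥ i'`. -/
def filtration (Sp Sq : Finset ι) (i' : ℤ) : Submodule ℝ L :=
  ⨆ (j' : ℤ) (_ : i' ≤ j') (j'' : ℤ), R.bigrading Sp Sq j' j''

lemma weightSpace_le_filtration {Sp Sq : Finset ι} {i' j' j'' : ℤ} (hj : i' ≤ j')
    {α : Module.Dual ℝ R.𝔞} (h : R.height Sp α = j' ∧ R.height Sq α = j' + j'') :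
    weightSpace R.𝔞 α ≤ R.filtration Sp Sq i' :=
  le_trans (le_trans (le_iSup₂_of_le α h le_rfl)
    (le_iSup (fun k => R.bigrading Sp Sq j' k) j''))
    (le_iSup₂_of_le (f := fun (k' : ℤ) (_ : i' ≤ k') => ⨆ k'' : ℤ, R.bigrading Sp Sq k' k'')
      j' hj le_rfl)

lemma filtration_le {Sp Sq : Finset ι} {i' : ℤ} {W : Submodule ℝ L}
    (h : ∀ (j' j'' : ℤ), i' ≤ j' → ∀ α : Module.Dual ℝ R.𝔞,
      R.height Sp α = j' ∧ R.height Sq α = j' + j'' → weightSpace R.𝔞 α ≤ W) :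
    R.filtration Sp Sq i' ≤ W := by
  unfold filtration bigrading
  simp only [iSup_le_iff]
  intro j' hj j'' α hα
  exact h j' j'' hj α hα

lemma height_add (S : Finset ι) (α β : Module.Dual ℝ R.𝔞) :
    R.height S (α + β) = R.height S α + R.height S β := by
  simp [height, Finset.sum_add_distrib]

lemma lie_weightSpace {𝔞 : Submodule ℝ L} {α β : Module.Dual ℝ 𝔞} {x y : L}
    (hx : x ∈ weightSpace 𝔞 α) (hy : y ∈ weightSpace 𝔞 β) :
    ⁅x, y⁆ ∈ weightSpace 𝔞 (α + β) := by
  intro a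
  rw [leibniz_lie, hx a, hy a, smul_lie, lie_smul, LinearMap.add_apply, add_smul]

/-- The filtration is compatible with the Lie bracket. -/
lemma lie_filtration {Sp Sq : Finset ι} {i j : ℤ} {x y : L}
    (hx : x ∈ R.filtration Sp Sq i) (hy : y ∈ R.filtration Sp Sq j) :
    ⁅x, y⁆ ∈ R.filtration Sp Sq (i + j) := by
  have key : R.filtration Sp Sq i ≤
      ⨅ z ∈ R.filtration Sp Sq j, (R.filtration Sp Sq (i + j)).comap
        (-(LieAlgebra.ad ℝ L z : L →ₗ[ℝ] L)) := by
    refine R.filtration_le fun k k'' hk α hα a ha => ?_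
    simp only [Submodule.mem_iInf, Submodule.mem_comap, LinearMap.neg_apply, LieAlgebra.ad_apply,
      lie_skew]
    have key2 : R.filtration Sp Sq j ≤ (R.filtration Sp Sq (i + j)).comap
        (LieAlgebra.ad ℝ L a : L →ₗ[ℝ] L) := by
      refine R.filtration_le fun l l'' hl β hβ b hb => ?_
      refine R.weightSpace_le_filtration (j' := k + l) (j'' := k'' + l'') (by omega)
        ⟨?_, ?_⟩ (lie_weightSpace ha hb)
      · rw [height_add, hα.1, hβ.1]; push_cast; ring
      · rw [height_add, hα.2, hβ.2]; push_cast; ring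
    exact fun z hz => key2 hz
  have := key hx
  simp only [Submodule.mem_iInf, Submodule.mem_comap, LinearMap.neg_apply, LieAlgebra.ad_apply,
      lie_skew] at this
  exact this y hy

/-- The quotient `𝕍_{i'} = 𝔤^(i', *) / 𝔤^(i'+1, *)`. -/
abbrev Quot (Sp Sq : Finset ι) (i' : ℤ) : Type _ :=
  (R.filtration Sp Sq i') ⧸ (R.filtration Sp Sq (i' + 1)).submoduleOf (R.filtration Sp Sq i')

/-- The bracket `𝔤^(0, *) × 𝔤^(i', *) → 𝔤^(i', *)`. -/
def filtrationLie (Sp Sq : Finset ι) (i' : ℤ) :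
    R.filtration Sp Sq 0 →ₗ[ℝ] R.filtration Sp Sq i' →ₗ[ℝ] R.filtration Sp Sq i' :=
  LinearMap.mk₂ ℝ
    (fun a x => ⟨⁅(a : L), (x : L)⁆, by simpa using R.lie_filtration a.2 x.2⟩)
    (fun a b x => Subtype.ext (by simp))
    (fun c a x => Subtype.ext (by simp))
    (fun a x y => Subtype.ext (by simp))
    (fun c a x => Subtype.ext (by simp))

/-- The infinitesimal representation of `𝔭/𝔭₊ = 𝔤^(0, *) / 𝔤^(1, *)` on `𝕍_{i'}` induced by the
adjoint representation: `[a] • [x] = [[a, x]]`. -/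
def bullet (Sp Sq : Finset ι) (i' : ℤ) :
    R.Quot Sp Sq 0 →ₗ[ℝ] R.Quot Sp Sq i' →ₗ[ℝ] R.Quot Sp Sq i' :=
  Submodule.liftQ _
    { toFun := fun a => Submodule.mapQ _ _ (R.filtrationLie Sp Sq i' a) (by
        intro x hx
        have hx' : (x : L) ∈ R.filtration Sp Sq (i' + 1) := hx
        change ⁅(a : L), (x : L)⁆ ∈ R.filtration Sp Sq (i' + 1)
        simpa using R.lie_filtration a.2 hx')
      map_add' := fun a b => by
        refine Submodule.linearMap_qext _ (LinearMap.ext fun x => ?_)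
        simp
      map_smul' := fun c a => by
        refine Submodule.linearMap_qext _ (LinearMap.ext fun x => ?_)
        simp }
    (by
      intro a ha
      have ha' : (a : L) ∈ R.filtration Sp Sq (0 + 1) := ha
      refine Submodule.linearMap_qext _ (LinearMap.ext fun x => ?_)
      refine (Submodule.Quotient.mk_eq_zero _).2 ?_
      change ⁅(a : L), (x : L)⁆ ∈ R.filtration Sp Sq (i' + 1)
      have h := R.lie_filtration ha' x.2
      rwa [zero_add, add_comm] at h)

end RestrictedRootSystem

end Algebra

/-! ### Smooth functions with values in a finite-dimensional real vector space -/

section Calculus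

variable {E : Type*} [NormedAddCommGroup E] [NormedSpace ℝ E]
  {N : Type*} [TopologicalSpace N] [ChartedSpace E N]
  {W : Type*} [AddCommGroup W] [Module ℝ W]

/-- `f : N → W` is smooth, i.e. all its components `φ ∘ f` (`φ` a linear functional on the
finite-dimensional space `W`) are smooth. -/
def IsSmooth (f : N → W) : Prop :=
  ∀ φ : Module.Dual ℝ W, ContMDiff 𝓘(ℝ, E) 𝓘(ℝ, ℝ) ∞ (fun u => φ (f u))

/-- The directional derivative `X · f` of the real-valued function `f` in direction `X ∈ T_u N`. -/
def fnDeriv (f : N → ℝ) (u : N) (X : TangentSpace 𝓘(ℝ, E) u) : ℝ :=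
  mfderiv 𝓘(ℝ, E) 𝓘(ℝ, ℝ) f u X

/-- The directional derivative `X · f ∈ W` of `f : N → W` in direction of `X ∈ T_u N`, computed in
components with respect to a basis of `W`. -/
def dirDeriv [Module.Finite ℝ W] (f : N → W) (u : N) (X : TangentSpace 𝓘(ℝ, E) u) : W :=
  ∑ i, fnDeriv (fun v => (Module.finBasis ℝ W).repr (f v) i) u X • Module.finBasis ℝ W i

/-- The vector field `ξ` is smooth. -/
def IsSmoothVF [IsManifold 𝓘(ℝ, E) ∞ N] (ξ : ∀ x : N, TangentSpace 𝓘(ℝ, E) x) : Prop :=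
  ContMDiff 𝓘(ℝ, E) 𝓘(ℝ, E).tangent ∞ (fun x => (⟨x, ξ x⟩ : TangentBundle 𝓘(ℝ, E) N))

end Calculus

/-! ### The groups -/

section Groups

variable {EG : Type*} [NormedAddCommGroup EG] [NormedSpace ℝ EG] [FiniteDimensional ℝ EG]
  {G : Type*} [TopologicalSpace G] [ChartedSpace EG G] [Group G] [LieGroup 𝓘(ℝ, EG) ∞ G]

instance lieGroup_minSmoothness : LieGroup 𝓘(ℝ, EG) (minSmoothness ℝ 3) G :=
  LieGroup.of_le (n := ∞) (by simpa using ENat.LEInfty.out)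

instance finite_groupLieAlgebra : Module.Finite ℝ (GroupLieAlgebra 𝓘(ℝ, EG) G) :=
  inferInstanceAs (Module.Finite ℝ EG)

/-- The adjoint action of `g` on the Lie algebra of `G`: the derivative at `1` of conjugation. -/
def Ad (g : G) : GroupLieAlgebra 𝓘(ℝ, EG) G →ₗ[ℝ] GroupLieAlgebra 𝓘(ℝ, EG) G :=
  (mfderiv 𝓘(ℝ, EG) 𝓘(ℝ, EG) (fun x : G => g * x * g⁻¹) 1).toLinearMap

/-- The normalizer `N_G(V) = {g | Ad(g) V = V}`. -/
def normalizerSet (V : Submodule ℝ (GroupLieAlgebra 𝓘(ℝ, EG) G)) : Set G :=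
  {g | V.map (Ad g) = V}

variable {EQ : Type*} [NormedAddCommGroup EQ] [NormedSpace ℝ EQ]

/-- The inclusion of the Lie algebra of a subgroup `Q` (carrying its own structure of a Lie group)
into that of `G`: the derivative at `1` of the inclusion. -/
def inclDeriv (Q : Subgroup G) [ChartedSpace EQ Q] :
    GroupLieAlgebra 𝓘(ℝ, EQ) Q →ₗ[ℝ] GroupLieAlgebra 𝓘(ℝ, EG) G :=
  (mfderiv 𝓘(ℝ, EQ) 𝓘(ℝ, EG) (Subtype.val : Q → G) 1).toLinearMap

/-- Nested parabolic subgroups `Q ⊂ P ⊂ G`, for a Lie group `G` whose Lie algebra is semisimple: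
there are fixed standard parabolic subalgebras `𝔮 ⊂ 𝔭` corresponding to sets `Sp ⊆ Sq` of simple
restricted roots, `P` lies between the normalizer `N_G(𝔭)` and its identity component, and `Q` is a
Lie subgroup with Lie algebra `𝔮`, which lies between `N_P(𝔮)` and its identity component.
(`Q` has the subspace topology.) -/
structure NestedParabolics (ι : Type*) [Fintype ι] (P Q : Subgroup G) [ChartedSpace EQ Q] where
  roots : RestrictedRootSystem (GroupLieAlgebra 𝓘(ℝ, EG) G) ι
  Sp : Finset ι
  Sq : Finset ι
  Sp_subset : Sp ⊆ Sq
  P_le : (P : Set G) ⊆ normalizerSet (roots.parabolic Sp)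
  le_P : connectedComponentIn (normalizerSet (roots.parabolic Sp)) 1 ⊆ P
  Q_le : (Q : Set G) ⊆ P ∩ normalizerSet (roots.parabolic Sq)
  le_Q : connectedComponentIn (P ∩ normalizerSet (roots.parabolic Sq)) 1 ⊆ Q
  incl_smooth : ContMDiff 𝓘(ℝ, EQ) 𝓘(ℝ, EG) ∞ (Subtype.val : Q → G)
  incl_immersion : Function.Injective (inclDeriv (EG := EG) (EQ := EQ) Q)
  lieAlgebra_Q : LinearMap.range (inclDeriv (EG := EG) (EQ := EQ) Q) = roots.parabolic Sq

namespace NestedParabolics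

variable {ι : Type*} [Fintype ι] {P Q : Subgroup G} [ChartedSpace EQ Q]
  (B : NestedParabolics (EG := EG) (EQ := EQ) ι P Q)

/-- `𝔤^(i', *)`; in particular `𝔭 = 𝔤^(0, *)` and `𝔭₊ = 𝔤^(1, *)`. -/
abbrev F (i' : ℤ) : Submodule ℝ (GroupLieAlgebra 𝓘(ℝ, EG) G) := B.roots.filtration B.Sp B.Sq i'

/-- `𝕍_{i'} = 𝔤^(i', *) / 𝔤^(i'+1, *)`; in particular `𝕍_0 = 𝔭/𝔭₊`. -/
abbrev V (i' : ℤ) : Type _ := B.roots.Quot B.Sp B.Sq i'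

/-- The class in `𝕍_{i'}` of an element of `𝔤^(i', *)`. -/
abbrev cls (i' : ℤ) : B.F i' →ₗ[ℝ] B.V i' := Submodule.mkQ _

/-- The projection `Γ(𝒜^(i', *) M) → Γ(𝒱_{i'} M)`, for sections viewed as functions on the total
space `X` of the principal bundle. -/
def proj {X : Type*} (i' : ℤ) (t : X → GroupLieAlgebra 𝓘(ℝ, EG) G) (ht : ∀ u, t u ∈ B.F i') :
    X → B.V i' :=
  fun u => B.cls i' ⟨t u, ht u⟩

end NestedParabolics

/-! ### Cartan geometries -/

variable {E𝒢 : Type*} [NormedAddCommGroup E𝒢] [NormedSpace ℝ E𝒢]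
  {EM : Type*} [NormedAddCommGroup EM] [NormedSpace ℝ EM]

variable (EG EQ E𝒢 EM) in
/-- A Cartan geometry `(π : 𝒢 → M, ω)` of type `(G, Q)`: a smooth principal `Q`-bundle together
with a Cartan connection `ω`.  (For `Q` a parabolic subgroup, this is a parabolic geometry.) -/
structure CartanGeometry (Q : Subgroup G) [ChartedSpace EQ Q]
    (𝒢 : Type*) [TopologicalSpace 𝒢] [ChartedSpace E𝒢 𝒢] [IsManifold 𝓘(ℝ, E𝒢) ∞ 𝒢]
    (M : Type*) [TopologicalSpace M] [ChartedSpace EM M] [IsManifold 𝓘(ℝ, EM) ∞ M] where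
  π : 𝒢 → M
  act : 𝒢 → Q → 𝒢
  π_smooth : ContMDiff 𝓘(ℝ, E𝒢) 𝓘(ℝ, EM) ∞ π
  act_smooth : ContMDiff (𝓘(ℝ, E𝒢).prod 𝓘(ℝ, EQ)) 𝓘(ℝ, E𝒢) ∞ (fun z : 𝒢 × Q => act z.1 z.2)
  act_one : ∀ u, act u 1 = u
  act_mul : ∀ u q r, act (act u q) r = act u (q * r)
  π_act : ∀ u q, π (act u q) = π u
  /-- Local triviality, by smooth equivariant trivializations. -/
  locallyTrivial : ∀ x : M, ∃ e : Bundle.Trivialization Q π, x ∈ e.baseSet ∧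
    ContMDiffOn 𝓘(ℝ, E𝒢) (𝓘(ℝ, EM).prod 𝓘(ℝ, EQ)) ∞ e e.source ∧
    ContMDiffOn (𝓘(ℝ, EM).prod 𝓘(ℝ, EQ)) 𝓘(ℝ, E𝒢) ∞ e.toOpenPartialHomeomorph.symm e.target ∧
    ∀ u ∈ e.source, ∀ q, (e (act u q)).2 = (e u).2 * q
  /-- The Cartan connection: a `𝔤`-valued one-form which is a linear isomorphism on each tangent
  space. -/
  cartan : ∀ u : 𝒢, TangentSpace 𝓘(ℝ, E𝒢) u ≃ₗ[ℝ] GroupLieAlgebra 𝓘(ℝ, EG) G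
  cartan_smooth : ∀ φ : Module.Dual ℝ (GroupLieAlgebra 𝓘(ℝ, EG) G),
    ContMDiff 𝓘(ℝ, E𝒢).tangent 𝓘(ℝ, ℝ) ∞
      (fun X : TangentBundle 𝓘(ℝ, E𝒢) 𝒢 => φ (cartan X.1 X.2))
  /-- Equivariancy: `(r^q)^* ω = Ad(q⁻¹) ∘ ω`. -/
  cartan_equivariant : ∀ (u : 𝒢) (q : Q) (X : TangentSpace 𝓘(ℝ, E𝒢) u),
    cartan (act u q) (mfderiv 𝓘(ℝ, E𝒢) 𝓘(ℝ, E𝒢) (fun v => act v q) u X) = Ad (q : G)⁻¹ (cartan u X)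
  /-- `ω` reproduces the generators of fundamental vector fields. -/
  cartan_fundamental : ∀ (u : 𝒢) (A : GroupLieAlgebra 𝓘(ℝ, EQ) Q),
    cartan (act u 1) (mfderiv 𝓘(ℝ, EQ) 𝓘(ℝ, E𝒢) (fun q : Q => act u q) 1 A) = inclDeriv Q A

namespace CartanGeometry

variable {ι : Type*} [Fintype ι] {P Q : Subgroup G} [ChartedSpace EQ Q]
  {𝒢 : Type*} [TopologicalSpace 𝒢] [ChartedSpace E𝒢 𝒢] [IsManifold 𝓘(ℝ, E𝒢) ∞ 𝒢]
  {M : Type*} [TopologicalSpace M] [ChartedSpace EM M] [IsManifold 𝓘(ℝ, EM) ∞ M]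
  (C : CartanGeometry EG EQ E𝒢 EM Q 𝒢 M)
  (B : NestedParabolics (EG := EG) (EQ := EQ) ι P Q)

set_option linter.unusedSectionVars false in
lemma π_surjective : Function.Surjective C.π := by
  intro x
  obtain ⟨e, hx, -⟩ := C.locallyTrivial x
  exact ⟨e.toOpenPartialHomeomorph.symm (x, 1), e.proj_symm_apply' hx⟩

/-- The vector of `T_{π(u)} M` represented by `(u, A) ∈ 𝒢 × 𝔤`, i.e. `T_u π (ω_u⁻¹ A)`.  This induces
the isomorphism `𝒢 ×_Q (𝔤/𝔮) ≅ TM`. -/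
def toTM (u : 𝒢) (A : GroupLieAlgebra 𝓘(ℝ, EG) G) : TangentSpace 𝓘(ℝ, EM) (C.π u) :=
  mfderiv 𝓘(ℝ, E𝒢) 𝓘(ℝ, EM) C.π u ((C.cartan u).symm A)

/-! Sections of an associated bundle `𝒢 ×_Q W` are identified with the `Q`-equivariant smooth
functions `𝒢 → W`. -/

/-- `Γ(𝒜M)`, the sections of the adjoint tractor bundle `𝒜M = 𝒢 ×_Q 𝔤`. -/
def ΓA : Set (𝒢 → GroupLieAlgebra 𝓘(ℝ, EG) G) :=
  {s | IsSmooth (E := E𝒢) s ∧ ∀ u (q : Q), s (C.act u q) = Ad (q : G)⁻¹ (s u)}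

/-- `Γ(𝒜^(i', *) M)`, the sections of the subbundle of `𝒜M` determined by `𝔤^(i', *) ⊂ 𝔤`. -/
def ΓAF (i' : ℤ) : Set (𝒢 → GroupLieAlgebra 𝓘(ℝ, EG) G) :=
  {s | s ∈ C.ΓA ∧ ∀ u, s u ∈ B.F i'}

/-- `Γ(𝒱_{i'} M)`, the sections of `𝒱_{i'} M = 𝒜^(i', *) M / 𝒜^(i'+1, *) M = 𝒢 ×_Q 𝕍_{i'}`, where
`q ∈ Q` acts on `𝕍_{i'}` by `[x] ↦ [Ad(q) x]`; in particular `Γ(𝒱_0 M)` is the space of sections of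
the relative adjoint tractor bundle `𝒜_ρ M = 𝒢 ×_Q (𝔭/𝔭₊)`. -/
def ΓV (i' : ℤ) : Set (𝒢 → B.V i') :=
  {σ | IsSmooth (E := E𝒢) σ ∧ ∀ u (q : Q), ∃ x y : B.F i', B.cls i' x = σ u ∧ B.cls i' y = σ (C.act u q) ∧
    (y : GroupLieAlgebra 𝓘(ℝ, EG) G) = Ad (q : G)⁻¹ (x : GroupLieAlgebra 𝓘(ℝ, EG) G)}

/-- The subbundle `T^{i'}_P M ⊂ TM`, for `i' ≤ 0`: the image of `𝒢 × 𝔤^(i', *)` in `TM`, i.e. the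
subbundle corresponding to `𝔤^(i', *)/𝔮 ⊂ 𝔤/𝔮`.  For `i' = 0` this is the relative tangent bundle
`T_ρ M`. -/
def TP (i' : ℤ) : Set (TangentBundle 𝓘(ℝ, EM) M) :=
  {v | ∃ u, ∃ A ∈ B.F i', v = ⟨C.π u, C.toTM u A⟩}

/-- `Γ(T^{i'}_P M)`. -/
def ΓTP (i' : ℤ) : Set (∀ x : M, TangentSpace 𝓘(ℝ, EM) x) :=
  {ξ | IsSmoothVF ξ ∧ ∀ x, (⟨x, ξ x⟩ : TangentBundle 𝓘(ℝ, EM) M) ∈ C.TP B i'}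

/-- The projection `Π : Γ(𝒜M) → 𝔛(M)`. -/
def Pi (s : 𝒢 → GroupLieAlgebra 𝓘(ℝ, EG) G) (x : M) : TangentSpace 𝓘(ℝ, EM) x :=
  Function.surjInv_eq C.π_surjective x ▸
    C.toTM (Function.surjInv C.π_surjective x) (s (Function.surjInv C.π_surjective x))

/-- The fundamental derivative `D_s f`: the derivative of the function `f` in direction of the
vector field `ω⁻¹(s)` on `𝒢`. -/
def fundDeriv {W : Type*} [AddCommGroup W] [Module ℝ W] [Module.Finite ℝ W]
    (s : 𝒢 → GroupLieAlgebra 𝓘(ℝ, EG) G) (f : 𝒢 → W) : 𝒢 → W :=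
  fun u => dirDeriv f u ((C.cartan u).symm (s u))

/-- A function `s : 𝒢 → 𝔤` such that `(u, s(u))` represents `ξ(π(u))` for each `u`. -/
def lift (ξ : ∀ x : M, TangentSpace 𝓘(ℝ, EM) x) : 𝒢 → GroupLieAlgebra 𝓘(ℝ, EG) G :=
  fun u => Classical.epsilon fun A => C.toTM u A = ξ (C.π u)

/-- The adjoint tractor connection `∇^𝒜_ξ t = D_s t + {s, t}` with `Π(s) = ξ`.  The right hand side
at `u` depends only on the value `s(u)`, and it does not depend on which `s(u)` representing
`ξ(π(u))` is used. -/
def adjConn (ξ : ∀ x : M, TangentSpace 𝓘(ℝ, EM) x) (t : 𝒢 → GroupLieAlgebra 𝓘(ℝ, EG) G) :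
    𝒢 → GroupLieAlgebra 𝓘(ℝ, EG) G :=
  fun u => C.fundDeriv (C.lift ξ) t u + ⁅C.lift ξ u, t u⁆

/-- The relative fundamental derivative `D^ρ_a f = D_s f`, where `s` is any representative in
`Γ(𝒜^(0, *) M)` of the section `a` of `𝒜_ρ M = 𝒜^(0, *) M / 𝒜^(1, *) M`. -/
def relFundDeriv {W : Type*} [AddCommGroup W] [Module ℝ W] [Module.Finite ℝ W]
    (a : 𝒢 → B.V 0) (f : 𝒢 → W) : 𝒢 → W :=
  C.fundDeriv (fun u => (Function.surjInv (Submodule.mkQ_surjective _) (a u) : B.F 0)) f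

/-- A function `a : 𝒢 → 𝔭/𝔭₊` such that `(u, a(u))` represents `ξ(π(u))` for each `u`, for `ξ` a
section of `T_ρ M`. -/
def relLift (ξ : ∀ x : M, TangentSpace 𝓘(ℝ, EM) x) : 𝒢 → B.V 0 :=
  fun u => Classical.epsilon fun a => ∃ A : B.F 0, B.cls 0 A = a ∧ C.toTM u A = ξ (C.π u)

/-- The relative tractor connection `∇^ρ_ξ σ = D^ρ_a σ + a • σ` on `𝒱_{i'} M`, where the section `a`
of `𝒜_ρ M` projects to `ξ`. -/
def relConn (i' : ℤ) (ξ : ∀ x : M, TangentSpace 𝓘(ℝ, EM) x) (σ : 𝒢 → B.V i') : 𝒢 → B.V i' :=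
  fun u => C.relFundDeriv B (C.relLift B ξ) σ u +
    B.roots.bullet B.Sp B.Sq i' (C.relLift B ξ u) (σ u)

/-- `nab` restricts to a partial connection `Γ(T_ρ M) × S → S` on the bundle with space `S` of
sections: it is linear over smooth functions in the first argument, and additive with a Leibniz rule
in the second one. -/
structure IsPartialConnection {W : Type*} [AddCommGroup W] [Module ℝ W] (S : Set (𝒢 → W))
    (nab : (∀ x : M, TangentSpace 𝓘(ℝ, EM) x) → (𝒢 → W) → (𝒢 → W)) : Prop where
  mem : ∀ ξ ∈ C.ΓTP B 0, ∀ σ ∈ S, nab ξ σ ∈ S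
  add_left : ∀ ξ ∈ C.ΓTP B 0, ∀ η ∈ C.ΓTP B 0, ∀ σ ∈ S,
    nab (fun x => ξ x + η x) σ = nab ξ σ + nab η σ
  smul_left : ∀ f : M → ℝ, ContMDiff 𝓘(ℝ, EM) 𝓘(ℝ, ℝ) ∞ f → ∀ ξ ∈ C.ΓTP B 0, ∀ σ ∈ S,
    nab (fun x => f x • ξ x) σ = fun u => f (C.π u) • nab ξ σ u
  add_right : ∀ ξ ∈ C.ΓTP B 0, ∀ σ ∈ S, ∀ τ ∈ S, nab ξ (σ + τ) = nab ξ σ + nab ξ τ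
  leibniz : ∀ f : M → ℝ, ContMDiff 𝓘(ℝ, EM) 𝓘(ℝ, ℝ) ∞ f → ∀ ξ ∈ C.ΓTP B 0, ∀ σ ∈ S,
    nab ξ (fun u => f (C.π u) • σ u) =
      fun u => fnDeriv f (C.π u) (ξ (C.π u)) • σ u + f (C.π u) • nab ξ σ u

end CartanGeometry

end Groups

end

end RelTractor

/-! The value of `D_s t + {s, t}` at a point `u` of the total space depends linearly on `s(u)`
alone. If `s(u)` lies in `𝔮`, then `ω⁻¹(s(u))` is tangent to the fibre, and equivariance of `t`
gives the derivative `-[s(u), t(u)]`, so the two terms cancel. Since `𝔮` is exactly the kernel of `𝔤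
→ T_{π(u)}M`, the sum depends only on `Π(s)`; this is `connAt_congr`. A function with values in
`𝔤^(i',*)` has derivatives in the same subspace, and `[𝔤^(0,*), 𝔤^(i',*)] ⊂ 𝔤^(i',*)`, so the
connection preserves the filtration in relative directions. Both terms commute with the projection
to `𝕍_{i'}`, where they become `D^ρ` and `•`; hence the induced operation is the relative tractor
connection (`relConn_proj`). That `D^ρ` is well defined on the quotient follows from `𝔤^(1,*) ⊂ 𝔮`
together with the fact that `𝔤^(1,*)` raises the filtration degree (`relFundDeriv_proj`).

Three facts behind this need proof.

The group `Q` is only assumed to normalize `𝔭 = 𝔤^(0,*)` and `𝔮`, whereas every `𝔤^(k,*)` with `k ≤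
1` has to be invariant (`map_filtration`). For this, the filtration is recovered from `𝔭` by
operations natural under automorphisms: `𝔤^(1,*)` is the Killing annihilator of `𝔭`, and for `k ≤ 0`
the space `𝔤^(k,*)` consists of the `x` with `[x, 𝔤^(1,*)] ⊂ 𝔤^(k+1,*)`. The second description is a
highest weight argument, which ends in `weight_eq_zero_of_annihilated`.

The derivative of `Ad` has to be the bracket defined by left-invariant vector fields
(`mfderiv_AdOrbit_one`); this comes from the second derivative of the multiplication in a chart.

Sections of quotient bundles have to lift. Lifts exist locally, the admissible values form convex
sets, and a partition of unity on `M` glues (`exists_section_of_local`). -/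

namespace RelTractor

noncomputable section

/-! ### Weight decomposition and invariance of the filtration under automorphisms -/

section Algebra

open Module.End in
/-- A commuting family of operators which are symmetric for a positive definite form is
simultaneously diagonalizable. -/
lemma iSup_iInf_eigenspace_eq_top {E : Type*} [AddCommGroup E] [Module ℝ E] [Module.Finite ℝ E]
    (b : LinearMap.BilinForm ℝ E) (hsymm : ∀ x y, b x y = b y x) (hpos : ∀ x, x ≠ 0 → 0 < b x x)
    {κ : Type*} (T : κ → E →ₗ[ℝ] E) (hT : ∀ i x y, b (T i x) y = b x (T i y))
    (hcomm : ∀ i j, Commute (T i) (T j)) :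
    ⨆ χ : κ → ℝ, ⨅ i, eigenspace (T i) (χ i) = ⊤ := by
  -- With `b` as inner product, this is the spectral theorem for commuting symmetric operators.
  let c : InnerProductSpace.Core ℝ E :=
    { inner := fun x y => b x y
      conj_inner_symm := fun x y => hsymm y x
      re_inner_nonneg := fun x => by
        rcases eq_or_ne x 0 with rfl | hx
        · simp
        · exact (hpos x hx).le
      add_left := fun x y z => by simp
      smul_left := fun x y r => by simp
      definite := fun x hx => by
        by_contra h
        exact (hpos x h).ne' hx }
  let _ : NormedAddCommGroup E := c.toNormedAddCommGroup
  let _ : InnerProductSpace ℝ E := InnerProductSpace.ofCore c.toCore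
  exact LinearMap.IsSymmetric.iSup_iInf_eq_top_of_commute (𝕜 := ℝ) (T := T)
    (fun i x y => hT i x y) (fun i j _ => hcomm i j)

open Module.End in
/-- A nonzero invariant subspace contains a joint eigenvector. -/
lemma exists_joint_eigenvector {E : Type*} [AddCommGroup E] [Module ℝ E] [Module.Finite ℝ E]
    (b : LinearMap.BilinForm ℝ E) (hsymm : ∀ x y, b x y = b y x) (hpos : ∀ x, x ≠ 0 → 0 < b x x)
    {κ : Type*} (T : κ → E →ₗ[ℝ] E) (hT : ∀ i x y, b (T i x) y = b x (T i y))
    (hcomm : ∀ i j, Commute (T i) (T j)) {N : Submodule ℝ E} (hN : N ≠ ⊥)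
    (hinv : ∀ i, ∀ x ∈ N, T i x ∈ N) :
    ∃ x ∈ N, x ≠ 0 ∧ ∃ χ : κ → ℝ, ∀ i, T i x = χ i • x := by
  have h := iSup_iInf_eigenspace_eq_top (b.restrict N) (fun x y => hsymm x y)
    (fun x hx => hpos x (by simpa using hx)) (fun i => (T i).restrict (hinv i))
    (fun i x y => hT i x y) (fun i j => LinearMap.ext fun x => Subtype.ext (by
      simpa using LinearMap.congr_fun (hcomm i j).eq (x : E)))
  have : ∃ χ : κ → ℝ, (⨅ i, eigenspace ((T i).restrict (hinv i)) (χ i)) ≠ ⊥ := by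
    by_contra! hcon
    simp only [hcon, iSup_bot] at h
    have : Subsingleton N := by
      rw [← Submodule.subsingleton_iff ℝ]
      exact subsingleton_of_bot_eq_top h
    exact hN (Submodule.subsingleton_iff_eq_bot.1 this)
  obtain ⟨χ, hχ⟩ := this
  obtain ⟨x, hx, hx0⟩ := Submodule.exists_mem_ne_zero_of_ne_bot hχ
  refine ⟨x, x.2, by simpa using hx0, χ, fun i => ?_⟩
  have := (Submodule.mem_iInf _).1 hx i
  rw [mem_eigenspace_iff] at this
  simpa using congrArg Subtype.val this

variable {L : Type*} [LieRing L] [LieAlgebra ℝ L]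

namespace RestrictedRootSystem

variable {ι : Type*} [Fintype ι] (R : RestrictedRootSystem L ι)

lemma killing_lie (x y z : L) : killingForm ℝ L ⁅x, y⁆ z = - killingForm ℝ L y ⁅x, z⁆ :=
  LieModule.traceForm_apply_lie_apply' ℝ L L x y z

lemma killing_comm (x y : L) : killingForm ℝ L x y = killingForm ℝ L y x :=
  LieModule.traceForm_comm ℝ L L x y

lemma killing_θ (x y : L) : killingForm ℝ L (R.θ x) y = killingForm ℝ L x (R.θ y) := by
  conv_lhs => rw [← R.θ_involutive y]
  exact LieAlgebra.killingForm_of_equiv_apply R.θ x (R.θ y)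

/-- The positive definite form `-B(x, θ y)` associated with the Cartan involution. -/
def innerForm : LinearMap.BilinForm ℝ L :=
  -(killingForm ℝ L).compl₂ (R.θ : L →ₗ[ℝ] L)

lemma innerForm_apply (x y : L) : R.innerForm x y = -killingForm ℝ L x (R.θ y) := rfl

lemma innerForm_symm (x y : L) : R.innerForm x y = R.innerForm y x := by
  rw [innerForm_apply, innerForm_apply, ← killing_θ, killing_comm]

lemma innerForm_pos (x : L) (hx : x ≠ 0) : 0 < R.innerForm x x :=
  neg_pos.2 (R.killing_θ_neg x hx)

lemma innerForm_self_nonneg (x : L) : 0 ≤ R.innerForm x x := by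
  rcases eq_or_ne x 0 with rfl | hx
  · simp
  · exact (R.innerForm_pos x hx).le

/-- By invariance of the Killing form, the adjoint of `ad x` is `-ad (θ x)`. In particular `𝔞`, on
which `θ = -1`, acts by symmetric operators. -/
lemma innerForm_lie (x y z : L) : R.innerForm ⁅x, y⁆ z = -R.innerForm y ⁅R.θ x, z⁆ := by
  simp only [innerForm_apply, LieEquiv.map_lie, R.θ_involutive, killing_lie, neg_neg]

lemma innerForm_lie_of_mem {a : L} (ha : a ∈ R.𝔞) (x y : L) :
    R.innerForm ⁅a, x⁆ y = R.innerForm x ⁅a, y⁆ := by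
  rw [innerForm_lie, R.θ_𝔞 a ha]
  simp only [neg_lie, map_neg, neg_neg]

lemma commute_ad (a b : R.𝔞) :
    Commute (LieAlgebra.ad ℝ L (a : L)) (LieAlgebra.ad ℝ L (b : L)) := by
  refine LinearMap.ext fun x => ?_
  change ⁅(a : L), ⁅(b : L), x⁆⁆ = ⁅(b : L), ⁅(a : L), x⁆⁆
  rw [leibniz_lie, R.abelian a a.2 b b.2]
  simp

/-- The bracket is linear in its first argument and `x ≠ 0`, so the eigenvalue is automatically a
linear function of `a`. -/
lemma exists_dual_of_joint_eigenvector {x : L} (hx : x ≠ 0) {χ : R.𝔞 → ℝ}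
    (h : ∀ a : R.𝔞, ⁅(a : L), x⁆ = χ a • x) :
    ∃ α : Module.Dual ℝ R.𝔞, x ∈ weightSpace R.𝔞 α := by
  refine ⟨{ toFun := χ, map_add' := fun a b => ?_, map_smul' := fun c a => ?_ }, fun a => h a⟩
  · refine smul_left_injective ℝ hx ?_
    simp only [← h, Submodule.coe_add, add_lie, add_smul]
  · refine smul_left_injective ℝ hx ?_
    simp only [← h, Submodule.coe_smul, smul_lie, RingHom.id_apply, smul_assoc]

/-- The sum of all weight spaces for weights satisfying `p`. -/
def weightSup (p : Module.Dual ℝ R.𝔞 → Prop) : Submodule ℝ L :=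
  ⨆ (α : Module.Dual ℝ R.𝔞) (_ : p α), weightSpace R.𝔞 α

variable {R} in
lemma weightSpace_le_weightSup {p : Module.Dual ℝ R.𝔞 → Prop} {α : Module.Dual ℝ R.𝔞} (h : p α) :
    weightSpace R.𝔞 α ≤ R.weightSup p :=
  le_iSup₂_of_le α h le_rfl

variable {R} in
lemma weightSup_le {p : Module.Dual ℝ R.𝔞 → Prop} {W : Submodule ℝ L}
    (h : ∀ α, p α → ∀ x ∈ weightSpace R.𝔞 α, x ≠ 0 → x ∈ W) : R.weightSup p ≤ W := by
  refine iSup₂_le fun α hα x hx => ?_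
  rcases eq_or_ne x 0 with rfl | hx0
  · exact W.zero_mem
  · exact h α hα x hx hx0

lemma innerForm_eq_zero_of_ne {α β : Module.Dual ℝ R.𝔞} (h : α ≠ β) {x y : L}
    (hx : x ∈ weightSpace R.𝔞 α) (hy : y ∈ weightSpace R.𝔞 β) : R.innerForm x y = 0 := by
  obtain ⟨a, ha⟩ := DFunLike.ne_iff.1 h
  have := R.innerForm_lie_of_mem a.2 x y
  rw [hx a, hy a] at this
  simp only [map_smul, LinearMap.smul_apply, smul_eq_mul] at this
  have h0 : (α a - β a) * R.innerForm x y = 0 := by linarith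
  exact (mul_eq_zero.1 h0).resolve_left (sub_ne_zero.2 ha)

lemma innerForm_weightSup_eq_zero {p q : Module.Dual ℝ R.𝔞 → Prop} (h : ∀ α, p α → ¬ q α)
    {x y : L} (hx : x ∈ R.weightSup p) (hy : y ∈ R.weightSup q) : R.innerForm x y = 0 := by
  have h1 : R.weightSup q ≤ LinearMap.ker (R.innerForm x) := by
    refine weightSup_le fun β hβ z hz _ => ?_
    have h2 : R.weightSup p ≤ LinearMap.ker (R.innerForm z) := by
      refine weightSup_le fun α hα w hw _ => ?_
      rw [LinearMap.mem_ker, innerForm_symm]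
      exact R.innerForm_eq_zero_of_ne (fun e => h α hα (by rw [e]; exact hβ)) hw hz
    rw [LinearMap.mem_ker, innerForm_symm]
    exact h2 hx
  exact h1 hy

lemma θ_mem_weightSpace {α : Module.Dual ℝ R.𝔞} {x : L} (hx : x ∈ weightSpace R.𝔞 α) :
    R.θ x ∈ weightSpace R.𝔞 (-α) := by
  intro a
  have : (a : L) = R.θ (-(a : L)) := by rw [map_neg, R.θ_𝔞 a a.2, neg_neg]
  rw [this, ← LieEquiv.map_lie, neg_lie, hx a, map_neg, map_smul]
  simp

lemma θ_mem_weightSup {p q : Module.Dual ℝ R.𝔞 → Prop} (h : ∀ α, p α → q (-α))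
    {x : L} (hx : x ∈ R.weightSup p) : R.θ x ∈ R.weightSup q := by
  have : R.weightSup p ≤ (R.weightSup q).comap (R.θ : L →ₗ[ℝ] L) :=
    weightSup_le fun α hα z hz _ =>
      weightSpace_le_weightSup (h α hα) (R.θ_mem_weightSpace hz)
  exact this hx

variable {R} in
lemma eq_sum_simple {α : Module.Dual ℝ R.𝔞} {x : L} (hx : x ∈ weightSpace R.𝔞 α) (hx0 : x ≠ 0) :
    (∃ n : ι → ℕ, α = ∑ i, (n i : ℝ) • R.simple i) ∨
      (∃ n : ι → ℕ, α = -∑ i, (n i : ℝ) • R.simple i) := by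
  by_cases hα : α = 0
  · exact Or.inl ⟨0, by simp [hα]⟩
  · exact R.root_sign α ⟨hα, fun h => hx0 (by simpa [h] using hx)⟩

lemma height_neg (S : Finset ι) (α : Module.Dual ℝ R.𝔞) :
    R.height S (-α) = -R.height S α := by
  simp [height]

lemma height_sum (S : Finset ι) (n : ι → ℕ) :
    R.height S (∑ i, (n i : ℝ) • R.simple i) = ∑ i ∈ S, (n i : ℝ) := by
  unfold height
  refine Finset.sum_congr rfl fun i _ => ?_
  rw [R.simple.repr_sum_self]

open Classical in
lemma height_simple (S : Finset ι) (i : ι) :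
    R.height S (R.simple i) = if i ∈ S then 1 else 0 := by
  simp [height, Finsupp.single_apply]

variable {R} in
lemma exists_height_eq_int {α : Module.Dual ℝ R.𝔞} {x : L} (hx : x ∈ weightSpace R.𝔞 α)
    (hx0 : x ≠ 0) (S : Finset ι) : ∃ k : ℤ, R.height S α = k := by
  rcases eq_sum_simple hx hx0 with ⟨n, rfl⟩ | ⟨n, rfl⟩
  · exact ⟨∑ i ∈ S, (n i : ℤ), by rw [height_sum]; push_cast; rfl⟩
  · exact ⟨-∑ i ∈ S, (n i : ℤ), by rw [height_neg, height_sum]; push_cast; rfl⟩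

/-- All weights that occur have integral heights, so a suitable `j''` always exists, namely the
difference of the two heights. Only the inequality for the `Sp`-height remains. -/
lemma filtration_eq (Sp Sq : Finset ι) (k : ℤ) :
    R.filtration Sp Sq k = R.weightSup fun α => (k : ℝ) ≤ R.height Sp α := by
  refine le_antisymm ?_ ?_
  · refine R.filtration_le fun j' j'' hj α hα => weightSpace_le_weightSup ?_
    rw [hα.1]
    exact_mod_cast hj
  · refine weightSup_le fun α hα x hx hx0 => ?_
    obtain ⟨m, hm⟩ := exists_height_eq_int hx hx0 Sp
    obtain ⟨l, hl⟩ := exists_height_eq_int hx hx0 Sq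
    refine R.weightSpace_le_filtration (j' := m) (j'' := l - m) ?_ ⟨hm, ?_⟩ hx
    · rw [hm] at hα
      exact_mod_cast hα
    · rw [hl]; push_cast; ring

lemma filtration_zero (Sp Sq : Finset ι) : R.filtration Sp Sq 0 = R.parabolic Sp := by
  rw [filtration_eq]
  simp [weightSup, parabolic]

lemma filtration_anti (Sp Sq : Finset ι) {k l : ℤ} (h : k ≤ l) :
    R.filtration Sp Sq l ≤ R.filtration Sp Sq k := by
  rw [filtration_eq, filtration_eq]
  refine weightSup_le fun α hα x hx _ => weightSpace_le_weightSup ?_ hx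
  exact le_trans (by exact_mod_cast h) hα

/-- The simple root coefficients of a weight have a common sign. For a negative weight of
`Sq`-height at least `0`, all coefficients on `Sq` vanish, hence also those on `Sp`. -/
lemma parabolic_le_filtration {Sp Sq : Finset ι} (h : Sp ⊆ Sq) {k : ℤ} (hk : k ≤ 0) :
    R.parabolic Sq ≤ R.filtration Sp Sq k := by
  refine le_trans ?_ (R.filtration_anti Sp Sq hk)
  rw [filtration_eq]
  refine weightSup_le (p := fun α => 0 ≤ R.height Sq α) fun α hα x hx hx0 =>
    weightSpace_le_weightSup ?_ hx
  simp only [Int.cast_zero]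
  rcases eq_sum_simple hx hx0 with ⟨n, rfl⟩ | ⟨n, rfl⟩
  · rw [height_sum]; positivity
  · rw [height_neg, height_sum] at hα ⊢
    have : ∑ i ∈ Sp, (n i : ℝ) ≤ ∑ i ∈ Sq, (n i : ℝ) :=
      Finset.sum_le_sum_of_subset_of_nonneg h fun i _ _ => by positivity
    linarith

/-- A weight of positive `Sp`-height cannot be negative, so all its coefficients are non-negative.
-/
lemma filtration_one_le_parabolic (Sp Sq : Finset ι) :
    R.filtration Sp Sq 1 ≤ R.parabolic Sq := by
  rw [filtration_eq]
  refine weightSup_le fun α hα x hx hx0 =>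
    weightSpace_le_weightSup (p := fun α => 0 ≤ R.height Sq α) ?_ hx
  rcases eq_sum_simple hx hx0 with ⟨n, rfl⟩ | ⟨n, rfl⟩
  · rw [height_sum]; positivity
  · rw [height_neg, height_sum] at hα
    have : 0 ≤ ∑ i ∈ Sp, (n i : ℝ) := by positivity
    push_cast at hα
    linarith

/-- A weight vector annihilated by all simple root spaces, whose weight is a sum of negative
roots, has weight zero. -/
lemma weight_eq_zero_of_annihilated {n : ι → ℕ} {x : L}
    (hx : x ∈ weightSpace R.𝔞 (-∑ i, (n i : ℝ) • R.simple i)) (hx0 : x ≠ 0)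
    (h : ∀ i, ∀ e ∈ weightSpace R.𝔞 (R.simple i), ⁅e, x⁆ = 0) :
    (-∑ i, (n i : ℝ) • R.simple i) = 0 := by
  choose e he he0 using fun i => Submodule.exists_mem_ne_zero_of_ne_bot (R.simple_isRoot i).2
  set α := -∑ i, (n i : ℝ) • R.simple i with hα
  -- The element `[e, θ e]` has weight zero and is negated by `θ`, so it lies in `𝔞` by maximality.
  -- It plays the role of a coroot, up to a negative factor.
  have hh𝔞 : ∀ i, ⁅e i, R.θ (e i)⁆ ∈ R.𝔞 := by
    intro i
    refine R.maximal _ ?_ ?_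
    · rw [LieEquiv.map_lie, R.θ_involutive, ← lie_skew]
    · intro a ha
      have := lie_weightSpace (he i) (R.θ_mem_weightSpace (he i)) ⟨a, ha⟩
      simpa using this
  set c : ι → ℝ := fun i => R.innerForm (e i) (e i) with hc
  have hcpos : ∀ i, 0 < c i := fun i => R.innerForm_pos _ (he0 i)
  have hB : ∀ (a : R.𝔞) i, killingForm ℝ L a ⁅e i, R.θ (e i)⁆ = -(c i * R.simple i a) := by
    intro a i
    rw [killing_comm, killing_lie, ← lie_skew, map_neg, neg_neg, he i a, map_smul, killing_comm,
      smul_eq_mul, hc]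
    simp only [innerForm_apply]
    ring
  -- As `e` annihilates `x`, one has `[[e, θ e], x] = [e, [θ e, x]]`. Pairing with `x` and moving
  -- `e` to the other side yields minus the square norm of `[θ e, x]`.
  have hneg : ∀ i, α ⟨_, hh𝔞 i⟩ ≤ 0 := by
    intro i
    have h1 : ⁅⁅e i, R.θ (e i)⁆, x⁆ = ⁅e i, ⁅R.θ (e i), x⁆⁆ := by
      rw [lie_lie, h i _ (he i), lie_zero, sub_zero]
    have h2 := hx ⟨_, hh𝔞 i⟩
    simp only at h2
    rw [h1] at h2
    have h3 : R.innerForm ⁅e i, ⁅R.θ (e i), x⁆⁆ x ≤ 0 := by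
      rw [innerForm_lie]
      have := R.innerForm_self_nonneg ⁅R.θ (e i), x⁆
      linarith
    rw [h2, map_smul, LinearMap.smul_apply, smul_eq_mul] at h3
    have := R.innerForm_pos x hx0
    nlinarith
  -- The coefficients `n i / c i` are chosen so that `H` represents `α` with respect to the Killing
  -- form.
  set H : R.𝔞 := ∑ i, ((n i : ℝ) / c i) • ⟨_, hh𝔞 i⟩ with hH
  have hBH : ∀ a : R.𝔞, killingForm ℝ L a H = α a := by
    intro a
    rw [hH, hα]
    simp only [Submodule.coe_sum, Submodule.coe_smul, map_sum, map_smul, hB, LinearMap.neg_apply,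
      LinearMap.sum_apply, LinearMap.smul_apply, smul_eq_mul, ← Finset.sum_neg_distrib]
    refine Finset.sum_congr rfl fun i _ => ?_
    have := (hcpos i).ne'
    field_simp
  have hle : α H ≤ 0 := by
    rw [hH, map_sum]
    refine Finset.sum_nonpos fun i _ => ?_
    rw [map_smul, smul_eq_mul]
    exact mul_nonpos_of_nonneg_of_nonpos (div_nonneg (by positivity) (hcpos i).le) (hneg i)
  -- On `𝔞` the Killing form is positive definite, and its value on `(H, H)` is `α H ≤ 0`.
  have hH0 : (H : L) = 0 := by
    by_contra hne
    have := R.innerForm_pos _ hne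
    rw [innerForm_apply, R.θ_𝔞 H H.2, map_neg, neg_neg, hBH] at this
    linarith
  refine LinearMap.ext fun a => ?_
  rw [← hBH, hH0]
  simp

variable [Module.Finite ℝ L]

lemma iSup_weightSpace : ⨆ α : Module.Dual ℝ R.𝔞, weightSpace R.𝔞 α = ⊤ := by
  rw [eq_top_iff, ← iSup_iInf_eigenspace_eq_top R.innerForm R.innerForm_symm R.innerForm_pos
    (fun a : R.𝔞 => LieAlgebra.ad ℝ L (a : L)) (fun a x y => R.innerForm_lie_of_mem a.2 x y)
    R.commute_ad]
  refine iSup_le fun χ x hx => ?_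
  rcases eq_or_ne x 0 with rfl | hx0
  · exact zero_mem _
  simp only [Submodule.mem_iInf, Module.End.mem_eigenspace_iff, LieAlgebra.ad_apply] at hx
  obtain ⟨α, hα⟩ := R.exists_dual_of_joint_eigenvector hx0 hx
  exact le_iSup (fun α => weightSpace R.𝔞 α) α hα

lemma exists_weight_vector {N : Submodule ℝ L} (hN : N ≠ ⊥)
    (hinv : ∀ a ∈ R.𝔞, ∀ x ∈ N, ⁅a, x⁆ ∈ N) :
    ∃ x ∈ N, x ≠ 0 ∧ ∃ α : Module.Dual ℝ R.𝔞, x ∈ weightSpace R.𝔞 α := by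
  obtain ⟨x, hxN, hx0, χ, hχ⟩ := exists_joint_eigenvector R.innerForm R.innerForm_symm
    R.innerForm_pos (fun a : R.𝔞 => LieAlgebra.ad ℝ L (a : L))
    (fun a x y => R.innerForm_lie_of_mem a.2 x y) R.commute_ad hN (fun a x hx => hinv a a.2 x hx)
  exact ⟨x, hxN, hx0, R.exists_dual_of_joint_eigenvector hx0 hχ⟩

lemma weightSup_sup_not (p : Module.Dual ℝ R.𝔞 → Prop) :
    R.weightSup p ⊔ R.weightSup (fun α => ¬ p α) = ⊤ := by
  rw [eq_top_iff, ← R.iSup_weightSpace]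
  refine iSup_le fun α => ?_
  by_cases h : p α
  · exact le_sup_of_le_left (weightSpace_le_weightSup h)
  · exact le_sup_of_le_right (weightSpace_le_weightSup h)

/-- The two sums of weight spaces are complementary and orthogonal, so the component of `x` in the
first one is orthogonal to itself. -/
lemma mem_weightSup_not {p : Module.Dual ℝ R.𝔞 → Prop} {x : L}
    (h : ∀ y ∈ R.weightSup p, R.innerForm x y = 0) : x ∈ R.weightSup fun α => ¬ p α := by
  have hx : x ∈ R.weightSup p ⊔ R.weightSup (fun α => ¬ p α) := by
    rw [weightSup_sup_not]; trivial
  obtain ⟨a, ha, b, hb, rfl⟩ := Submodule.mem_sup.1 hx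
  have h1 := h a ha
  rw [map_add, LinearMap.add_apply, R.innerForm_weightSup_eq_zero (fun α h h' => h h') hb ha,
    add_zero] at h1
  have : a = 0 := by
    by_contra h0
    exact (R.innerForm_pos a h0).ne' h1
  simpa [this] using hb

/-- The subspace `𝔤^(1, *)` is the annihilator of `𝔤^(0, *)` for the Killing form. -/
lemma mem_filtration_one_iff (Sp Sq : Finset ι) (x : L) :
    x ∈ R.filtration Sp Sq 1 ↔ ∀ y ∈ R.filtration Sp Sq 0, killingForm ℝ L x y = 0 := by
  simp only [filtration_eq, Int.cast_zero, Int.cast_one]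
  constructor
  · intro hx y hy
    -- The involution negates heights and turns the Killing form into the inner product, so the
    -- claim becomes orthogonality of heights `≥ 1` and heights `≤ 0`.
    have h : R.θ y ∈ R.weightSup fun α => R.height Sp α ≤ 0 :=
      R.θ_mem_weightSup (fun α hα => by rw [height_neg]; linarith) hy
    have := R.innerForm_weightSup_eq_zero (fun α h1 h2 => by linarith) hx h
    rw [innerForm_apply, R.θ_involutive] at this
    linarith
  · intro h
    have hx : x ∈ R.weightSup fun α => ¬ (R.height Sp α ≤ 0) := by
      refine R.mem_weightSup_not fun y hy => ?_
      rw [innerForm_apply, h, neg_zero]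
      exact R.θ_mem_weightSup (fun α hα => by rw [height_neg]; linarith) hy
    refine weightSup_le (fun α hα z hz hz0 => ?_) hx
    refine weightSpace_le_weightSup ?_ hz
    -- Integrality of the height turns `> 0` into `≥ 1`.
    obtain ⟨m, hm⟩ := exists_height_eq_int hz hz0 Sp
    rw [hm] at hα ⊢
    push Not at hα
    have : (0 : ℤ) < m := by exact_mod_cast hα
    exact_mod_cast this

/-- The subspaces `𝔤^(-k, *)` are determined by `𝔤^(1, *)` and `𝔤^(-k+1, *)`. -/
lemma mem_filtration_of_lie_mem (Sp Sq : Finset ι) {k : ℤ} (hk : k ≤ 0) {x : L}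
    (hx : ∀ y ∈ R.filtration Sp Sq 1, ⁅x, y⁆ ∈ R.filtration Sp Sq (k + 1)) :
    x ∈ R.filtration Sp Sq k := by
  have hadd : ∀ {l m : ℤ} {u v : L}, u ∈ R.filtration Sp Sq l → v ∈ R.filtration Sp Sq m →
    ∀ {r : ℤ}, l + m = r → ⁅u, v⁆ ∈ R.filtration Sp Sq r := fun hu hv _ h =>
      h ▸ R.lie_filtration hu hv
  let p : Module.Dual ℝ R.𝔞 → Prop := fun α => R.height Sp α < k
  have hlow : ∀ {u : L}, u ∈ R.weightSup p → ∀ {l : ℤ}, k ≤ l → u ∈ R.filtration Sp Sq l →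
      u = 0 := by
    intro u hu l hl hu'
    by_contra h0
    refine (R.innerForm_pos u h0).ne' ?_
    rw [filtration_eq] at hu'
    refine R.innerForm_weightSup_eq_zero (fun α h1 h2 => ?_) hu hu'
    have : (k : ℝ) ≤ l := by exact_mod_cast hl
    simp only [p] at h1
    linarith
  have hlie : ∀ {α : Module.Dual ℝ R.𝔞}, R.height Sp α = 0 → ∀ {g u : L},
      g ∈ weightSpace R.𝔞 α → u ∈ R.weightSup p → ⁅g, u⁆ ∈ R.weightSup p := by
    intro α hα g u hg hu
    have : R.weightSup p ≤ (R.weightSup p).comap (LieAlgebra.ad ℝ L g : L →ₗ[ℝ] L) :=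
      weightSup_le fun β hβ z hz _ => weightSpace_le_weightSup
        (by simp only [p] at hβ ⊢; rw [height_add, hα]; linarith) (lie_weightSpace hg hz)
    exact this hu
  -- The possible counterexamples of height below `k`. This space is stable under weight vectors of
  -- `Sp`-height zero, in particular under `𝔞`, and the aim is to show that it vanishes.
  let N : Submodule ℝ L :=
    { carrier := {u | u ∈ R.weightSup p ∧
        ∀ y ∈ R.filtration Sp Sq 1, ⁅u, y⁆ ∈ R.filtration Sp Sq (k + 1)}
      add_mem' := fun {u v} hu hv => ⟨add_mem hu.1 hv.1, fun y hy => by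
        rw [add_lie]; exact add_mem (hu.2 y hy) (hv.2 y hy)⟩
      zero_mem' := ⟨zero_mem _, fun y _ => by simp⟩
      smul_mem' := fun c u hu => ⟨Submodule.smul_mem _ _ hu.1, fun y hy => by
        rw [smul_lie]; exact Submodule.smul_mem _ _ (hu.2 y hy)⟩ }
  have hN0 : ∀ {α : Module.Dual ℝ R.𝔞}, R.height Sp α = 0 → ∀ {g u : L},
      g ∈ weightSpace R.𝔞 α → u ∈ N → ⁅g, u⁆ ∈ N := by
    intro α hα g u hg hu
    refine ⟨hlie hα hg hu.1, fun y hy => ?_⟩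
    have hg0 : g ∈ R.filtration Sp Sq 0 := by
      rw [filtration_eq]
      exact weightSpace_le_weightSup (by simp [hα]) hg
    rw [lie_lie]
    exact sub_mem (hadd hg0 (hu.2 y hy) (by ring)) (hu.2 _ (hadd hg0 hy (by ring)))
  have hN : N = ⊥ := by
    by_contra hne
    -- If `N` is nonzero it contains a weight vector. Its `Sp`-height is below `k ≤ 0`, so its
    -- weight is a negative combination; `m` is the sum of the coefficients, to be minimized.
    have key : ∃ m : ℕ, ∃ (n : ι → ℕ) (u : L), u ∈ N ∧ u ≠ 0 ∧ ∑ i, n i = m ∧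
        u ∈ weightSpace R.𝔞 (-∑ i, (n i : ℝ) • R.simple i) := by
      obtain ⟨u, huN, hu0, α, hα⟩ := R.exists_weight_vector hne fun a ha u hu =>
        hN0 (α := 0) (by simp [height]) (fun b => by simpa using R.abelian b b.2 a ha) hu
      have hpα : p α := by
        by_contra hp
        exact (R.innerForm_pos u hu0).ne' (R.innerForm_weightSup_eq_zero (fun β h h' => h' h)
          huN.1 (weightSpace_le_weightSup (p := fun β => ¬ p β) hp hα))
      rcases eq_sum_simple hα hu0 with ⟨n, rfl⟩ | ⟨n, rfl⟩
      · simp only [p] at hpα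
        rw [height_sum] at hpα
        have h1 : 0 ≤ ∑ i ∈ Sp, (n i : ℝ) := by positivity
        have h2 : (k : ℝ) ≤ 0 := by exact_mod_cast hk
        linarith
      · exact ⟨_, n, u, huN, hu0, rfl, hα⟩
    classical
    obtain ⟨n, u, huN, hu0, hn, hu⟩ := Nat.find_spec key
    have hpα : p (-∑ i, (n i : ℝ) • R.simple i) := by
      by_contra hp
      exact (R.innerForm_pos u hu0).ne' (R.innerForm_weightSup_eq_zero (fun β h h' => h' h)
        huN.1 (weightSpace_le_weightSup (p := fun β => ¬ p β) hp hu))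
    -- For `i ∈ Sp`, the bracket lies in `𝔤^(k+1,*)` but has height below `k + 1`, so it is zero.
    -- For `i ∉ Sp`, it stays in `N` and has a smaller coefficient sum, so minimality makes it zero.
    have hann : ∀ i, ∀ e ∈ weightSpace R.𝔞 (R.simple i), ⁅e, u⁆ = 0 := by
      intro i e he
      by_contra hne0
      have hw := lie_weightSpace he hu
      by_cases hi : i ∈ Sp
      · refine hne0 ?_
        have he1 : e ∈ R.filtration Sp Sq 1 := by
          rw [filtration_eq]
          exact weightSpace_le_weightSup (by simp [height_simple, hi]) he
        have h1 : ⁅e, u⁆ ∈ R.filtration Sp Sq (k + 1) := by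
          rw [← lie_skew]
          exact neg_mem (huN.2 e he1)
        by_contra h0
        refine (R.innerForm_pos _ h0).ne' ?_
        rw [filtration_eq] at h1
        refine R.innerForm_weightSup_eq_zero (p := fun β => R.height Sp β < k + 1)
          (fun β h1 h2 => ?_) (weightSpace_le_weightSup ?_ hw) h1
        · push_cast at h2
          linarith
        · simp only [p] at hpα
          rw [height_add, height_simple, if_pos hi]
          linarith
      · have hmem : ⁅e, u⁆ ∈ N := hN0 (by rw [height_simple, if_neg hi]) he huN
        have hni : ∃ n' : ι → ℕ, R.simple i + -∑ j, (n j : ℝ) • R.simple j =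
            -∑ j, (n' j : ℝ) • R.simple j ∧ ∑ j, n' j < ∑ j, n j := by
          have hcoord : ∀ (f : ι → ℝ) (j : ι), R.simple.repr (∑ i, f i • R.simple i) j = f j :=
            fun f j => by rw [R.simple.repr_sum_self]
          -- A positive weight is excluded because bracketing with `e` leaves the negative
          -- `Sp`-height unchanged.
          rcases eq_sum_simple hw hne0 with ⟨n', hn'⟩ | ⟨n', hn'⟩
          · exfalso
            have h1 := congrArg (R.height Sp) hn'
            rw [height_add, height_neg, height_sum, height_sum, height_simple, if_neg hi] at h1
            simp only [p] at hpα
            rw [height_neg, height_sum] at hpα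
            have h2 : (k : ℝ) ≤ 0 := by exact_mod_cast hk
            have h3 : 0 ≤ ∑ i ∈ Sp, (n' i : ℝ) := by positivity
            linarith
          · refine ⟨n', hn', ?_⟩
            have h1 := congrArg (R.height Finset.univ) hn'
            rw [height_add, height_neg, height_neg, height_sum, height_sum, height_simple,
              if_pos (Finset.mem_univ _)] at h1
            have h2 : (∑ j, (n' j : ℝ)) < ∑ j, (n j : ℝ) := by linarith
            exact_mod_cast h2
        obtain ⟨n', hn', hlt⟩ := hni
        rw [hn'] at hw
        exact Nat.find_min key (hn ▸ hlt) ⟨n', _, hmem, hne0, rfl, hw⟩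
    -- The weight of `u` is therefore zero, while its height should be below `k ≤ 0`.
    have h0 := R.weight_eq_zero_of_annihilated hu hu0 hann
    rw [h0] at hpα
    simp only [p, height, map_zero, Finsupp.coe_zero, Pi.zero_apply, Finset.sum_const_zero] at hpα
    have h2 : (k : ℝ) ≤ 0 := by exact_mod_cast hk
    linarith
  have hxs : x ∈ R.weightSup p ⊔ R.weightSup (fun α => ¬ p α) := by
    rw [weightSup_sup_not]; trivial
  obtain ⟨a, ha, b, hb, rfl⟩ := Submodule.mem_sup.1 hxs
  have hb' : b ∈ R.filtration Sp Sq k := by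
    rw [filtration_eq]
    simpa only [p, not_lt] using hb
  -- The part `b` of height at least `k` satisfies the bracket condition by itself, so the condition
  -- passes from `x` to `a`.
  have haN : a ∈ N := by
    refine ⟨ha, fun y hy => ?_⟩
    have := sub_mem (hx y hy) (hadd hb' hy (r := k + 1) rfl)
    rwa [add_lie, add_sub_cancel_right] at this
  rw [hN, Submodule.mem_bot] at haN
  rwa [haN, zero_add]

/-- An automorphism preserving a standard parabolic subalgebra preserves the associated
filtration. -/
lemma map_filtration (Sp Sq : Finset ι) (e : L ≃ₗ⁅ℝ⁆ L)
    (he : ∀ x, e x ∈ R.filtration Sp Sq 0 ↔ x ∈ R.filtration Sp Sq 0) {k : ℤ} (hk : k ≤ 1)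
    (x : L) : e x ∈ R.filtration Sp Sq k ↔ x ∈ R.filtration Sp Sq k := by
  have h1 : ∀ x, e x ∈ R.filtration Sp Sq 1 ↔ x ∈ R.filtration Sp Sq 1 := by
    intro x
    rw [mem_filtration_one_iff, mem_filtration_one_iff]
    constructor
    · intro h y hy
      rw [← LieAlgebra.killingForm_of_equiv_apply e]
      exact h _ ((he y).2 hy)
    · intro h y hy
      rw [← e.apply_symm_apply y, LieAlgebra.killingForm_of_equiv_apply e]
      exact h _ ((he _).1 (by rwa [e.apply_symm_apply]))
  -- Descending induction from `𝔤^(0,*)`: each step characterizes `𝔤^(k,*)` by brackets with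
  -- `𝔤^(1,*)`, which is already known to be invariant.
  have hneg : ∀ m : ℕ, ∀ x, e x ∈ R.filtration Sp Sq (-m) ↔ x ∈ R.filtration Sp Sq (-m) := by
    intro m
    induction m with
    | zero => simpa using he
    | succ m ih =>
      intro x
      have hm : (-((m + 1 : ℕ) : ℤ)) + 1 = -(m : ℤ) := by push_cast; ring
      constructor
      · intro h
        refine R.mem_filtration_of_lie_mem Sp Sq (by omega) fun y hy => ?_
        rw [hm, ← ih, LieEquiv.map_lie]
        have := R.lie_filtration h ((h1 y).2 hy)
        rwa [hm] at this
      · intro h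
        refine R.mem_filtration_of_lie_mem Sp Sq (by omega) fun y hy => ?_
        rw [← e.apply_symm_apply y, ← LieEquiv.map_lie, hm, ih]
        have := R.lie_filtration h ((h1 (e.symm y)).1 (by rwa [e.apply_symm_apply]))
        rwa [hm] at this
  rcases eq_or_lt_of_le hk with rfl | hlt
  · exact h1 x
  · obtain ⟨m, rfl⟩ : ∃ m : ℕ, k = -m := ⟨(-k).toNat, by omega⟩
    exact hneg m x

end RestrictedRootSystem

end Algebra

end

end RelTractor

namespace RelTractor

noncomputable section

/-! ### The adjoint representation of a Lie group and its derivative -/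

section Groups

set_option linter.unusedSectionVars false

open Filter Topology

section Charts

variable {E : Type*} [NormedAddCommGroup E] [NormedSpace ℝ E]
  {N : Type*} [TopologicalSpace N] [ChartedSpace E N]

/-- Tangent spaces are identified with the model space through the preferred chart, so that chart
has identity derivative at its own base point. -/
lemma mfderiv_extChartAt_eq_id [IsManifold 𝓘(ℝ, E) 1 N] {x y : N} (h : y = x) (v : E) :
    (mfderiv 𝓘(ℝ, E) 𝓘(ℝ, E) (extChartAt 𝓘(ℝ, E) x) y : E →L[ℝ] E) v = v := by
  subst h
  rw [mfderiv_extChartAt_self]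
  rfl

lemma mfderiv_extChartAt_symm_eq_id [IsManifold 𝓘(ℝ, E) 1 N] (x : N) (v : E) :
    (mfderiv 𝓘(ℝ, E) 𝓘(ℝ, E) (extChartAt 𝓘(ℝ, E) x).symm (extChartAt 𝓘(ℝ, E) x x) : E →L[ℝ] E) v
      = v := by
  have := mfderivWithin_range_extChartAt_symm (I := 𝓘(ℝ, E)) (x := x)
  rw [modelWithCornersSelf_coe, Set.range_id, mfderivWithin_univ] at this
  rw [this]
  rfl

lemma contMDiffAt_extChartAt_symm [IsManifold 𝓘(ℝ, E) ∞ N] (x : N) :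
    ContMDiffAt 𝓘(ℝ, E) 𝓘(ℝ, E) ∞ (extChartAt 𝓘(ℝ, E) x).symm (extChartAt 𝓘(ℝ, E) x x) := by
  have := contMDiffWithinAt_extChartAt_symm_range (I := 𝓘(ℝ, E)) (n := ∞) x
    (mem_extChartAt_target x)
  rwa [modelWithCornersSelf_coe, Set.range_id, contMDiffWithinAt_univ] at this

end Charts

/-- The chain rule with the intermediate point known only up to an equation. Reading derivatives as
maps of model spaces avoids transport between tangent spaces. -/
lemma mfderiv_comp_apply_of_eq
    {E : Type*} [NormedAddCommGroup E] [NormedSpace ℝ E] {H : Type*} [TopologicalSpace H]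
    {I : ModelWithCorners ℝ E H} {N : Type*} [TopologicalSpace N] [ChartedSpace H N]
    {E' : Type*} [NormedAddCommGroup E'] [NormedSpace ℝ E'] {H' : Type*} [TopologicalSpace H']
    {I' : ModelWithCorners ℝ E' H'} {N' : Type*} [TopologicalSpace N'] [ChartedSpace H' N']
    {E'' : Type*} [NormedAddCommGroup E''] [NormedSpace ℝ E''] {H'' : Type*} [TopologicalSpace H'']
    {I'' : ModelWithCorners ℝ E'' H''} {N'' : Type*} [TopologicalSpace N''] [ChartedSpace H'' N'']
    {g : N' → N''} {f : N → N'} {x : N} {y : N'} (h : f x = y)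
    (hg : MDifferentiableAt I' I'' g y) (hf : MDifferentiableAt I I' f x) (v : E) :
    (mfderiv I I'' (fun z => g (f z)) x : E →L[ℝ] E'') v =
      (mfderiv I' I'' g y : E' →L[ℝ] E'') ((mfderiv I I' f x : E →L[ℝ] E') v) := by
  subst h
  exact congrArg (fun A : E →L[ℝ] E'' => A v) (mfderiv_comp (I' := I') x hg hf)

variable {EG : Type*} [NormedAddCommGroup EG] [NormedSpace ℝ EG] [FiniteDimensional ℝ EG]
  {G : Type*} [TopologicalSpace G] [ChartedSpace EG G] [Group G] [LieGroup 𝓘(ℝ, EG) ∞ G]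

lemma contMDiff_conj :
    ContMDiff (𝓘(ℝ, EG).prod 𝓘(ℝ, EG)) 𝓘(ℝ, EG) ∞ (fun z : G × G => z.1 * z.2 * z.1⁻¹) :=
  (contMDiff_fst.mul contMDiff_snd).mul contMDiff_fst.inv

lemma contMDiff_conj_left (g : G) :
    ContMDiff 𝓘(ℝ, EG) 𝓘(ℝ, EG) ∞ (fun x : G => g * x * g⁻¹) :=
  contMDiff_conj.comp (contMDiff_const.prodMk contMDiff_id)

lemma Ad_apply (g : G) (x : GroupLieAlgebra 𝓘(ℝ, EG) G) :
    Ad g x = mfderiv 𝓘(ℝ, EG) 𝓘(ℝ, EG) (fun x : G => g * x * g⁻¹) 1 x := rfl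

lemma Ad_one (x : GroupLieAlgebra 𝓘(ℝ, EG) G) : Ad (1 : G) x = x := by
  rw [Ad_apply]
  have : (fun x : G => 1 * x * 1⁻¹) = id := by ext; simp
  rw [this, mfderiv_id]
  rfl

lemma mfderiv_congr_base {E : Type*} [NormedAddCommGroup E] [NormedSpace ℝ E]
    {N : Type*} [TopologicalSpace N] [ChartedSpace E N]
    {E' : Type*} [NormedAddCommGroup E'] [NormedSpace ℝ E']
    {N' : Type*} [TopologicalSpace N'] [ChartedSpace E' N'] (f : N → N') {x y : N} (h : x = y) :
    (mfderiv 𝓘(ℝ, E) 𝓘(ℝ, E') f x : E →L[ℝ] E') = mfderiv 𝓘(ℝ, E) 𝓘(ℝ, E') f y := by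
  subst h; rfl

lemma Ad_mul (g h : G) (x : GroupLieAlgebra 𝓘(ℝ, EG) G) : Ad (g * h) x = Ad g (Ad h x) := by
  rw [Ad_apply, Ad_apply, Ad_apply]
  have : (fun x : G => g * h * x * (g * h)⁻¹) =
      (fun x : G => g * x * g⁻¹) ∘ (fun x : G => h * x * h⁻¹) := by
    ext; simp [mul_assoc]
  rw [this, mfderiv_comp (I' := 𝓘(ℝ, EG)) _
    ((contMDiff_conj_left g).mdifferentiable (by simp) _)
    ((contMDiff_conj_left h).mdifferentiable (by simp) _)]
  have e : h * 1 * h⁻¹ = 1 := by simp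
  exact congrArg (fun A : EG →L[ℝ] EG => A (Ad h x))
    (mfderiv_congr_base (E := EG) (E' := EG) (fun x : G => g * x * g⁻¹) e)

lemma Ad_inv_Ad (g : G) (x : GroupLieAlgebra 𝓘(ℝ, EG) G) : Ad g⁻¹ (Ad g x) = x := by
  rw [← Ad_mul, inv_mul_cancel, Ad_one]

lemma Ad_Ad_inv (g : G) (x : GroupLieAlgebra 𝓘(ℝ, EG) G) : Ad g (Ad g⁻¹ x) = x := by
  rw [← Ad_mul, mul_inv_cancel, Ad_one]

/-- The orbit map `g ↦ Ad(g) x`, as a map into the model space. -/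
def AdOrbit (x : GroupLieAlgebra 𝓘(ℝ, EG) G) : G → EG := fun g => Ad g x

/-- The map `g ↦ Ad(g) x` is smooth. -/
lemma contMDiff_AdOrbit (x : GroupLieAlgebra 𝓘(ℝ, EG) G) :
    ContMDiff 𝓘(ℝ, EG) 𝓘(ℝ, EG) ∞ (AdOrbit x) := by
  intro g₀
  let v : EG := x
  have key := ContMDiffAt.mfderiv_apply (I := 𝓘(ℝ, EG)) (I' := 𝓘(ℝ, EG)) (J := 𝓘(ℝ, EG))
    (J' := 𝓘(ℝ, EG)) (n := ∞) (m := ∞) (x₀ := g₀)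
    (fun (g : G) (h : G) => g * h * g⁻¹) (fun _ : G => (1 : G)) (id : G → G) (fun _ => v)
    contMDiff_conj.contMDiffAt contMDiffAt_const contMDiffAt_id contMDiffAt_const (by simp)
  refine key.congr_of_eventuallyEq (Eventually.of_forall fun g => ?_)
  simp only [id]
  -- Every conjugation fixes `1`, so both changes of coordinates are taken at the base point of the
  -- chart and are identities.
  rw [inTangentCoordinates_eq_mfderiv_comp (I := 𝓘(ℝ, EG)) (I' := 𝓘(ℝ, EG)) (by simp) (by simp)]
  have h1 : (mfderivWithin 𝓘(ℝ, EG) 𝓘(ℝ, EG) (extChartAt 𝓘(ℝ, EG) (1 : G)).symm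
      (Set.range 𝓘(ℝ, EG)) (extChartAt 𝓘(ℝ, EG) (1 : G) 1) : EG →L[ℝ] EG) x = x := by
    rw [modelWithCornersSelf_coe, Set.range_id, mfderivWithin_univ]
    exact mfderiv_extChartAt_symm_eq_id (E := EG) (1 : G) x
  have h2 := mfderiv_extChartAt_eq_id (E := EG) (x := g₀ * 1 * g₀⁻¹) (y := g * 1 * g⁻¹)
    (by simp) (Ad g x)
  exact (h2.symm.trans (congrArg _ (congrArg (Ad g) h1.symm)) :)

lemma inverse_apply_of_eq_id {E : Type*} [NormedAddCommGroup E] [NormedSpace ℝ E] {A : E →L[ℝ] E}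
    (h : A = ContinuousLinearMap.id ℝ E) (w : E) : A.inverse w = w := by
  rw [h, ContinuousLinearMap.inverse_id]
  rfl

/-- The bracket is computed in the chart at `1`, whose derivative at `1` is the identity. Only the
germs of the coordinate expressions `V'` and `W'` matter. -/
lemma mlieBracket_one_eq (V W : ∀ g : G, TangentSpace 𝓘(ℝ, EG) g) {V' W' : EG → EG}
    (hV : ∀ᶠ a in 𝓝 (extChartAt 𝓘(ℝ, EG) (1 : G) 1),
      V' a = mfderiv 𝓘(ℝ, EG) 𝓘(ℝ, EG) (extChartAt 𝓘(ℝ, EG) (1 : G))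
        ((extChartAt 𝓘(ℝ, EG) (1 : G)).symm a) (V ((extChartAt 𝓘(ℝ, EG) (1 : G)).symm a)))
    (hW : ∀ᶠ a in 𝓝 (extChartAt 𝓘(ℝ, EG) (1 : G) 1),
      W' a = mfderiv 𝓘(ℝ, EG) 𝓘(ℝ, EG) (extChartAt 𝓘(ℝ, EG) (1 : G))
        ((extChartAt 𝓘(ℝ, EG) (1 : G)).symm a) (W ((extChartAt 𝓘(ℝ, EG) (1 : G)).symm a))) :
    (VectorField.mlieBracket 𝓘(ℝ, EG) V W (1 : G) : EG) =
      VectorField.lieBracket ℝ V' W' (extChartAt 𝓘(ℝ, EG) (1 : G) 1) := by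
  have hpull : ∀ (U : ∀ g : G, TangentSpace 𝓘(ℝ, EG) g) (U' : EG → EG),
      (∀ᶠ a in 𝓝 (extChartAt 𝓘(ℝ, EG) (1 : G) 1),
      U' a = mfderiv 𝓘(ℝ, EG) 𝓘(ℝ, EG) (extChartAt 𝓘(ℝ, EG) (1 : G))
        ((extChartAt 𝓘(ℝ, EG) (1 : G)).symm a) (U ((extChartAt 𝓘(ℝ, EG) (1 : G)).symm a))) →
      VectorField.mpullbackWithin 𝓘(ℝ, EG) 𝓘(ℝ, EG) (extChartAt 𝓘(ℝ, EG) (1 : G)).symm U Set.univ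
        =ᶠ[𝓝 (extChartAt 𝓘(ℝ, EG) (1 : G) 1)] U' := by
    intro U U' h
    filter_upwards [h, extChartAt_target_mem_nhds (I := 𝓘(ℝ, EG)) (1 : G)] with a ha hat
    rw [ha, VectorField.mpullbackWithin_apply]
    have h1 := mfderiv_extChartAt_comp_mfderivWithin_extChartAt_symm (I := 𝓘(ℝ, EG)) hat
    have h2 := mfderivWithin_extChartAt_symm_comp_mfderiv_extChartAt (I := 𝓘(ℝ, EG)) hat
    rw [modelWithCornersSelf_coe, Set.range_id] at h1 h2
    rw [ContinuousLinearMap.inverse_eq h2 h1]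
    rfl
  rw [VectorField.mlieBracket, VectorField.mlieBracketWithin_apply]
  refine (inverse_apply_of_eq_id (E := EG)
    (mfderiv_extChartAt_self (I := 𝓘(ℝ, EG)) (x := (1 : G))) _).trans ?_
  rw [modelWithCornersSelf_coe, Set.range_id, Set.preimage_univ, Set.inter_univ]
  refine Eq.trans (α := EG) (congrFun (VectorField.lieBracketWithin_univ (E := EG)) _) ?_
  exact Filter.EventuallyEq.lieBracket_vectorField_eq (E := EG) (hpull V V' hV) (hpull W W' hW)

/-- The derivative of the orbit map as a bracket of left-invariant vector fields. -/
lemma mfderiv_AdOrbit_one_eq_mlieBracket (x y : EG) :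
    (mfderiv 𝓘(ℝ, EG) 𝓘(ℝ, EG) (AdOrbit x) (1 : G) : EG →L[ℝ] EG) y =
      (VectorField.mlieBracket 𝓘(ℝ, EG) (mulInvariantVectorField (I := 𝓘(ℝ, EG)) y)
        (mulInvariantVectorField (I := 𝓘(ℝ, EG)) x) (1 : G) : EG) := by
  set φ := extChartAt 𝓘(ℝ, EG) (1 : G) with hφ
  set e₀ : EG := φ 1 with he₀
  have hψ0 : φ.symm e₀ = 1 := extChartAt_to_inv (I := 𝓘(ℝ, EG)) (1 : G)
  have hψ : ContMDiffAt 𝓘(ℝ, EG) 𝓘(ℝ, EG) ∞ φ.symm e₀ := contMDiffAt_extChartAt_symm (1 : G)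
  have hφsmooth : ∀ g ∈ (chartAt EG (1 : G)).source, ContMDiffAt 𝓘(ℝ, EG) 𝓘(ℝ, EG) ∞ φ g :=
    fun g hg => contMDiffAt_extChartAt' hg
  -- The multiplication in the chart at `1`. Its partial derivatives at `(a, e₀)` and `(e₀, a)`
  -- express the left- and right-invariant vector fields.
  let m : EG × EG → EG := fun z => φ (φ.symm z.1 * φ.symm z.2)
  have hm : ContDiffAt ℝ ∞ m (e₀, e₀) := by
    rw [← contMDiffAt_iff_contDiffAt]
    have h1 : ContMDiffAt 𝓘(ℝ, EG × EG) 𝓘(ℝ, EG) ∞ (fun z : EG × EG => φ.symm z.1) (e₀, e₀) :=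
      ContMDiffAt.comp (e₀, e₀) (g := φ.symm) hψ contDiff_fst.contDiffAt.contMDiffAt
    have h2 : ContMDiffAt 𝓘(ℝ, EG × EG) 𝓘(ℝ, EG) ∞ (fun z : EG × EG => φ.symm z.2) (e₀, e₀) :=
      ContMDiffAt.comp (e₀, e₀) (g := φ.symm) hψ contDiff_snd.contDiffAt.contMDiffAt
    refine ContMDiffAt.comp (e₀, e₀) (g := φ) (hφsmooth _ ?_) (h1.mul h2)
    simp [hψ0]
  have hmd : ∀ᶠ z in 𝓝 (e₀, e₀), DifferentiableAt ℝ m z := by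
    have h1 : ContDiffAt ℝ 1 m (e₀, e₀) := hm.of_le (by norm_cast)
    filter_upwards [h1.eventually (by simp)] with z hz
    exact hz.differentiableAt (by simp)
  have hsrc : ∀ᶠ a in 𝓝 e₀, φ.symm a ∈ (chartAt EG (1 : G)).source := by
    refine hψ.continuousAt.eventually_mem ?_
    rw [hψ0]
    exact chart_source_mem_nhds EG (1 : G)
  have hLd : ∀ (g h : G), MDifferentiableAt 𝓘(ℝ, EG) 𝓘(ℝ, EG) (fun k : G => g * k) h := fun g h =>
    (contMDiff_mul_left (I := 𝓘(ℝ, EG)) (n := ∞) (a := g)).mdifferentiable (by simp) h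
  have hRd : ∀ (g h : G), MDifferentiableAt 𝓘(ℝ, EG) 𝓘(ℝ, EG) (fun k : G => k * g) h := fun g h =>
    (contMDiff_mul_right (I := 𝓘(ℝ, EG)) (n := ∞) (a := g)).mdifferentiable (by simp) h
  have hψd : MDifferentiableAt 𝓘(ℝ, EG) 𝓘(ℝ, EG) φ.symm e₀ := hψ.mdifferentiableAt (by simp)
  have hψid : ∀ v : EG, (mfderiv 𝓘(ℝ, EG) 𝓘(ℝ, EG) φ.symm e₀ : EG →L[ℝ] EG) v = v :=
    fun v => mfderiv_extChartAt_symm_eq_id (1 : G) v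
  have hL : ∀ᶠ a in 𝓝 e₀, ∀ v : EG, fderiv ℝ m (a, e₀) (0, v) =
      (mfderiv 𝓘(ℝ, EG) 𝓘(ℝ, EG) (fun k : G => φ (φ.symm a * k)) 1 : EG →L[ℝ] EG) v := by
    have h1 : Tendsto (fun a : EG => (a, e₀)) (𝓝 e₀) (𝓝 (e₀, e₀)) :=
      (Continuous.prodMk_left e₀).tendsto e₀
    filter_upwards [h1.eventually hmd, hsrc] with a ha has v
    have h2 : HasFDerivAt (fun b => m (a, b))
        ((fderiv ℝ m (a, e₀)).comp (ContinuousLinearMap.inr ℝ EG EG)) e₀ :=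
      ha.hasFDerivAt.comp e₀ (hasFDerivAt_prodMk_right a e₀)
    have h3 : fderiv ℝ (fun b => m (a, b)) e₀ v = fderiv ℝ m (a, e₀) (0, v) := by
      rw [h2.fderiv]; rfl
    have hφd : MDifferentiableAt 𝓘(ℝ, EG) 𝓘(ℝ, EG) φ (φ.symm a * 1) := by
      rw [mul_one]
      exact (hφsmooth _ has).mdifferentiableAt (by simp)
    rw [← h3, ← mfderiv_eq_fderiv]
    refine (mfderiv_comp_apply_of_eq (E := EG) (E' := EG) (E'' := EG)
      (g := fun k : G => φ (φ.symm a * k)) hψ0 (hφd.comp (1 : G) (hLd _ _)) hψd v).trans ?_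
    rw [hψid]
  have hR : ∀ᶠ a in 𝓝 e₀, ∀ v : EG, fderiv ℝ m (e₀, a) (v, 0) =
      (mfderiv 𝓘(ℝ, EG) 𝓘(ℝ, EG) (fun k : G => φ (k * φ.symm a)) 1 : EG →L[ℝ] EG) v := by
    have h1 : Tendsto (fun a : EG => (e₀, a)) (𝓝 e₀) (𝓝 (e₀, e₀)) :=
      (Continuous.prodMk_right e₀).tendsto e₀
    filter_upwards [h1.eventually hmd, hsrc] with a ha has v
    have h2 : HasFDerivAt (fun b => m (b, a))
        ((fderiv ℝ m (e₀, a)).comp (ContinuousLinearMap.inl ℝ EG EG)) e₀ :=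
      HasFDerivAt.comp (g := m) (f := fun b => (b, a)) e₀ ha.hasFDerivAt
        (hasFDerivAt_prodMk_left e₀ a)
    have h3 : fderiv ℝ (fun b => m (b, a)) e₀ v = fderiv ℝ m (e₀, a) (v, 0) := by
      rw [h2.fderiv]; rfl
    have hφd : MDifferentiableAt 𝓘(ℝ, EG) 𝓘(ℝ, EG) φ (1 * φ.symm a) := by
      rw [one_mul]
      exact (hφsmooth _ has).mdifferentiableAt (by simp)
    rw [← h3, ← mfderiv_eq_fderiv]
    refine (mfderiv_comp_apply_of_eq (E := EG) (E' := EG) (E'' := EG)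
      (g := fun k : G => φ (k * φ.symm a)) hψ0 (hφd.comp (1 : G) (hRd _ _)) hψd v).trans ?_
    rw [hψid]
  let F : EG → EG := fun a => AdOrbit x (φ.symm a)
  -- The infinitesimal form of `(g k g⁻¹) g = g k`: the right-invariant field of `Ad(g) x` agrees at
  -- `g` with the left-invariant field of `x`.
  have hRL : ∀ᶠ a in 𝓝 e₀, fderiv ℝ m (e₀, a) (F a, 0) = fderiv ℝ m (a, e₀) (0, x) := by
    filter_upwards [hL, hR, hsrc] with a h1 h2 has
    rw [h1, h2]
    have hφd : MDifferentiableAt 𝓘(ℝ, EG) 𝓘(ℝ, EG) φ (1 * φ.symm a) := by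
      rw [one_mul]
      exact (hφsmooth _ has).mdifferentiableAt (by simp)
    have h3 := mfderiv_comp_apply_of_eq (E := EG) (E' := EG) (E'' := EG)
      (g := fun k : G => φ (k * φ.symm a)) (f := fun k : G => φ.symm a * k * (φ.symm a)⁻¹)
      (x := 1) (y := 1) (by simp) (hφd.comp (1 : G) (hRd _ _))
      ((contMDiff_conj_left (φ.symm a)).mdifferentiable (by simp) 1) x
    refine Eq.trans h3.symm ?_
    exact congrArg (fun f : G → EG => (mfderiv 𝓘(ℝ, EG) 𝓘(ℝ, EG) f 1 : EG →L[ℝ] EG) x)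
      (funext fun k => by simp only [inv_mul_cancel_right])
  have hL0 : ∀ v : EG, fderiv ℝ m (e₀, e₀) (0, v) = v := by
    intro v
    rw [hL.self_of_nhds, hψ0]
    have h : (fun k : G => φ (1 * k)) = φ := funext fun k => by rw [one_mul]
    rw [h]
    exact mfderiv_extChartAt_eq_id (x := (1 : G)) rfl v
  have hR0 : ∀ v : EG, fderiv ℝ m (e₀, e₀) (v, 0) = v := by
    intro v
    rw [hR.self_of_nhds, hψ0]
    have h : (fun k : G => φ (k * 1)) = φ := funext fun k => by rw [mul_one]
    rw [h]
    exact mfderiv_extChartAt_eq_id (x := (1 : G)) rfl v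
  have hF0 : F e₀ = x := by
    simp only [F, hψ0]
    exact Ad_one x
  have hDd : HasFDerivAt (fderiv ℝ m) (fderiv ℝ (fderiv ℝ m) (e₀, e₀)) (e₀, e₀) :=
    ((hm.fderiv_right (m := 1) (by norm_cast)).differentiableAt (by simp)).hasFDerivAt
  set D₂ := fderiv ℝ (fderiv ℝ m) (e₀, e₀) with hD₂
  have hsymm : ∀ v w, D₂ v w = D₂ w v :=
    (hm.isSymmSndFDerivAt (by simpa using ENat.LEInfty.out)).eq
  have hleft : ∀ v : EG, HasFDerivAt (fun a => fderiv ℝ m (a, e₀) (0, v))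
      ((ContinuousLinearMap.apply ℝ EG ((0, v) : EG × EG)).comp
        (D₂.comp (ContinuousLinearMap.inl ℝ EG EG))) e₀ := fun v =>
    HasFDerivAt.comp (f := fun a => fderiv ℝ m (a, e₀)) e₀
      (ContinuousLinearMap.apply ℝ EG ((0, v) : EG × EG)).hasFDerivAt
      (HasFDerivAt.comp (g := fderiv ℝ m) (f := fun b => (b, e₀)) e₀ hDd
        (hasFDerivAt_prodMk_left e₀ e₀))
  have hFd : DifferentiableAt ℝ F e₀ := by
    rw [← mdifferentiableAt_iff_differentiableAt]
    exact ((contMDiff_AdOrbit x).mdifferentiable (by simp) _).comp e₀ hψd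
  have hFderiv : ∀ v : EG, fderiv ℝ F e₀ v =
      (mfderiv 𝓘(ℝ, EG) 𝓘(ℝ, EG) (AdOrbit x) (1 : G) : EG →L[ℝ] EG) v := by
    intro v
    rw [← mfderiv_eq_fderiv]
    refine (mfderiv_comp_apply_of_eq (E := EG) (E' := EG) (E'' := EG) hψ0
      ((contMDiff_AdOrbit x).mdifferentiable (by simp) _) hψd v).trans ?_
    rw [hψid]
  have hprod : HasFDerivAt (fun a => fderiv ℝ m (e₀, a) (F a, 0)) _ e₀ :=
    (hDd.comp e₀ (hasFDerivAt_prodMk_right e₀ e₀)).clm_apply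
      ((ContinuousLinearMap.inl ℝ EG EG).hasFDerivAt.comp e₀ hFd.hasFDerivAt)
  -- Differentiating `hRL` at `e₀` in direction `y` gives `D₂ (0,y) (x,0) + F'(y) = D₂ (y,0) (0,x)`.
  have heq := (hprod.congr_of_eventuallyEq (f₁ := fun a => fderiv ℝ m (a, e₀) (0, x))
    (hRL.mono fun a ha => ha.symm)).unique (hleft x)
  have heq' := DFunLike.congr_fun heq y
  simp only [add_apply, ContinuousLinearMap.comp_apply,
    ContinuousLinearMap.flip_apply, Function.comp_apply, ContinuousLinearMap.apply_apply,
    ContinuousLinearMap.inl_apply, ContinuousLinearMap.inr_apply, hF0, hFderiv] at heq'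
  have hbr : (VectorField.mlieBracket 𝓘(ℝ, EG) (mulInvariantVectorField (I := 𝓘(ℝ, EG)) y)
        (mulInvariantVectorField (I := 𝓘(ℝ, EG)) x) (1 : G) : EG) =
      VectorField.lieBracket ℝ (fun a => fderiv ℝ m (a, e₀) (0, y))
        (fun a => fderiv ℝ m (a, e₀) (0, x)) e₀ := by
    have hinv : ∀ v : EG, ∀ᶠ a in 𝓝 e₀, fderiv ℝ m (a, e₀) (0, v) =
        (mfderiv 𝓘(ℝ, EG) 𝓘(ℝ, EG) φ (φ.symm a) : EG →L[ℝ] EG)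
          (mulInvariantVectorField (I := 𝓘(ℝ, EG)) (G := G) v (φ.symm a)) := by
      intro v
      filter_upwards [hL, hsrc] with a h1 has
      rw [h1]
      exact mfderiv_comp_apply_of_eq (E := EG) (E' := EG) (E'' := EG) (g := φ)
        (f := fun k : G => φ.symm a * k) (mul_one (φ.symm a))
        ((hφsmooth _ has).mdifferentiableAt (by simp)) (hLd _ _) v
    exact mlieBracket_one_eq _ _ (hinv y) (hinv x)
  rw [hbr, VectorField.lieBracket, (hleft x).fderiv, (hleft y).fderiv]
  simp only [ContinuousLinearMap.comp_apply, ContinuousLinearMap.apply_apply,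
    ContinuousLinearMap.inl_apply, hL0]
  -- The bracket is `D₂ (y,0) (0,x) - D₂ (x,0) (0,y)`; symmetry of the second derivative identifies
  -- it with `F'(y)`.
  rw [hsymm (x, 0) (0, y)]
  exact eq_sub_of_add_eq ((congrArg (· + _) (hR0 _).symm).trans heq')

/-- The derivative of the adjoint representation of `G` is the adjoint representation of its Lie
algebra. -/
lemma mfderiv_AdOrbit_one (x y : GroupLieAlgebra 𝓘(ℝ, EG) G) :
    (mfderiv 𝓘(ℝ, EG) 𝓘(ℝ, EG) (AdOrbit x) (1 : G) : EG →L[ℝ] EG) y =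
      (⁅y, x⁆ : GroupLieAlgebra 𝓘(ℝ, EG) G) :=
  mfderiv_AdOrbit_one_eq_mlieBracket (EG := EG) (G := G) x y

/-- The adjoint action preserves the Lie bracket. -/
lemma Ad_lie (g : G) (x y : GroupLieAlgebra 𝓘(ℝ, EG) G) : Ad g ⁅x, y⁆ = ⁅Ad g x, Ad g y⁆ := by
  let A : EG →L[ℝ] EG := mfderiv 𝓘(ℝ, EG) 𝓘(ℝ, EG) (fun x : G => g * x * g⁻¹) 1
  have hA : ∀ v : EG, MDifferentiableAt 𝓘(ℝ, EG) 𝓘(ℝ, EG) A v := fun v =>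
    A.differentiableAt.mdifferentiableAt
  have hd : ∀ (z : GroupLieAlgebra 𝓘(ℝ, EG) G) (h : G),
      MDifferentiableAt 𝓘(ℝ, EG) 𝓘(ℝ, EG) (AdOrbit z) h := fun z h =>
    (contMDiff_AdOrbit z).mdifferentiable (by simp) h
  -- Both sides of `Ad(g) Ad(h) y = Ad(g h g⁻¹) Ad(g) y` are differentiated at `h = 1` in direction
  -- `x`.
  have h1 := mfderiv_comp_apply_of_eq (E := EG) (E' := EG) (E'' := EG) (g := A)
    (f := AdOrbit (G := G) y) (x := 1) rfl (hA _) (hd y 1) x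
  have h2 := mfderiv_comp_apply_of_eq (E := EG) (E' := EG) (E'' := EG) (g := AdOrbit (Ad g y))
    (f := fun h : G => g * h * g⁻¹) (x := 1) (y := 1) (by simp) (hd _ 1)
    ((contMDiff_conj_left g).mdifferentiable (by simp) 1) x
  rw [mfderiv_AdOrbit_one, mfderiv_eq_fderiv, A.fderiv] at h1
  have h3 : (fun h : G => A (AdOrbit y h)) =
      fun h : G => AdOrbit (Ad g y) (g * h * g⁻¹) := by
    funext h
    change Ad g (Ad h y) = Ad (g * h * g⁻¹) (Ad g y)
    rw [← Ad_mul, ← Ad_mul, inv_mul_cancel_right]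
  rw [h3] at h1
  exact h1.symm.trans (h2.trans (mfderiv_AdOrbit_one (Ad g y) (Ad g x)))

/-- The adjoint action as an automorphism of the Lie algebra. -/
def AdEquiv (g : G) : GroupLieAlgebra 𝓘(ℝ, EG) G ≃ₗ⁅ℝ⁆ GroupLieAlgebra 𝓘(ℝ, EG) G :=
  { Ad g with
    map_lie' := fun {x y} => Ad_lie g x y
    invFun := Ad g⁻¹
    left_inv := Ad_inv_Ad g
    right_inv := Ad_Ad_inv g }

lemma AdEquiv_apply (g : G) (x : GroupLieAlgebra 𝓘(ℝ, EG) G) : AdEquiv g x = Ad g x := rfl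

end Groups

end

end RelTractor

namespace RelTractor

noncomputable section

/-! ### Calculus of functions with values in a finite-dimensional real vector space -/

section Calculus

set_option linter.unusedSectionVars false

open Filter Topology

variable {E : Type*} [NormedAddCommGroup E] [NormedSpace ℝ E]
  {N : Type*} [TopologicalSpace N] [ChartedSpace E N]
  {E' : Type*} [NormedAddCommGroup E'] [NormedSpace ℝ E']
  {N' : Type*} [TopologicalSpace N'] [ChartedSpace E' N']
  {W : Type*} [AddCommGroup W] [Module ℝ W]
  {W' : Type*} [AddCommGroup W'] [Module ℝ W']
  {W'' : Type*} [AddCommGroup W''] [Module ℝ W'']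

/-- Smoothness at a point of a function with values in a finite-dimensional real vector space. -/
def IsSmoothAt (f : N → W) (u : N) : Prop :=
  ∀ φ : Module.Dual ℝ W, ContMDiffAt 𝓘(ℝ, E) 𝓘(ℝ, ℝ) ∞ (fun v => φ (f v)) u

lemma isSmooth_iff {f : N → W} : IsSmooth (E := E) f ↔ ∀ u, IsSmoothAt (E := E) f u :=
  ⟨fun h _ φ => (h φ).contMDiffAt, fun h φ u => h u φ⟩

lemma IsSmooth.isSmoothAt {f : N → W} (h : IsSmooth (E := E) f) (u : N) :
    IsSmoothAt (E := E) f u :=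
  isSmooth_iff.1 h u

namespace IsSmoothAt

variable {u : N} {f g : N → W}

lemma linear (hf : IsSmoothAt (E := E) f u) (T : W →ₗ[ℝ] W') :
    IsSmoothAt (E := E) (fun v => T (f v)) u := fun φ => hf (φ.comp T)

lemma congr (hf : IsSmoothAt (E := E) f u) (h : ∀ᶠ v in 𝓝 u, g v = f v) :
    IsSmoothAt (E := E) g u := fun φ =>
  (hf φ).congr_of_eventuallyEq (h.mono fun v hv => by simp only [hv])

lemma const (w : W) : IsSmoothAt (E := E) (fun _ : N => w) u := fun _ => contMDiffAt_const

lemma add (hf : IsSmoothAt (E := E) f u) (hg : IsSmoothAt (E := E) g u) :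
    IsSmoothAt (E := E) (fun v => f v + g v) u := fun φ => by
  simp only [map_add]
  exact (hf φ).add (hg φ)

lemma sub (hf : IsSmoothAt (E := E) f u) (hg : IsSmoothAt (E := E) g u) :
    IsSmoothAt (E := E) (fun v => f v - g v) u := fun φ => by
  simp only [map_sub]
  exact (hf φ).sub (hg φ)

lemma smul {c : N → ℝ} (hc : ContMDiffAt 𝓘(ℝ, E) 𝓘(ℝ, ℝ) ∞ c u) (hf : IsSmoothAt (E := E) f u) :
    IsSmoothAt (E := E) (fun v => c v • f v) u := fun φ => by
  simp only [map_smul, smul_eq_mul]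
  exact hc.mul (hf φ)

lemma sum {κ : Type*} {s : Finset κ} {f : κ → N → W}
    (hf : ∀ i ∈ s, IsSmoothAt (E := E) (f i) u) :
    IsSmoothAt (E := E) (fun v => ∑ i ∈ s, f i v) u := fun φ => by
  simp only [map_sum]
  exact contMDiffAt_finsetSum fun i hi => hf i hi φ

lemma comp {h : N' → N} {x : N'} (hf : IsSmoothAt (E := E) f (h x))
    (hh : ContMDiffAt 𝓘(ℝ, E') 𝓘(ℝ, E) ∞ h x) : IsSmoothAt (E := E') (fun v => f (h v)) x :=
  fun φ => (hf φ).comp x hh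

lemma repr {κ : Type*} [Fintype κ] (b : Module.Basis κ ℝ W) (hf : IsSmoothAt (E := E) f u) (i : κ) :
    ContMDiffAt 𝓘(ℝ, E) 𝓘(ℝ, ℝ) ∞ (fun v => b.repr (f v) i) u :=
  hf (b.coord i)

lemma bilin [Module.Finite ℝ W] (B : W →ₗ[ℝ] W' →ₗ[ℝ] W'') {g : N → W'}
    (hf : IsSmoothAt (E := E) f u) (hg : IsSmoothAt (E := E) g u) :
    IsSmoothAt (E := E) (fun v => B (f v) (g v)) u := by
  let b := Module.finBasis ℝ W
  have : IsSmoothAt (E := E) (fun v => ∑ i, b.repr (f v) i • B (b i) (g v)) u :=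
    sum fun i _ => smul (hf.repr b i) (hg.linear _)
  refine this.congr (Eventually.of_forall fun v => ?_)
  conv_lhs => rw [← b.sum_repr (f v)]
  simp only [map_sum, LinearMap.sum_apply, map_smul, LinearMap.smul_apply]

variable {F : Type*} [NormedAddCommGroup F] [NormedSpace ℝ F] {f : N → F}

lemma of_contMDiffAt [FiniteDimensional ℝ F] (h : ContMDiffAt 𝓘(ℝ, E) 𝓘(ℝ, F) ∞ f u) :
    IsSmoothAt (E := E) f u := fun φ =>
  ContMDiffAt.comp u (g := φ) (φ.toContinuousLinearMap.contDiff.contDiffAt.contMDiffAt) h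

lemma contMDiffAt [FiniteDimensional ℝ F] (h : IsSmoothAt (E := E) f u) :
    ContMDiffAt 𝓘(ℝ, E) 𝓘(ℝ, F) ∞ f u := by
  let b := Module.finBasis ℝ F
  have : ContMDiffAt 𝓘(ℝ, E) 𝓘(ℝ, F) ∞ (fun v => ∑ i, b.repr (f v) i • b i) u :=
    contMDiffAt_finsetSum fun i _ => (h.repr b i).smul contMDiffAt_const
  simpa only [b.sum_repr] using this

end IsSmoothAt

section Derivative

variable {u : N} {f g : N → W}

lemma fnDeriv_add (c : N → ℝ) (u : N) (X Y : TangentSpace 𝓘(ℝ, E) u) :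
    fnDeriv (E := E) c u (X + Y) = fnDeriv (E := E) c u X + fnDeriv (E := E) c u Y :=
  map_add (mfderiv 𝓘(ℝ, E) 𝓘(ℝ, ℝ) c u) X Y

lemma fnDeriv_smul (c : N → ℝ) (u : N) (r : ℝ) (X : TangentSpace 𝓘(ℝ, E) u) :
    fnDeriv (E := E) c u (r • X) = r * fnDeriv (E := E) c u X :=
  map_smul (mfderiv 𝓘(ℝ, E) 𝓘(ℝ, ℝ) c u) r X

lemma fnDeriv_comp {c : N → ℝ} {h : N' → N} {x : N'} {y : N} (hxy : h x = y)
    (hc : MDifferentiableAt 𝓘(ℝ, E) 𝓘(ℝ, ℝ) c y)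
    (hh : MDifferentiableAt 𝓘(ℝ, E') 𝓘(ℝ, E) h x) (X : E') :
    fnDeriv (E := E') (fun v => c (h v)) x X =
      fnDeriv (E := E) c y ((mfderiv 𝓘(ℝ, E') 𝓘(ℝ, E) h x : E' →L[ℝ] E) X) :=
  mfderiv_comp_apply_of_eq hxy hc hh X

variable [Module.Finite ℝ W] [Module.Finite ℝ W']

lemma dirDeriv_add_vec (f : N → W) (u : N) (X Y : TangentSpace 𝓘(ℝ, E) u) :
    dirDeriv (E := E) f u (X + Y) = dirDeriv (E := E) f u X + dirDeriv (E := E) f u Y := by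
  simp only [dirDeriv, fnDeriv_add, add_smul, Finset.sum_add_distrib]

lemma dirDeriv_smul_vec (f : N → W) (u : N) (r : ℝ) (X : TangentSpace 𝓘(ℝ, E) u) :
    dirDeriv (E := E) f u (r • X) = r • dirDeriv (E := E) f u X := by
  simp only [dirDeriv, fnDeriv_smul, mul_smul, Finset.smul_sum]

/-- This frees `dirDeriv` from the basis used in its definition. Together with `eq_of_forall_dual`
it reduces the rules for vector-valued functions to those for scalar ones. -/
lemma dual_dirDeriv (hf : IsSmoothAt (E := E) f u) (X : TangentSpace 𝓘(ℝ, E) u)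
    (φ : Module.Dual ℝ W) :
    φ (dirDeriv (E := E) f u X) = fnDeriv (E := E) (fun v => φ (f v)) u X := by
  let b := Module.finBasis ℝ W
  let n := Module.finrank ℝ W
  let g : N → (Fin n → ℝ) := fun v i => b.repr (f v) i
  have hg : MDifferentiableAt 𝓘(ℝ, E) 𝓘(ℝ, Fin n → ℝ) g u := by
    have : ContMDiffAt 𝓘(ℝ, E) 𝓘(ℝ, Fin n → ℝ) ∞ g u :=
      contMDiffAt_pi_space.2 fun i => hf.repr b i
    exact this.mdifferentiableAt (by simp)
  let Y : Fin n → ℝ := (mfderiv 𝓘(ℝ, E) 𝓘(ℝ, Fin n → ℝ) g u : E →L[ℝ] (Fin n → ℝ)) X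
  have key : ∀ Φ : (Fin n → ℝ) →L[ℝ] ℝ, fnDeriv (E := E) (fun v => Φ (g v)) u X = Φ Y := by
    intro Φ
    refine (mfderiv_comp_apply_of_eq (g := Φ) (f := g) (x := u) rfl
      Φ.differentiableAt.mdifferentiableAt hg X).trans ?_
    rw [mfderiv_eq_fderiv, Φ.fderiv]
    rfl
  have h1 : ∀ i, fnDeriv (E := E) (fun v => b.repr (f v) i) u X = Y i :=
    fun i => key (ContinuousLinearMap.proj i)
  let Φ : (Fin n → ℝ) →L[ℝ] ℝ :=
    ∑ i, φ (b i) • ContinuousLinearMap.proj (R := ℝ) (φ := fun _ => ℝ) i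
  have hΦ : ∀ y : Fin n → ℝ, Φ y = ∑ i, y i * φ (b i) := by
    intro y
    simp only [Φ]
    rw [sum_apply]
    exact Finset.sum_congr rfl fun i _ => mul_comm _ _
  have h2 : (fun v => φ (f v)) = fun v => Φ (g v) := by
    funext v
    rw [hΦ]
    conv_lhs => rw [← b.sum_repr (f v)]
    simp only [map_sum, map_smul, smul_eq_mul]
    rfl
  rw [h2, key, dirDeriv, hΦ]
  simp only [map_sum, map_smul, smul_eq_mul]
  exact Finset.sum_congr rfl fun i _ => congrArg (· * φ (b i)) (h1 i)

lemma eq_of_forall_dual {w w' : W} (h : ∀ φ : Module.Dual ℝ W, φ w = φ w') : w = w' := by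
  rw [← sub_eq_zero, ← Module.forall_dual_apply_eq_zero_iff ℝ]
  intro φ
  rw [map_sub, h, sub_self]

lemma dirDeriv_linear (hf : IsSmoothAt (E := E) f u) (T : W →ₗ[ℝ] W')
    (X : TangentSpace 𝓘(ℝ, E) u) :
    dirDeriv (E := E) (fun v => T (f v)) u X = T (dirDeriv (E := E) f u X) :=
  eq_of_forall_dual fun φ => by
    rw [dual_dirDeriv (hf.linear T)]
    exact (dual_dirDeriv hf X (φ.comp T)).symm

lemma dirDeriv_const (w : W) (X : TangentSpace 𝓘(ℝ, E) u) :
    dirDeriv (E := E) (fun _ : N => w) u X = 0 :=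
  eq_of_forall_dual fun φ => by
    rw [dual_dirDeriv (.const w), fnDeriv, mfderiv_const, map_zero]
    rfl

lemma dirDeriv_add (hf : IsSmoothAt (E := E) f u) (hg : IsSmoothAt (E := E) g u)
    (X : TangentSpace 𝓘(ℝ, E) u) :
    dirDeriv (E := E) (fun v => f v + g v) u X =
      dirDeriv (E := E) f u X + dirDeriv (E := E) g u X :=
  eq_of_forall_dual fun φ => by
    rw [map_add, dual_dirDeriv (hf.add hg), dual_dirDeriv hf, dual_dirDeriv hg]
    simp only [map_add]
    have h1 := ((hf φ).mdifferentiableAt (by simp)).hasMFDerivAt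
    have h2 := ((hg φ).mdifferentiableAt (by simp)).hasMFDerivAt
    exact congrArg (fun A : E →L[ℝ] ℝ => A X) (h1.add h2).mfderiv

lemma dirDeriv_smul {c : N → ℝ} (hc : ContMDiffAt 𝓘(ℝ, E) 𝓘(ℝ, ℝ) ∞ c u)
    (hf : IsSmoothAt (E := E) f u) (X : TangentSpace 𝓘(ℝ, E) u) :
    dirDeriv (E := E) (fun v => c v • f v) u X =
      fnDeriv (E := E) c u X • f u + c u • dirDeriv (E := E) f u X :=
  eq_of_forall_dual fun φ => by
    rw [dual_dirDeriv (hf.smul hc), map_add, map_smul, map_smul, dual_dirDeriv hf]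
    simp only [map_smul, smul_eq_mul]
    have h1 := (hc.mdifferentiableAt (by simp)).hasMFDerivAt
    have h2 := ((hf φ).mdifferentiableAt (by simp)).hasMFDerivAt
    refine (congrArg (fun A : E →L[ℝ] ℝ => A X) (h1.mul h2).mfderiv).trans ?_
    refine (add_comm _ _).trans ?_
    exact congrArg (· + _) (mul_comm _ _)

lemma dirDeriv_sum {κ : Type*} {s : Finset κ} {f : κ → N → W}
    (hf : ∀ i ∈ s, IsSmoothAt (E := E) (f i) u) (X : TangentSpace 𝓘(ℝ, E) u) :
    dirDeriv (E := E) (fun v => ∑ i ∈ s, f i v) u X = ∑ i ∈ s, dirDeriv (E := E) (f i) u X := by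
  classical
  induction s using Finset.induction_on with
  | empty => simpa using dirDeriv_const (u := u) (0 : W) X
  | insert i s hi ih =>
    simp only [Finset.sum_insert hi]
    rw [dirDeriv_add (hf i (by simp)) (.sum fun j hj => hf j (by simp [hj])),
      ih fun j hj => hf j (by simp [hj])]

lemma dirDeriv_comp {h : N' → N} {x : N'} {y : N} (hxy : h x = y) (hf : IsSmoothAt (E := E) f y)
    (hh : ContMDiffAt 𝓘(ℝ, E') 𝓘(ℝ, E) ∞ h x) (X : E') :
    dirDeriv (E := E') (fun v => f (h v)) x X =
      dirDeriv (E := E) f y ((mfderiv 𝓘(ℝ, E') 𝓘(ℝ, E) h x : E' →L[ℝ] E) X) := by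
  subst hxy
  refine eq_of_forall_dual fun φ => ?_
  refine (dual_dirDeriv (hf.comp hh) X φ).trans ?_
  refine Eq.trans ?_ (dual_dirDeriv hf _ φ).symm
  exact fnDeriv_comp rfl ((hf φ).mdifferentiableAt (by simp)) (hh.mdifferentiableAt (by simp)) X

/-- The composition of `f` with the projection to `W ⧸ S` is constant, and a linear map commutes
with differentiation. -/
lemma dirDeriv_mem (hf : IsSmoothAt (E := E) f u) {S : Submodule ℝ W} (hS : ∀ v, f v ∈ S)
    (X : TangentSpace 𝓘(ℝ, E) u) : dirDeriv (E := E) f u X ∈ S := by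
  rw [← Submodule.Quotient.mk_eq_zero, ← Submodule.mkQ_apply, ← dirDeriv_linear hf]
  have : (fun v => S.mkQ (f v)) = fun _ => 0 :=
    funext fun v => (Submodule.Quotient.mk_eq_zero S).2 (hS v)
  rw [this, dirDeriv_const]

lemma IsSmooth.dirDeriv [IsManifold 𝓘(ℝ, E) ∞ N] (hf : IsSmooth (E := E) f)
    {X : ∀ u : N, TangentSpace 𝓘(ℝ, E) u} (hX : IsSmoothVF X) :
    IsSmooth (E := E) (fun u => dirDeriv (E := E) f u (X u)) := by
  intro φ
  have h1 : ContMDiff 𝓘(ℝ, E).tangent 𝓘(ℝ, ℝ).tangent ∞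
      (tangentMap 𝓘(ℝ, E) 𝓘(ℝ, ℝ) (fun v => φ (f v))) :=
    (hf φ).contMDiff_tangentMap (by simp)
  have h2 := (contMDiff_snd_tangentBundle_modelSpace ℝ 𝓘(ℝ, ℝ) (n := ∞)).comp (h1.comp hX)
  refine h2.congr fun u => ?_
  exact dual_dirDeriv (hf.isSmoothAt u) (X u) φ

end Derivative

/-- Over the locus where a smooth family of linear maps is surjective, linear equations with smooth
right hand side have smooth local solutions. -/
lemma exists_smooth_solution [FiniteDimensional ℝ E'] {T : N → W →ₗ[ℝ] E'} {y : N → E'} {u₀ : N}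
    (hT : ∀ w, ∀ᶠ u in 𝓝 u₀, ContMDiffAt 𝓘(ℝ, E) 𝓘(ℝ, E') ∞ (fun v => T v w) u)
    (hy : ∀ᶠ u in 𝓝 u₀, ContMDiffAt 𝓘(ℝ, E) 𝓘(ℝ, E') ∞ y u)
    (hsurj : Function.Surjective (T u₀)) :
    ∃ A : N → W, ∀ᶠ u in 𝓝 u₀, IsSmoothAt (E := E) A u ∧ T u (A u) = y u := by
  -- With a right inverse `R` of `T u₀`, the operator `T u ∘ R` is the identity at `u₀`, hence
  -- invertible nearby. The solution is `R (T u ∘ R)⁻¹ y`, smooth because inversion is.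
  obtain ⟨R, hR⟩ := (T u₀).exists_rightInverse_of_surjective (LinearMap.range_eq_top.2 hsurj)
  let b := Module.finBasis ℝ E'
  let B : N → E' →L[ℝ] E' := fun u => ((T u).comp R).toContinuousLinearMap
  have hB : ∀ᶠ u in 𝓝 u₀, ContMDiffAt 𝓘(ℝ, E) 𝓘(ℝ, E' →L[ℝ] E') ∞ B u := by
    have hT' : ∀ᶠ u in 𝓝 u₀, ∀ i, ContMDiffAt 𝓘(ℝ, E) 𝓘(ℝ, E') ∞ (fun v => T v (R (b i))) u :=
      eventually_all.2 fun i => hT _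
    filter_upwards [hT'] with u hu
    have h1 : ContMDiffAt 𝓘(ℝ, E) 𝓘(ℝ, E' →L[ℝ] E') ∞ (fun v => ∑ i,
        ContinuousLinearMap.smulRightL ℝ E' E' (b.coord i).toContinuousLinearMap
          (T v (R (b i)))) u := by
      refine contMDiffAt_finsetSum fun i _ => ?_
      exact ContMDiffAt.comp u (g := ContinuousLinearMap.smulRightL ℝ E' E'
        (b.coord i).toContinuousLinearMap)
        (ContinuousLinearMap.contDiff _).contDiffAt.contMDiffAt (hu i)
    refine h1.congr_of_eventuallyEq (Eventually.of_forall fun v => ?_)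
    refine ContinuousLinearMap.ext fun z => ?_
    rw [sum_apply]
    change T v (R z) = ∑ i, b.repr z i • T v (R (b i))
    conv_lhs => rw [← b.sum_repr z]
    simp only [map_sum, map_smul]
  have hB0 : B u₀ = ContinuousLinearEquiv.refl ℝ E' := by
    refine ContinuousLinearMap.ext fun z => ?_
    exact LinearMap.congr_fun hR z
  have hinv : ∀ᶠ u in 𝓝 u₀, B u ∈ Set.range ((↑) : (E' ≃L[ℝ] E') → E' →L[ℝ] E') := by
    refine hB.self_of_nhds.continuousAt.eventually_mem ?_
    rw [hB0]
    exact ContinuousLinearEquiv.nhds _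
  refine ⟨fun u => R ((B u).inverse (y u)), ?_⟩
  filter_upwards [hB, hinv, hy] with u h1 ⟨e, he⟩ h2
  constructor
  · refine IsSmoothAt.linear (.of_contMDiffAt ?_) R
    have h3 : ContMDiffAt 𝓘(ℝ, E) 𝓘(ℝ, E' →L[ℝ] E') ∞ (fun v => (B v).inverse) u := by
      refine ContMDiffAt.comp u (g := ContinuousLinearMap.inverse) ?_ h1
      rw [← he]
      exact (contDiffAt_map_inverse e).contMDiffAt
    exact h3.clm_apply h2
  · change B u ((B u).inverse (y u)) = y u
    rw [← he, ContinuousLinearMap.inverse_equiv]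
    simp

end Calculus

end

end RelTractor

namespace RelTractor

noncomputable section

/-! ### The principal bundle and the isomorphism of `TM` with `𝒢 ×_Q (𝔤/𝔮)` -/

section Groups

set_option linter.unusedSectionVars false

open Filter Topology

section TangentSpaces

variable {E : Type*} [NormedAddCommGroup E] [NormedSpace ℝ E]
  {N : Type*} [TopologicalSpace N] [ChartedSpace E N]

lemma tangentBundle_mk_congr {x y : N} (h : x = y) {v w : E} (hv : v = w) :
    (⟨x, v⟩ : TangentBundle 𝓘(ℝ, E) N) = ⟨y, w⟩ := by
  subst h; subst hv; rfl

lemma tangentSpace_cast {x y : N} (h : x = y) (v : TangentSpace 𝓘(ℝ, E) x) :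
    ((h ▸ v : TangentSpace 𝓘(ℝ, E) y) : E) = v := by
  subst h; rfl

lemma tangentBundle_snd_eq {x y : N} {v w : E}
    (h : (⟨x, v⟩ : TangentBundle 𝓘(ℝ, E) N) = ⟨y, w⟩) : v = w := by
  cases h; rfl

end TangentSpaces

variable {EG : Type*} [NormedAddCommGroup EG] [NormedSpace ℝ EG] [FiniteDimensional ℝ EG]
  {G : Type*} [TopologicalSpace G] [ChartedSpace EG G] [Group G] [LieGroup 𝓘(ℝ, EG) ∞ G]

lemma isSmooth_Ad (x : GroupLieAlgebra 𝓘(ℝ, EG) G) :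
    IsSmooth (E := EG) (fun g : G => Ad g x) :=
  isSmooth_iff.2 fun _ =>
    IsSmoothAt.of_contMDiffAt (F := EG) (contMDiff_AdOrbit x).contMDiffAt

lemma dirDeriv_Ad_one (x y : GroupLieAlgebra 𝓘(ℝ, EG) G) :
    dirDeriv (E := EG) (fun g : G => Ad g x) 1 y = ⁅y, x⁆ := by
  refine eq_of_forall_dual fun φ => ?_
  rw [dual_dirDeriv ((isSmooth_Ad x).isSmoothAt 1)]
  let Φ : EG →L[ℝ] ℝ := LinearMap.toContinuousLinearMap (E := EG) φ
  refine (mfderiv_comp_apply_of_eq (g := Φ) (f := AdOrbit (G := G) x) (x := (1 : G)) rfl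
    Φ.differentiableAt.mdifferentiableAt
    ((contMDiff_AdOrbit x).mdifferentiable (by simp) 1) y).trans ?_
  rw [mfderiv_eq_fderiv, Φ.fderiv]
  exact congrArg Φ (mfderiv_AdOrbit_one x y)

variable {EQ : Type*} [NormedAddCommGroup EQ] [NormedSpace ℝ EQ] [FiniteDimensional ℝ EQ]
  {ι : Type*} [Fintype ι] {P Q : Subgroup G} [ChartedSpace EQ Q] [LieGroup 𝓘(ℝ, EQ) ∞ Q]

lemma isSmooth_Ad_coe (hQ : ContMDiff 𝓘(ℝ, EQ) 𝓘(ℝ, EG) ∞ (Subtype.val : Q → G))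
    (x : GroupLieAlgebra 𝓘(ℝ, EG) G) : IsSmooth (E := EQ) (fun q : Q => Ad (q : G) x) :=
  isSmooth_iff.2 fun q => ((isSmooth_Ad x).isSmoothAt (q : G)).comp hQ.contMDiffAt

lemma dirDeriv_Ad_coe_one (hQ : ContMDiff 𝓘(ℝ, EQ) 𝓘(ℝ, EG) ∞ (Subtype.val : Q → G))
    (x : GroupLieAlgebra 𝓘(ℝ, EG) G) (a : GroupLieAlgebra 𝓘(ℝ, EQ) Q) :
    dirDeriv (E := EQ) (fun q : Q => Ad (q : G) x) 1 a =
      ⁅inclDeriv (EG := EG) (EQ := EQ) Q a, x⁆ := by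
  refine (dirDeriv_comp (E := EG) (E' := EQ) (f := fun g : G => Ad g x)
    (h := (Subtype.val : Q → G)) (x := 1) (y := 1) (OneMemClass.coe_one Q)
    ((isSmooth_Ad x).isSmoothAt 1) hQ.contMDiffAt a).trans ?_
  exact dirDeriv_Ad_one x (inclDeriv (EG := EG) (EQ := EQ) Q a)

namespace NestedParabolics

variable (B : NestedParabolics (EG := EG) (EQ := EQ) ι P Q)

/-- Elements of `Q` lie in `P` and so normalize `𝔭 = 𝔤^(0,*)`; `map_filtration` extends this to all
degrees up to `1`, which covers both `i'` and `i' + 1` for `i' ≤ 0`. -/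
lemma Ad_mem_F_iff (q : Q) {i : ℤ} (hi : i ≤ 1) (x : GroupLieAlgebra 𝓘(ℝ, EG) G) :
    Ad (q : G) x ∈ B.F i ↔ x ∈ B.F i := by
  refine B.roots.map_filtration B.Sp B.Sq (AdEquiv (q : G)) (fun y => ?_) hi x
  rw [B.roots.filtration_zero, AdEquiv_apply]
  have hq : (B.roots.parabolic B.Sp).map (Ad (q : G)) = B.roots.parabolic B.Sp :=
    B.P_le (B.Q_le q.2).1
  constructor
  · intro h
    rw [← hq] at h
    obtain ⟨z, hz, hzy⟩ := h
    rwa [← Ad_inv_Ad (q : G) y, ← hzy, Ad_inv_Ad]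
  · intro h
    rw [← hq]
    exact ⟨y, h, rfl⟩

lemma Ad_inv_mem_F_iff (q : Q) {i : ℤ} (hi : i ≤ 1) (x : GroupLieAlgebra 𝓘(ℝ, EG) G) :
    Ad (q : G)⁻¹ x ∈ B.F i ↔ x ∈ B.F i := by
  rw [← B.Ad_mem_F_iff q hi, Ad_Ad_inv]

lemma range_inclDeriv_le_F {i : ℤ} (hi : i ≤ 0) :
    LinearMap.range (inclDeriv (EG := EG) (EQ := EQ) Q) ≤ B.F i :=
  B.lieAlgebra_Q.le.trans (B.roots.parabolic_le_filtration B.Sp_subset hi)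

lemma F_one_le_range_inclDeriv :
    B.F 1 ≤ LinearMap.range (inclDeriv (EG := EG) (EQ := EQ) Q) :=
  (B.roots.filtration_one_le_parabolic B.Sp B.Sq).trans B.lieAlgebra_Q.ge

end NestedParabolics

variable {E𝒢 : Type*} [NormedAddCommGroup E𝒢] [NormedSpace ℝ E𝒢] [FiniteDimensional ℝ E𝒢]
  {𝒢 : Type*} [TopologicalSpace 𝒢] [ChartedSpace E𝒢 𝒢] [IsManifold 𝓘(ℝ, E𝒢) ∞ 𝒢]
  {EM : Type*} [NormedAddCommGroup EM] [NormedSpace ℝ EM] [FiniteDimensional ℝ EM]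
  {M : Type*} [TopologicalSpace M] [ChartedSpace EM M] [IsManifold 𝓘(ℝ, EM) ∞ M]

namespace CartanGeometry

variable (C : CartanGeometry EG EQ E𝒢 EM Q 𝒢 M)
  (B : NestedParabolics (EG := EG) (EQ := EQ) ι P Q)

/-- Smooth local sections and the corresponding local trivializations of the principal bundle. -/
lemma exists_localSection (x₀ : M) : ∃ (U : Set M) (σ : M → 𝒢) (γ : 𝒢 → Q), IsOpen U ∧ x₀ ∈ U ∧
    (∀ x ∈ U, C.π (σ x) = x ∧ ContMDiffAt 𝓘(ℝ, EM) 𝓘(ℝ, E𝒢) ∞ σ x) ∧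
    (∀ u, C.π u ∈ U → C.act (σ (C.π u)) (γ u) = u ∧ ContMDiffAt 𝓘(ℝ, E𝒢) 𝓘(ℝ, EQ) ∞ γ u) ∧
    ∀ u, C.π u ∈ U → ∀ q, γ (C.act u q) = γ u * q := by
  obtain ⟨e, hx₀, he, he', hmul⟩ := C.locallyTrivial x₀
  have hσ : ∀ x ∈ e.baseSet, C.π (e.toOpenPartialHomeomorph.symm (x, 1)) = x :=
    fun x hx => e.proj_symm_apply' hx
  have hmem : ∀ u, C.π u ∈ e.baseSet → u ∈ e.source := fun u hu => e.mem_source.2 hu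
  refine ⟨e.baseSet, fun x => e.toOpenPartialHomeomorph.symm (x, 1), fun u => (e u).2,
    e.open_baseSet, hx₀, fun x hx => ⟨hσ x hx, ?_⟩, fun u hu => ⟨?_, ?_⟩,
    fun u hu q => hmul u (hmem u hu) q⟩
  · have h1 : (x, (1 : Q)) ∈ e.target := e.mem_target.2 hx
    exact ((he' _ h1).contMDiffAt (e.open_target.mem_nhds h1)).comp x
      (contMDiffAt_id.prodMk contMDiffAt_const)
  · set v := e.toOpenPartialHomeomorph.symm (C.π u, 1) with hv
    have hπv : C.π v = C.π u := hσ _ hu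
    have hvs : v ∈ e.source := hmem v (by rwa [hπv])
    have hws : C.act v (e u).2 ∈ e.source := hmem _ (by rw [C.π_act, hπv]; exact hu)
    refine e.injOn hws (hmem u hu) (Prod.ext ?_ ?_)
    · change (e (C.act v (e u).2)).1 = (e u).1
      rw [e.coe_fst hws, e.coe_fst (hmem u hu), C.π_act, hπv]
    · change (e (C.act v (e u).2)).2 = (e u).2
      rw [hmul v hvs, hv, e.apply_symm_apply' hu, one_mul]
  · have hu' := hmem u hu
    exact (contMDiffAt_snd).comp u ((he u hu').contMDiffAt (e.open_source.mem_nhds hu'))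

lemma exists_act_eq {u v : 𝒢} (h : C.π u = C.π v) : ∃ q, C.act u q = v := by
  obtain ⟨U, σ, γ, -, hxU, -, hact, hγ⟩ := C.exists_localSection (C.π u)
  have h1 := (hact u hxU).1
  have h2 := (hact v (h ▸ hxU)).1
  refine ⟨(γ u)⁻¹ * γ v, ?_⟩
  nth_rw 1 [← h1]
  rw [C.act_mul, mul_inv_cancel_left, h, h2]

lemma contMDiff_act_right (q : Q) : ContMDiff 𝓘(ℝ, E𝒢) 𝓘(ℝ, E𝒢) ∞ (fun u => C.act u q) :=
  C.act_smooth.comp (contMDiff_id.prodMk contMDiff_const)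

lemma contMDiff_act_left (u : 𝒢) : ContMDiff 𝓘(ℝ, EQ) 𝓘(ℝ, E𝒢) ∞ (fun q => C.act u q) :=
  C.act_smooth.comp (contMDiff_const.prodMk contMDiff_id)

lemma mdifferentiableAt_π (u : 𝒢) : MDifferentiableAt 𝓘(ℝ, E𝒢) 𝓘(ℝ, EM) C.π u :=
  C.π_smooth.mdifferentiable (by simp) u

lemma cartan_congr {u v : 𝒢} (h : u = v) (X : E𝒢) : C.cartan u X = C.cartan v X := by
  subst h; rfl

lemma cartan_symm_act (u : 𝒢) (q : Q) (A : GroupLieAlgebra 𝓘(ℝ, EG) G) :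
    (C.cartan (C.act u q)).symm (Ad (q : G)⁻¹ A) =
      mfderiv 𝓘(ℝ, E𝒢) 𝓘(ℝ, E𝒢) (fun v => C.act v q) u ((C.cartan u).symm A) := by
  rw [LinearEquiv.symm_apply_eq, C.cartan_equivariant, LinearEquiv.apply_symm_apply]

lemma cartan_symm_inclDeriv (u : 𝒢) (a : GroupLieAlgebra 𝓘(ℝ, EQ) Q) :
    ((C.cartan u).symm (inclDeriv Q a) : E𝒢) =
      (mfderiv 𝓘(ℝ, EQ) 𝓘(ℝ, E𝒢) (fun q : Q => C.act u q) 1 : EQ →L[ℝ] E𝒢) a := by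
  refine (LinearEquiv.symm_apply_eq _).2 ?_
  exact (C.cartan_fundamental u a).symm.trans (C.cartan_congr (C.act_one u) _)

lemma toTM_add (u : 𝒢) (A A' : GroupLieAlgebra 𝓘(ℝ, EG) G) :
    C.toTM u (A + A') = C.toTM u A + C.toTM u A' := by
  simp only [toTM, map_add]

lemma toTM_smul (u : 𝒢) (r : ℝ) (A : GroupLieAlgebra 𝓘(ℝ, EG) G) :
    C.toTM u (r • A) = r • C.toTM u A := by
  simp only [toTM, map_smul]

/-- The map `toTM u` as a linear map. -/
def toTMLinear (u : 𝒢) : GroupLieAlgebra 𝓘(ℝ, EG) G →ₗ[ℝ] TangentSpace 𝓘(ℝ, EM) (C.π u) where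
  toFun := C.toTM u
  map_add' := C.toTM_add u
  map_smul' := C.toTM_smul u

lemma toTM_sub (u : 𝒢) (A A' : GroupLieAlgebra 𝓘(ℝ, EG) G) :
    C.toTM u (A - A') = C.toTM u A - C.toTM u A' := map_sub (C.toTMLinear u) A A'

/-- Equivariance of `ω` combined with `π(u q) = π(u)`. The equation is read in the model space,
since the two base points are equal only propositionally. -/
lemma toTM_act (u : 𝒢) (q : Q) (A : GroupLieAlgebra 𝓘(ℝ, EG) G) :
    (C.toTM (C.act u q) (Ad (q : G)⁻¹ A) : EM) = C.toTM u A := by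
  rw [toTM, cartan_symm_act]
  refine (mfderiv_comp_apply_of_eq (g := C.π) (f := fun v => C.act v q) rfl
    (C.mdifferentiableAt_π _) ((C.contMDiff_act_right q).mdifferentiable (by simp) u)
    ((C.cartan u).symm A)).symm.trans ?_
  have h : (fun v => C.π (C.act v q)) = C.π := funext fun v => C.π_act v q
  exact congrArg (fun f : 𝒢 → M => (mfderiv 𝓘(ℝ, E𝒢) 𝓘(ℝ, EM) f u : E𝒢 →L[ℝ] EM)
    ((C.cartan u).symm A)) h

lemma mk_toTM_act (u : 𝒢) (q : Q) (A : GroupLieAlgebra 𝓘(ℝ, EG) G) :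
    (⟨C.π (C.act u q), C.toTM (C.act u q) (Ad (q : G)⁻¹ A)⟩ : TangentBundle 𝓘(ℝ, EM) M) =
      ⟨C.π u, C.toTM u A⟩ :=
  tangentBundle_mk_congr (C.π_act u q) (C.toTM_act u q A)

/-- A local section, translated so that it passes through `u`, is a local right inverse of `π`. -/
lemma toTM_surjective (u : 𝒢) : Function.Surjective (C.toTM u) := by
  obtain ⟨U, σ, γ, hU, hxU, hσ, hact, hγ⟩ := C.exists_localSection (C.π u)
  intro v
  let τ : M → 𝒢 := fun x => C.act (σ x) (γ u)
  have hτu : τ (C.π u) = u := (hact u hxU).1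
  have hτd : MDifferentiableAt 𝓘(ℝ, EM) 𝓘(ℝ, E𝒢) τ (C.π u) :=
    ((C.contMDiff_act_right (γ u)).contMDiffAt.comp _ (hσ _ hxU).2).mdifferentiableAt (by simp)
  let X : TangentSpace 𝓘(ℝ, E𝒢) u :=
    (mfderiv 𝓘(ℝ, EM) 𝓘(ℝ, E𝒢) τ (C.π u) : EM →L[ℝ] E𝒢) v
  refine ⟨C.cartan u X, ?_⟩
  rw [toTM, LinearEquiv.symm_apply_apply]
  refine (mfderiv_comp_apply_of_eq (g := C.π) (f := τ) hτu (C.mdifferentiableAt_π _) hτd v).symm.trans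
    ?_
  have h1 : (fun x => C.π (τ x)) =ᶠ[𝓝 (C.π u)] id := by
    filter_upwards [hU.mem_nhds hxU] with x hx
    simp only [τ, C.π_act, (hσ x hx).1, id]
  rw [h1.mfderiv_eq, mfderiv_id]
  rfl

lemma toTM_inclDeriv (u : 𝒢) (a : GroupLieAlgebra 𝓘(ℝ, EQ) Q) :
    C.toTM u (inclDeriv Q a) = 0 := by
  rw [toTM, cartan_symm_inclDeriv]
  refine (mfderiv_comp_apply_of_eq (g := C.π) (f := fun q : Q => C.act u q) (C.act_one u)
    (C.mdifferentiableAt_π _) ((C.contMDiff_act_left u).mdifferentiable (by simp) 1) a).symm.trans ?_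
  have h : (fun q => C.π (C.act u q)) = fun _ => C.π u := funext fun q => C.π_act u q
  refine (congrArg (fun f : Q → M => (mfderiv 𝓘(ℝ, EQ) 𝓘(ℝ, EM) f 1 : EQ →L[ℝ] EM) a) h).trans ?_
  rw [mfderiv_const]
  rfl

/-- The kernel of `𝔤 → T_{π(u)} M` is the Lie algebra of `Q`. -/
lemma toTM_eq_zero_iff (u : 𝒢) (A : GroupLieAlgebra 𝓘(ℝ, EG) G) :
    C.toTM u A = 0 ↔ A ∈ LinearMap.range (inclDeriv (EG := EG) (EQ := EQ) Q) := by
  constructor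
  · intro h
    obtain ⟨U, σ, γ, hU, hxU, hσ, hact, hγ⟩ := C.exists_localSection (C.π u)
    set X : E𝒢 := (C.cartan u).symm A with hX
    -- Near `u` each point is `v = σ(π v) · γ(v)`. A vertical `X` is killed by the derivative of the
    -- first factor, so it comes from the `Q`-factor alone.
    let f : 𝒢 → 𝒢 := fun v => σ (C.π v)
    have hσd := (hσ _ hxU).2.mdifferentiableAt (by simp)
    have hfd : MDifferentiableAt 𝓘(ℝ, E𝒢) 𝓘(ℝ, E𝒢) f u := hσd.comp u (C.mdifferentiableAt_π u)
    have hγd : MDifferentiableAt 𝓘(ℝ, E𝒢) 𝓘(ℝ, EQ) γ u :=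
      (hact u hxU).2.mdifferentiableAt (by simp)
    have hfX : (mfderiv 𝓘(ℝ, E𝒢) 𝓘(ℝ, E𝒢) f u : E𝒢 →L[ℝ] E𝒢) X = 0 := by
      refine (mfderiv_comp_apply_of_eq (g := σ) (f := C.π) rfl hσd (C.mdifferentiableAt_π u)
        X).trans ?_
      have h0 : (mfderiv 𝓘(ℝ, E𝒢) 𝓘(ℝ, EM) C.π u : E𝒢 →L[ℝ] EM) X = 0 := h
      rw [h0]
      exact map_zero (mfderiv 𝓘(ℝ, EM) 𝓘(ℝ, E𝒢) σ (C.π u) : EM →L[ℝ] E𝒢)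
    set Y : EQ := (mfderiv 𝓘(ℝ, E𝒢) 𝓘(ℝ, EQ) γ u : E𝒢 →L[ℝ] EQ) X with hY
    have hactd := C.act_smooth.mdifferentiable (by simp) (f u, γ u)
    have hpd : MDifferentiableAt 𝓘(ℝ, E𝒢) (𝓘(ℝ, E𝒢).prod 𝓘(ℝ, EQ)) (fun v => (f v, γ v)) u :=
      hfd.prodMk hγd
    have hid : (fun v => C.act (f v) (γ v)) =ᶠ[𝓝 u] id := by
      filter_upwards [C.π_smooth.continuous.continuousAt.eventually_mem (hU.mem_nhds hxU)]
        with v hv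
      exact (hact v hv).1
    have h1 : X = (mfderiv (𝓘(ℝ, E𝒢).prod 𝓘(ℝ, EQ)) 𝓘(ℝ, E𝒢)
        (fun z : 𝒢 × Q => C.act z.1 z.2) (f u, γ u) : E𝒢 × EQ →L[ℝ] E𝒢) (0, Y) := by
      have h2 := mfderiv_comp_apply_of_eq (g := fun z : 𝒢 × Q => C.act z.1 z.2)
        (f := fun v => (f v, γ v)) (x := u) rfl hactd hpd X
      have h3 : (mfderiv 𝓘(ℝ, E𝒢) (𝓘(ℝ, E𝒢).prod 𝓘(ℝ, EQ)) (fun v => (f v, γ v)) u :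
          E𝒢 →L[ℝ] E𝒢 × EQ) X = (0, Y) := by
        rw [(hfd.hasMFDerivAt.prodMk hγd.hasMFDerivAt).mfderiv]
        exact Prod.ext hfX rfl
      rw [h3] at h2
      rw [← h2, hid.mfderiv_eq, mfderiv_id]
      rfl
    have h2 : X = (mfderiv 𝓘(ℝ, EQ) 𝓘(ℝ, E𝒢) (fun q => C.act (f u) q) (γ u) : EQ →L[ℝ] E𝒢) Y := by
      rw [h1]
      refine (mfderiv_prod_eq_add_apply (I := 𝓘(ℝ, E𝒢)) (I' := 𝓘(ℝ, EQ)) hactd).trans ?_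
      refine (congrArg (· + _) (map_zero (mfderiv 𝓘(ℝ, E𝒢) 𝓘(ℝ, E𝒢)
        (fun v => C.act v (γ u)) (f u) : E𝒢 →L[ℝ] E𝒢))).trans ?_
      exact zero_add _
    -- Rewriting the orbit map with base point `u` moves the tangent vector at `γ u` to one at `1`,
    -- an element of the Lie algebra of `Q`.
    have hfun : (fun q => C.act (f u) q) = fun q => C.act u ((γ u)⁻¹ * q) := by
      funext q
      have := (hact u hxU).1
      nth_rw 2 [← this]
      rw [C.act_mul, mul_inv_cancel_left]
    let a : EQ := (mfderiv 𝓘(ℝ, EQ) 𝓘(ℝ, EQ) (fun q : Q => (γ u)⁻¹ * q) (γ u) : EQ →L[ℝ] EQ) Y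
    have h3 : X = (mfderiv 𝓘(ℝ, EQ) 𝓘(ℝ, E𝒢) (fun q => C.act u q) 1 : EQ →L[ℝ] E𝒢) a := by
      rw [h2, hfun]
      exact mfderiv_comp_apply_of_eq (g := fun q => C.act u q) (f := fun q : Q => (γ u)⁻¹ * q)
        (inv_mul_cancel _) ((C.contMDiff_act_left u).mdifferentiable (by simp) 1)
        ((contMDiff_mul_left (I := 𝓘(ℝ, EQ)) (n := ∞)).mdifferentiable (by simp) _) Y
    refine ⟨a, ?_⟩
    rw [← C.cartan_symm_inclDeriv u a, hX] at h3
    exact ((C.cartan u).symm.injective h3).symm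
  · rintro ⟨a, rfl⟩
    exact C.toTM_inclDeriv u a

end CartanGeometry

end Groups

end

end RelTractor

namespace RelTractor

noncomputable section

/-! ### The adjoint tractor connection -/

section Connection

set_option linter.unusedSectionVars false

open Filter Topology

variable {EG : Type*} [NormedAddCommGroup EG] [NormedSpace ℝ EG] [FiniteDimensional ℝ EG]
  {G : Type*} [TopologicalSpace G] [ChartedSpace EG G] [Group G] [LieGroup 𝓘(ℝ, EG) ∞ G]
  {EQ : Type*} [NormedAddCommGroup EQ] [NormedSpace ℝ EQ] [FiniteDimensional ℝ EQ]
  {ι : Type*} [Fintype ι] {P Q : Subgroup G} [ChartedSpace EQ Q] [LieGroup 𝓘(ℝ, EQ) ∞ Q]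
  {E𝒢 : Type*} [NormedAddCommGroup E𝒢] [NormedSpace ℝ E𝒢] [FiniteDimensional ℝ E𝒢]
  {𝒢 : Type*} [TopologicalSpace 𝒢] [ChartedSpace E𝒢 𝒢] [IsManifold 𝓘(ℝ, E𝒢) ∞ 𝒢]
  {EM : Type*} [NormedAddCommGroup EM] [NormedSpace ℝ EM] [FiniteDimensional ℝ EM]
  {M : Type*} [TopologicalSpace M] [ChartedSpace EM M] [IsManifold 𝓘(ℝ, EM) ∞ M]

namespace CartanGeometry

variable (C : CartanGeometry EG EQ E𝒢 EM Q 𝒢 M)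
  (B : NestedParabolics (EG := EG) (EQ := EQ) ι P Q)

/-- The vector field `ω⁻¹(s)` is smooth. -/
lemma isSmoothVF_cartan_symm {s : 𝒢 → GroupLieAlgebra 𝓘(ℝ, EG) G} (hs : IsSmooth (E := E𝒢) s) :
    IsSmoothVF (fun u => (C.cartan u).symm (s u)) := by
  intro u₀
  let e := trivializationAt E𝒢 (TangentSpace 𝓘(ℝ, E𝒢) : 𝒢 → Type _) u₀
  have hb : ∀ᶠ u in 𝓝 u₀, u ∈ e.baseSet :=
    e.open_baseSet.mem_nhds (FiberBundle.mem_baseSet_trivializationAt' u₀)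
  have hsymm : ∀ A : 𝒢 → E𝒢, ∀ u ∈ e.baseSet, ContMDiffAt 𝓘(ℝ, E𝒢) 𝓘(ℝ, E𝒢) ∞ A u →
      ContMDiffAt 𝓘(ℝ, E𝒢) 𝓘(ℝ, E𝒢).tangent ∞
        (fun v => (⟨v, e.symmL ℝ v (A v)⟩ : TangentBundle 𝓘(ℝ, E𝒢) 𝒢)) u := by
    intro A u hu hA
    have h1 : (u, A u) ∈ e.target := e.mem_target.2 hu
    have h2 := ((e.contMDiffOn_symm (n := ∞) (IB := 𝓘(ℝ, E𝒢)) _ h1).contMDiffAt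
      (e.open_target.mem_nhds h1)).comp u (contMDiffAt_id.prodMk hA)
    refine h2.congr_of_eventuallyEq ?_
    filter_upwards [e.open_baseSet.mem_nhds hu] with v hv
    refine Eq.trans ?_ (e.mk_symm hv (A v))
    rw [e.symmL_apply hv]
  -- In a local trivialization of the tangent bundle, `ω` is a smooth family of linear isomorphisms,
  -- and `ω⁻¹(s)` solves the linear equation with right hand side `s`.
  let T : 𝒢 → E𝒢 →ₗ[ℝ] EG := fun u =>
    (C.cartan u).toLinearMap ∘ₗ (e.symmL ℝ u).toLinearMap
  have hT : ∀ w, ∀ᶠ u in 𝓝 u₀, ContMDiffAt 𝓘(ℝ, E𝒢) 𝓘(ℝ, EG) ∞ (fun v => T v w) u := by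
    intro w
    filter_upwards [hb] with u hu
    refine IsSmoothAt.contMDiffAt (F := EG) fun φ => ?_
    exact (C.cartan_smooth φ).contMDiffAt.comp u (hsymm (fun _ => w) u hu contMDiffAt_const)
  obtain ⟨A, hA⟩ := exists_smooth_solution (E' := EG) (y := s) hT
    (Eventually.of_forall fun u => IsSmoothAt.contMDiffAt (F := EG) (hs.isSmoothAt u))
    (by
      intro y
      refine ⟨e.continuousLinearMapAt ℝ u₀ ((C.cartan u₀).symm y), ?_⟩
      have := e.symmL_continuousLinearMapAt (R := ℝ) hb.self_of_nhds ((C.cartan u₀).symm y)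
      exact (congrArg (C.cartan u₀) this).trans ((C.cartan u₀).apply_symm_apply y))
  refine (hsymm A u₀ hb.self_of_nhds
    (IsSmoothAt.contMDiffAt (F := E𝒢) hA.self_of_nhds.1)).congr_of_eventuallyEq ?_
  filter_upwards [hA] with u hu
  have : (C.cartan u).symm (s u) = e.symmL ℝ u (A u) :=
    (LinearEquiv.symm_apply_eq _).2 hu.2.symm
  rw [this]

/-- Equivariant functions are differentiated along the fibers by means of the representation. -/
lemma dirDeriv_cartan_symm_inclDeriv
    (hQ : ContMDiff 𝓘(ℝ, EQ) 𝓘(ℝ, EG) ∞ (Subtype.val : Q → G))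
    {t : 𝒢 → GroupLieAlgebra 𝓘(ℝ, EG) G} (ht : t ∈ C.ΓA) (u : 𝒢)
    (a : GroupLieAlgebra 𝓘(ℝ, EQ) Q) :
    dirDeriv t u ((C.cartan u).symm (inclDeriv Q a)) =
      -⁅inclDeriv (EG := EG) (EQ := EQ) Q a, t u⁆ := by
  let b := Module.finBasis ℝ (GroupLieAlgebra 𝓘(ℝ, EG) G)
  let f : Q → GroupLieAlgebra 𝓘(ℝ, EG) G := fun q => t (C.act u q)
  have hf : IsSmoothAt (E := EQ) f 1 :=
    (ht.1.isSmoothAt _).comp (C.contMDiff_act_left u).contMDiffAt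
  have hf' : dirDeriv (E := EQ) f 1 a = dirDeriv t u ((C.cartan u).symm (inclDeriv Q a)) := by
    refine (dirDeriv_comp (f := t) (h := fun q : Q => C.act u q) (C.act_one u) (ht.1.isSmoothAt _)
      (C.contMDiff_act_left u).contMDiffAt a).trans ?_
    exact congrArg (dirDeriv t u) (C.cartan_symm_inclDeriv u a).symm
  -- Equivariance says that `Ad(q) t(u q)` is constant in `q`. Expanding in a basis and applying the
  -- product rule at `q = 1` gives the formula.
  have h0 : (fun q : Q => ∑ j, b.repr (f q) j • Ad (q : G) (b j)) = fun _ => t u := by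
    funext q
    have h1 : ∑ j, b.repr (f q) j • Ad (q : G) (b j) = Ad (q : G) (f q) := by
      conv_rhs => rw [← b.sum_repr (f q)]
      simp only [map_sum, map_smul]
    rw [h1]
    change Ad (q : G) (t (C.act u q)) = t u
    rw [ht.2, Ad_Ad_inv]
  have h1 := dirDeriv_const (E := EQ) (N := Q) (u := 1) (t u) a
  have hs : ∀ j, IsSmoothAt (E := EQ) (fun q : Q => Ad (q : G) (b j)) 1 := fun j =>
    (isSmooth_Ad_coe hQ (b j)).isSmoothAt 1
  rw [← h0, dirDeriv_sum fun j _ => (hs j).smul (hf.repr b j)] at h1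
  have h2 : ∀ j, dirDeriv (E := EQ) (fun q : Q => b.repr (f q) j • Ad (q : G) (b j)) 1 a =
      fnDeriv (E := EQ) (fun q => b.repr (f q) j) 1 a • b j +
        b.repr (t u) j • ⁅inclDeriv (EG := EG) (EQ := EQ) Q a, b j⁆ := by
    intro j
    rw [dirDeriv_smul (hf.repr b j) (hs j), dirDeriv_Ad_coe_one hQ, OneMemClass.coe_one, Ad_one]
    simp only [f, C.act_one]
  rw [Finset.sum_congr rfl fun j _ => h2 j, Finset.sum_add_distrib] at h1
  have h3 : ∑ j, b.repr (t u) j • ⁅inclDeriv (EG := EG) (EQ := EQ) Q a, b j⁆ =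
      ⁅inclDeriv (EG := EG) (EQ := EQ) Q a, t u⁆ := by
    conv_rhs => rw [← b.sum_repr (t u)]
    simp only [lie_sum, lie_smul]
  rw [h3] at h1
  rw [← hf']
  exact eq_neg_of_add_eq_zero_left h1

/-- The value at `u` of `D_s t + {s, t}` as a function of `s(u)`. -/
def connAt (t : 𝒢 → GroupLieAlgebra 𝓘(ℝ, EG) G) (u : 𝒢) :
    GroupLieAlgebra 𝓘(ℝ, EG) G →ₗ[ℝ] GroupLieAlgebra 𝓘(ℝ, EG) G where
  toFun A := dirDeriv t u ((C.cartan u).symm A) + ⁅A, t u⁆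
  map_add' A A' := by
    rw [map_add, dirDeriv_add_vec, add_lie]
    abel
  map_smul' r A := by
    rw [map_smul, dirDeriv_smul_vec, smul_lie, smul_add, RingHom.id_apply]

lemma connAt_apply (t : 𝒢 → GroupLieAlgebra 𝓘(ℝ, EG) G) (u : 𝒢)
    (A : GroupLieAlgebra 𝓘(ℝ, EG) G) :
    C.connAt t u A = dirDeriv t u ((C.cartan u).symm A) + ⁅A, t u⁆ := rfl

/-- Two representatives of a tangent vector differ by an element of `𝔮`, for which the vertical
derivative `-[a, t]` cancels the bracket term. -/
lemma connAt_congr (hQ : ContMDiff 𝓘(ℝ, EQ) 𝓘(ℝ, EG) ∞ (Subtype.val : Q → G))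
    {t : 𝒢 → GroupLieAlgebra 𝓘(ℝ, EG) G} (ht : t ∈ C.ΓA) {u : 𝒢}
    {A A' : GroupLieAlgebra 𝓘(ℝ, EG) G} (h : C.toTM u A = C.toTM u A') :
    C.connAt t u A = C.connAt t u A' := by
  rw [← sub_eq_zero, ← map_sub]
  obtain ⟨a, ha⟩ := (C.toTM_eq_zero_iff u (A - A')).1 (by rw [toTM_sub, h, sub_self])
  rw [← ha, connAt_apply, C.dirDeriv_cartan_symm_inclDeriv hQ ht, neg_add_cancel]

lemma toTM_lift (ξ : ∀ x : M, TangentSpace 𝓘(ℝ, EM) x) (u : 𝒢) :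
    C.toTM u (C.lift ξ u) = ξ (C.π u) :=
  Classical.epsilon_spec (p := fun A => C.toTM u A = ξ (C.π u)) (C.toTM_surjective u _)

lemma adjConn_eq (hQ : ContMDiff 𝓘(ℝ, EQ) 𝓘(ℝ, EG) ∞ (Subtype.val : Q → G))
    {t : 𝒢 → GroupLieAlgebra 𝓘(ℝ, EG) G} (ht : t ∈ C.ΓA) {u : 𝒢}
    {ξ : ∀ x : M, TangentSpace 𝓘(ℝ, EM) x} {A : GroupLieAlgebra 𝓘(ℝ, EG) G}
    (h : C.toTM u A = ξ (C.π u)) : C.adjConn ξ t u = C.connAt t u A :=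
  C.connAt_congr hQ ht ((C.toTM_lift ξ u).trans h.symm)

/-- Right translation by `q` carries `ω⁻¹(A)` to `ω⁻¹(Ad(q⁻¹) A)`. This makes the fundamental
derivative of sections equivariant. -/
lemma dirDeriv_act {W : Type*} [AddCommGroup W] [Module ℝ W] [Module.Finite ℝ W] {f : 𝒢 → W}
    (hf : IsSmooth (E := E𝒢) f) {q : Q} {ρ : W →ₗ[ℝ] W} (hρ : ∀ u, f (C.act u q) = ρ (f u))
    (u : 𝒢) (A : GroupLieAlgebra 𝓘(ℝ, EG) G) :
    dirDeriv f (C.act u q) ((C.cartan (C.act u q)).symm (Ad (q : G)⁻¹ A)) =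
      ρ (dirDeriv f u ((C.cartan u).symm A)) := by
  rw [cartan_symm_act, ← dirDeriv_linear (hf.isSmoothAt u)]
  refine (dirDeriv_comp (f := f) (h := fun v => C.act v q) rfl (hf.isSmoothAt _)
    (C.contMDiff_act_right q).contMDiffAt ((C.cartan u).symm A)).symm.trans ?_
  exact congrArg (fun g : 𝒢 → W => dirDeriv g u ((C.cartan u).symm A)) (funext hρ)

lemma fundDeriv_add_lie_mem {s t : 𝒢 → GroupLieAlgebra 𝓘(ℝ, EG) G} (hs : s ∈ C.ΓA)
    (ht : t ∈ C.ΓA) : (fun u => C.fundDeriv s t u + ⁅s u, t u⁆) ∈ C.ΓA := by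
  constructor
  · refine isSmooth_iff.2 fun u => .add ?_ ?_
    · exact (IsSmooth.dirDeriv ht.1 (C.isSmoothVF_cartan_symm hs.1)).isSmoothAt u
    · exact IsSmoothAt.bilin (LinearMap.mk₂ ℝ (fun x y : GroupLieAlgebra 𝓘(ℝ, EG) G => ⁅x, y⁆)
        add_lie smul_lie lie_add fun c x y => lie_smul c x y) (hs.1.isSmoothAt u) (ht.1.isSmoothAt u)
  · intro u q
    change C.fundDeriv s t (C.act u q) + ⁅s (C.act u q), t (C.act u q)⁆ = _
    rw [hs.2, ht.2, map_add, Ad_lie, fundDeriv, hs.2,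
      C.dirDeriv_act ht.1 (ρ := Ad (q : G)⁻¹) (fun v => ht.2 v q)]
    rfl

lemma fundDeriv_add_lie_mem_ΓAF {i : ℤ} {s t : 𝒢 → GroupLieAlgebra 𝓘(ℝ, EG) G}
    (hs : s ∈ C.ΓAF B 0) (ht : t ∈ C.ΓAF B i) :
    (fun u => C.fundDeriv s t u + ⁅s u, t u⁆) ∈ C.ΓAF B i := by
  refine ⟨C.fundDeriv_add_lie_mem hs.1 ht.1, fun u => add_mem ?_ ?_⟩
  · exact dirDeriv_mem (ht.1.1.isSmoothAt u) ht.2 _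
  · simpa using B.roots.lie_filtration (hs.2 u) (ht.2 u)

/-- `Pi` evaluates at an arbitrarily chosen point of the fibre; equivariance makes the choice
immaterial. -/
lemma Pi_π {s : 𝒢 → GroupLieAlgebra 𝓘(ℝ, EG) G}
    (hs : ∀ u (q : Q), s (C.act u q) = Ad (q : G)⁻¹ (s u)) (u : 𝒢) :
    C.Pi s (C.π u) = C.toTM u (s u) := by
  have hv := Function.surjInv_eq C.π_surjective (C.π u)
  refine (tangentSpace_cast hv _).trans ?_
  obtain ⟨q, hq⟩ := C.exists_act_eq hv.symm
  rw [← hq, hs]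
  exact C.toTM_act u q (s u)

/-- Along a smooth local section `σ`, the field `η` is `Tπ ∘ ω⁻¹(s) ∘ σ`. -/
lemma isSmoothVF_of_toTM {s : 𝒢 → GroupLieAlgebra 𝓘(ℝ, EG) G} (hs : IsSmooth (E := E𝒢) s)
    {η : ∀ x : M, TangentSpace 𝓘(ℝ, EM) x} (h : ∀ u, C.toTM u (s u) = η (C.π u)) :
    IsSmoothVF η := by
  intro x₀
  obtain ⟨U, σ, -, hU, hx₀, hσ, -, -⟩ := C.exists_localSection x₀
  have h1 := (((C.π_smooth.contMDiff_tangentMap (m := ∞) (by simp)).comp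
    (C.isSmoothVF_cartan_symm hs)).contMDiffAt (x := σ x₀)).comp x₀ (hσ x₀ hx₀).2
  refine h1.congr_of_eventuallyEq ?_
  filter_upwards [hU.mem_nhds hx₀] with x hx
  have hx' := (hσ x hx).1
  refine (tangentBundle_mk_congr hx' ?_).symm
  refine (h (σ x)).trans ?_
  rw [hx']

lemma Pi_mem {i : ℤ} {t : 𝒢 → GroupLieAlgebra 𝓘(ℝ, EG) G} (ht : t ∈ C.ΓAF B i) :
    C.Pi t ∈ C.ΓTP B i := by
  refine ⟨C.isSmoothVF_of_toTM ht.1.1 fun u => (C.Pi_π ht.1.2 u).symm, fun x => ?_⟩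
  obtain ⟨u, rfl⟩ := C.π_surjective x
  exact ⟨u, t u, ht.2 u, tangentBundle_mk_congr rfl (C.Pi_π ht.1.2 u)⟩

end CartanGeometry

end Connection

end

end RelTractor

namespace RelTractor

noncomputable section

/-! ### Lifting sections by partitions of unity -/

section Gluing

set_option linter.unusedSectionVars false

open Filter Topology

variable {EG : Type*} [NormedAddCommGroup EG] [NormedSpace ℝ EG] [FiniteDimensional ℝ EG]
  {G : Type*} [TopologicalSpace G] [ChartedSpace EG G] [Group G] [LieGroup 𝓘(ℝ, EG) ∞ G]
  {EQ : Type*} [NormedAddCommGroup EQ] [NormedSpace ℝ EQ] [FiniteDimensional ℝ EQ]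
  {ι : Type*} [Fintype ι] {P Q : Subgroup G} [ChartedSpace EQ Q] [LieGroup 𝓘(ℝ, EQ) ∞ Q]
  {E𝒢 : Type*} [NormedAddCommGroup E𝒢] [NormedSpace ℝ E𝒢] [FiniteDimensional ℝ E𝒢]
  {𝒢 : Type*} [TopologicalSpace 𝒢] [ChartedSpace E𝒢 𝒢] [IsManifold 𝓘(ℝ, E𝒢) ∞ 𝒢]
  {EM : Type*} [NormedAddCommGroup EM] [NormedSpace ℝ EM] [FiniteDimensional ℝ EM]
  {M : Type*} [TopologicalSpace M] [ChartedSpace EM M] [IsManifold 𝓘(ℝ, EM) ∞ M]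

namespace CartanGeometry

variable (C : CartanGeometry EG EQ E𝒢 EM Q 𝒢 M)
variable (C : CartanGeometry EG EQ E𝒢 EM Q 𝒢 M)
  (B : NestedParabolics (EG := EG) (EQ := EQ) ι P Q)

lemma isSmoothAt_Ad_apply {E : Type*} [NormedAddCommGroup E] [NormedSpace ℝ E]
    {N : Type*} [TopologicalSpace N] [ChartedSpace E N]
    (hQ : ContMDiff 𝓘(ℝ, EQ) 𝓘(ℝ, EG) ∞ (Subtype.val : Q → G)) {γ : N → Q}
    {A : N → GroupLieAlgebra 𝓘(ℝ, EG) G} {u : N} (hγ : ContMDiffAt 𝓘(ℝ, E) 𝓘(ℝ, EQ) ∞ γ u)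
    (hA : IsSmoothAt (E := E) A u) : IsSmoothAt (E := E) (fun v => Ad (γ v : G) (A v)) u := by
  let b := Module.finBasis ℝ (GroupLieAlgebra 𝓘(ℝ, EG) G)
  have h : IsSmoothAt (E := E) (fun v => ∑ j, b.repr (A v) j • Ad (γ v : G) (b j)) u :=
    .sum fun j _ => .smul (hA.repr b j) (((isSmooth_Ad_coe hQ (b j)).isSmoothAt _).comp hγ)
  refine h.congr (Eventually.of_forall fun v => ?_)
  conv_lhs => rw [← b.sum_repr (A v)]
  simp only [map_sum, map_smul]

/-- Local sections of `𝒜M` with values in an invariant family of convex sets. -/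
lemma exists_local_equivariant (hQ : ContMDiff 𝓘(ℝ, EQ) 𝓘(ℝ, EG) ∞ (Subtype.val : Q → G))
    {K : 𝒢 → Set (GroupLieAlgebra 𝓘(ℝ, EG) G)}
    (hK : ∀ u (q : Q), ∀ A ∈ K u, Ad (q : G)⁻¹ A ∈ K (C.act u q)) {x₀ : M}
    (hloc : ∀ σ : M → 𝒢, (∀ᶠ x in 𝓝 x₀, C.π (σ x) = x ∧
        ContMDiffAt 𝓘(ℝ, EM) 𝓘(ℝ, E𝒢) ∞ σ x) →
      ∃ A : M → GroupLieAlgebra 𝓘(ℝ, EG) G,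
        ∀ᶠ x in 𝓝 x₀, IsSmoothAt (E := EM) A x ∧ A x ∈ K (σ x)) :
    ∃ (U : Set M) (t : 𝒢 → GroupLieAlgebra 𝓘(ℝ, EG) G), IsOpen U ∧ x₀ ∈ U ∧
      ∀ u, C.π u ∈ U → IsSmoothAt (E := E𝒢) t u ∧ t u ∈ K u ∧
        ∀ q : Q, t (C.act u q) = Ad (q : G)⁻¹ (t u) := by
  obtain ⟨U, σ, γ, hU, hx₀, hσ, hact, hγ⟩ := C.exists_localSection x₀
  obtain ⟨A, hA⟩ := hloc σ (eventually_of_mem (hU.mem_nhds hx₀) hσ)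
  obtain ⟨V, hV, hVo, hxV⟩ := eventually_nhds_iff.1 hA
  -- Writing `u = σ(π u) γ(u)`, equivariance forces the extension of `A` from the image of `σ`.
  refine ⟨U ∩ V, fun u => Ad (((γ u)⁻¹ : Q) : G) (A (C.π u)), hU.inter hVo, ⟨hx₀, hxV⟩,
    fun u hu => ⟨?_, ?_, fun q => ?_⟩⟩
  · exact isSmoothAt_Ad_apply hQ (hact u hu.1).2.inv
      ((hV _ hu.2).1.comp C.π_smooth.contMDiffAt)
  · have h := hK _ (γ u) _ (hV _ hu.2).2
    rwa [(hact u hu.1).1] at h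
  · simp only [hγ u hu.1, C.π_act, mul_inv_rev, Subgroup.coe_mul, InvMemClass.coe_inv, Ad_mul]

variable [T2Space M] [SecondCountableTopology M]

/-- Sections of `𝒜M` with values in an invariant family of convex sets exist if they exist
locally. -/
lemma exists_section_of_local (hQ : ContMDiff 𝓘(ℝ, EQ) 𝓘(ℝ, EG) ∞ (Subtype.val : Q → G))
    {K : 𝒢 → Set (GroupLieAlgebra 𝓘(ℝ, EG) G)} (hconv : ∀ u, Convex ℝ (K u))
    (hK : ∀ u (q : Q), ∀ A ∈ K u, Ad (q : G)⁻¹ A ∈ K (C.act u q))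
    (hloc : ∀ x₀, ∀ σ : M → 𝒢, (∀ᶠ x in 𝓝 x₀, C.π (σ x) = x ∧
        ContMDiffAt 𝓘(ℝ, EM) 𝓘(ℝ, E𝒢) ∞ σ x) →
      ∃ A : M → GroupLieAlgebra 𝓘(ℝ, EG) G,
        ∀ᶠ x in 𝓝 x₀, IsSmoothAt (E := EM) A x ∧ A x ∈ K (σ x)) :
    ∃ t ∈ C.ΓA, ∀ u, t u ∈ K u := by
  choose U τ hU hxU hτ using fun x₀ => C.exists_local_equivariant hQ hK (hloc x₀)
  have : LocallyCompactSpace M := Manifold.locallyCompact_of_finiteDimensional 𝓘(ℝ, EM)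
  obtain ⟨f, hf⟩ := SmoothPartitionOfUnity.exists_isSubordinate 𝓘(ℝ, EM) isClosed_univ U hU
    fun x _ => Set.mem_iUnion.2 ⟨x, hxU x⟩
  have hmem : ∀ {x i}, f i x ≠ 0 → x ∈ U i := fun {x i} h => hf i (subset_tsupport _ h)
  -- The weights are pulled back from `M`, hence `Q`-invariant: the sum stays equivariant, and
  -- convexity keeps it in `K u`.
  refine ⟨fun u => ∑ i ∈ f.finsupport (C.π u), f i (C.π u) • τ i u, ⟨?_, fun u q => ?_⟩,
    fun u => ?_⟩
  · refine isSmooth_iff.2 fun u₀ => ?_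
    -- Near `u₀` the varying index set is contained in the fixed finite set `fintsupport`, and the
    -- extra terms vanish.
    have h : IsSmoothAt (E := E𝒢)
        (fun u => ∑ i ∈ f.fintsupport (C.π u₀), f i (C.π u) • τ i u) u₀ := by
      refine .sum fun i hi => .smul ?_ ?_
      · exact (f i).contMDiff.contMDiffAt.comp u₀ C.π_smooth.contMDiffAt
      · exact (hτ i u₀ (hf i ((f.mem_fintsupport_iff _ i).1 hi))).1
    refine h.congr ?_
    filter_upwards [C.π_smooth.continuous.continuousAt.eventually
      (f.eventually_finsupport_subset (C.π u₀))] with u hu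
    refine Finset.sum_subset hu fun i _ hi => ?_
    rw [f.mem_finsupport, Function.notMem_support] at hi
    rw [hi, zero_smul]
  · simp only [C.π_act, map_sum, map_smul]
    refine Finset.sum_congr rfl fun i hi => ?_
    rw [(hτ i u (hmem ((f.mem_finsupport _).1 hi))).2.2]
  · exact (hconv u).sum_mem (fun i _ => f.nonneg i _) (f.sum_finsupport _ (Set.mem_univ _))
      fun i hi => (hτ i u (hmem ((f.mem_finsupport _).1 hi))).2.1

-- Membership in `TP` may be witnessed at another point of the fibre. Moving it to `u` preserves
-- `𝔤^(i,*)`, and the remaining ambiguity lies in `𝔮 ⊂ 𝔤^(i,*)`.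
omit [T2Space M] [SecondCountableTopology M] in
lemma mk_toTM_mem_TP_iff {i : ℤ} (hi : i ≤ 0) (u : 𝒢) (A : GroupLieAlgebra 𝓘(ℝ, EG) G) :
    (⟨C.π u, C.toTM u A⟩ : TangentBundle 𝓘(ℝ, EM) M) ∈ C.TP B i ↔ A ∈ B.F i := by
  refine ⟨?_, fun h => ⟨u, A, h, rfl⟩⟩
  rintro ⟨v, A', hA', h⟩
  obtain ⟨q, rfl⟩ := C.exists_act_eq (congrArg Bundle.TotalSpace.proj h).symm
  rw [← C.mk_toTM_act v q A'] at h
  have h1 : C.toTM (C.act v q) A = C.toTM (C.act v q) (Ad (q : G)⁻¹ A') :=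
    tangentBundle_snd_eq (E := EM) h
  have h2 := B.range_inclDeriv_le_F hi ((C.toTM_eq_zero_iff _ (A - Ad (q : G)⁻¹ A')).1
    (by rw [toTM_sub, h1, sub_self]))
  have h3 := (B.Ad_inv_mem_F_iff q (hi.trans zero_le_one) A').2 hA'
  simpa using add_mem h2 h3

/-- Sections of `T^{i'}_P M` lift to sections of `𝒜^(i', *) M`. -/
lemma exists_Pi_eq {i : ℤ} (hi : i ≤ 0) {η : ∀ x : M, TangentSpace 𝓘(ℝ, EM) x}
    (hη : η ∈ C.ΓTP B i) : ∃ t ∈ C.ΓAF B i, C.Pi t = η := by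
  have hηπ : ∀ {x y : M}, x = y → (η x : EM) = η y := fun h => by rw [h]
  -- The lifts of `η(π u)` to `𝔤` form an affine space. That they lie in `𝔤^(i,*)` need not be
  -- imposed, as it follows from `mk_toTM_mem_TP_iff`.
  obtain ⟨t, ht, htK⟩ := C.exists_section_of_local B.incl_smooth
    (K := fun u => {A | C.toTM u A = η (C.π u)}) (fun u A hA A' hA' r s _ _ hrs => by
      change C.toTM u (r • A + s • A') = η (C.π u)
      rw [toTM_add, toTM_smul, toTM_smul, hA, hA', ← add_smul, hrs, one_smul])
    (fun u q A hA => (C.toTM_act u q A).trans (Eq.trans hA (hηπ (C.π_act u q).symm))) (by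
      intro x₀ σ hσ
      let e := trivializationAt EM (TangentSpace 𝓘(ℝ, EM) : M → Type _) x₀
      have hb : ∀ᶠ x in 𝓝 x₀, x ∈ e.baseSet :=
        e.open_baseSet.mem_nhds (FiberBundle.mem_baseSet_trivializationAt' x₀)
      have he : ∀ (s : M → TangentBundle 𝓘(ℝ, EM) M) (x : M), (s x).1 ∈ e.baseSet →
          ContMDiffAt 𝓘(ℝ, EM) 𝓘(ℝ, EM).tangent ∞ s x →
          ContMDiffAt 𝓘(ℝ, EM) 𝓘(ℝ, EM) ∞ (fun y => (e (s y)).2) x := by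
        intro s x hx hs
        have h1 : s x ∈ e.source := e.mem_source.2 hx
        exact contMDiffAt_snd.comp x (((e.contMDiffOn (n := ∞) (IB := 𝓘(ℝ, EM)) _ h1).contMDiffAt
          (e.open_source.mem_nhds h1)).comp x hs)
      let T : M → GroupLieAlgebra 𝓘(ℝ, EG) G →ₗ[ℝ] EM := fun x =>
        (e.continuousLinearMapAt ℝ (C.π (σ x))).toLinearMap ∘ₗ C.toTMLinear (σ x)
      have hTe : ∀ x w, C.π (σ x) ∈ e.baseSet →
          T x w = (e ⟨C.π (σ x), C.toTM (σ x) w⟩).2 := fun x w hx =>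
        congrFun (e.coe_linearMapAt_of_mem (R := ℝ) hx) _
      have hbσ : ∀ᶠ x in 𝓝 x₀, C.π (σ x) ∈ e.baseSet := by
        filter_upwards [hb, hσ] with x hx hx'
        rwa [hx'.1]
      have hT : ∀ w, ∀ᶠ x in 𝓝 x₀, ContMDiffAt 𝓘(ℝ, EM) 𝓘(ℝ, EM) ∞ (fun y => T y w) x := by
        intro w
        filter_upwards [hbσ.eventually_nhds, hσ] with x hx hx'
        have hw := C.isSmoothVF_cartan_symm (s := fun _ => w)
          (isSmooth_iff.2 fun u => .const w)
        have h1 := (((C.π_smooth.contMDiff_tangentMap (m := ∞) (by simp)).comp hw).contMDiffAt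
          (x := σ x)).comp x hx'.2
        refine (he _ x hx.self_of_nhds h1).congr_of_eventuallyEq ?_
        filter_upwards [hx] with y hy
        exact hTe y w hy
      obtain ⟨A, hA⟩ := exists_smooth_solution (y := fun x => (e ⟨x, η x⟩).2) hT
        (by filter_upwards [hb] with x hx using he _ x hx (hη.1 x))
        (by
          intro y
          obtain ⟨w, hw⟩ := ((e.continuousLinearEquivAt ℝ _ hbσ.self_of_nhds).surjective.comp
            (C.toTM_surjective (σ x₀))) y
          exact ⟨w, (hTe x₀ w hbσ.self_of_nhds).trans hw⟩)
      refine ⟨A, ?_⟩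
      filter_upwards [hA, hbσ, hσ] with x hx hx' hx''
      refine ⟨hx.1, (e.continuousLinearEquivAt ℝ _ hx').injective ?_⟩
      refine (hTe x (A x) hx').symm.trans (hx.2.trans ?_)
      change (e ⟨x, η x⟩).2 = (e ⟨C.π (σ x), η (C.π (σ x))⟩).2
      rw [hx''.1])
  have hPi : C.Pi t = η := by
    funext x
    obtain ⟨u, rfl⟩ := C.π_surjective x
    exact (C.Pi_π ht.2 u).trans (htK u)
  refine ⟨t, ⟨ht, fun u => ?_⟩, hPi⟩
  rw [← C.mk_toTM_mem_TP_iff B hi, htK u]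
  exact hη.2 (C.π u)

omit [T2Space M] [SecondCountableTopology M] in
lemma cls_eq_iff {i : ℤ} (x y : B.F i) :
    B.cls i x = B.cls i y ↔
      (x : GroupLieAlgebra 𝓘(ℝ, EG) G) - (y : GroupLieAlgebra 𝓘(ℝ, EG) G) ∈ B.F (i + 1) :=
  Submodule.Quotient.eq _

/-- Sections of `𝒱_{i'} M` lift to sections of `𝒜^(i', *) M`. -/
lemma exists_proj_eq {i : ℤ} (hi : i ≤ 0) {σ : 𝒢 → B.V i} (hσ : σ ∈ C.ΓV B i) :
    ∃ t, ∃ ht : t ∈ C.ΓAF B i, B.proj i t ht.2 = σ := by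
  -- A linear splitting need not be equivariant, so it serves only to produce smooth lifts along
  -- local sections.
  obtain ⟨r, hr⟩ := (B.cls i).exists_rightInverse_of_surjective (Submodule.range_mkQ _)
  obtain ⟨t, ht, htK⟩ := C.exists_section_of_local B.incl_smooth
    (K := fun u => {A | ∃ h : A ∈ B.F i, B.cls i ⟨A, h⟩ = σ u})
    (fun u A hA A' hA' a a' _ _ haa => by
      obtain ⟨h, hA⟩ := hA
      obtain ⟨h', hA'⟩ := hA'
      refine ⟨add_mem (Submodule.smul_mem _ a h) (Submodule.smul_mem _ a' h'), ?_⟩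
      refine ((B.cls i).map_add (a • ⟨A, h⟩) (a' • ⟨A', h'⟩)).trans ?_
      rw [map_smul, map_smul, hA, hA', ← add_smul, haa, one_smul])
    (fun u q A hA => by
      obtain ⟨h, hA⟩ := hA
      obtain ⟨x, y, hx, hy, hxy⟩ := hσ.2 u q
      refine ⟨(B.Ad_inv_mem_F_iff q (hi.trans zero_le_one) A).2 h, ?_⟩
      -- Independence of the representative requires invariance in degree `i + 1`, which is at most
      -- `1`.
      rw [← hy, cls_eq_iff, hxy, ← map_sub, B.Ad_inv_mem_F_iff q (by omega)]
      exact (cls_eq_iff B ⟨A, h⟩ x).1 (hA.trans hx.symm))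
    (fun x₀ s hs => by
      refine ⟨fun x => (r (σ (s x)) : B.F i), ?_⟩
      filter_upwards [hs] with x hx
      refine ⟨(((hσ.1.isSmoothAt (s x)).linear r).linear (B.F i).subtype).comp hx.2, (r _).2, ?_⟩
      exact LinearMap.congr_fun hr _)
  exact ⟨t, ⟨ht, fun u => (htK u).1⟩, funext fun u => (htK u).2⟩

end CartanGeometry

end Gluing

end

end RelTractor

namespace RelTractor

noncomputable section

/-! ### The induced partial connections and the relative tractor connection -/

section RelativeTractorConnection

set_option linter.unusedSectionVars false

open Filter Topology

variable {EG : Type*} [NormedAddCommGroup EG] [NormedSpace ℝ EG] [FiniteDimensional ℝ EG]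
  {G : Type*} [TopologicalSpace G] [ChartedSpace EG G] [Group G] [LieGroup 𝓘(ℝ, EG) ∞ G]
  {EQ : Type*} [NormedAddCommGroup EQ] [NormedSpace ℝ EQ] [FiniteDimensional ℝ EQ]
  {ι : Type*} [Fintype ι] {P Q : Subgroup G} [ChartedSpace EQ Q] [LieGroup 𝓘(ℝ, EQ) ∞ Q]
  {E𝒢 : Type*} [NormedAddCommGroup E𝒢] [NormedSpace ℝ E𝒢] [FiniteDimensional ℝ E𝒢]
  {𝒢 : Type*} [TopologicalSpace 𝒢] [ChartedSpace E𝒢 𝒢] [IsManifold 𝓘(ℝ, E𝒢) ∞ 𝒢]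
  {EM : Type*} [NormedAddCommGroup EM] [NormedSpace ℝ EM] [FiniteDimensional ℝ EM]
  {M : Type*} [TopologicalSpace M] [ChartedSpace EM M] [IsManifold 𝓘(ℝ, EM) ∞ M]

namespace CartanGeometry

variable (C : CartanGeometry EG EQ E𝒢 EM Q 𝒢 M)
variable (C : CartanGeometry EG EQ E𝒢 EM Q 𝒢 M)
  (B : NestedParabolics (EG := EG) (EQ := EQ) ι P Q)

lemma add_mem_ΓAF {i : ℤ} {s t : 𝒢 → GroupLieAlgebra 𝓘(ℝ, EG) G} (hs : s ∈ C.ΓAF B i)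
    (ht : t ∈ C.ΓAF B i) : s + t ∈ C.ΓAF B i := by
  refine ⟨⟨isSmooth_iff.2 fun u => (hs.1.1.isSmoothAt u).add (ht.1.1.isSmoothAt u),
    fun u q => ?_⟩, fun u => add_mem (hs.2 u) (ht.2 u)⟩
  simp only [Pi.add_apply, hs.1.2, ht.1.2, map_add]

lemma smul_mem_ΓAF {i : ℤ} {f : M → ℝ} (hf : ContMDiff 𝓘(ℝ, EM) 𝓘(ℝ, ℝ) ∞ f)
    {t : 𝒢 → GroupLieAlgebra 𝓘(ℝ, EG) G} (ht : t ∈ C.ΓAF B i) :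
    (fun u => f (C.π u) • t u) ∈ C.ΓAF B i := by
  refine ⟨⟨isSmooth_iff.2 fun u => (ht.1.1.isSmoothAt u).smul (hf.comp C.π_smooth).contMDiffAt,
    fun u q => ?_⟩, fun u => Submodule.smul_mem _ _ (ht.2 u)⟩
  simp only [C.π_act, ht.1.2, map_smul]

lemma sub_mem_ΓAF {i j : ℤ} {s t : 𝒢 → GroupLieAlgebra 𝓘(ℝ, EG) G} (hs : s ∈ C.ΓAF B i)
    (ht : t ∈ C.ΓAF B i) (h : ∀ u, s u - t u ∈ B.F j) : s - t ∈ C.ΓAF B j := by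
  refine ⟨⟨isSmooth_iff.2 fun u => (hs.1.1.isSmoothAt u).sub (ht.1.1.isSmoothAt u),
    fun u q => ?_⟩, h⟩
  simp only [Pi.sub_apply, hs.1.2, ht.1.2, map_sub]

lemma Pi_sub {s t : 𝒢 → GroupLieAlgebra 𝓘(ℝ, EG) G} (hs : s ∈ C.ΓA) (ht : t ∈ C.ΓA) :
    C.Pi (s - t) = C.Pi s - C.Pi t := by
  funext x
  obtain ⟨u, rfl⟩ := C.π_surjective x
  rw [Pi.sub_apply, C.Pi_π hs.2, C.Pi_π ht.2, ← toTM_sub]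
  refine C.Pi_π (fun v q => ?_) u
  simp only [Pi.sub_apply, hs.2, ht.2, map_sub]

section AdjConn

variable (ξ η : ∀ x : M, TangentSpace 𝓘(ℝ, EM) x) {s t : 𝒢 → GroupLieAlgebra 𝓘(ℝ, EG) G}

lemma adjConn_add_left (hQ : ContMDiff 𝓘(ℝ, EQ) 𝓘(ℝ, EG) ∞ (Subtype.val : Q → G))
    (ht : t ∈ C.ΓA) : C.adjConn (fun x => ξ x + η x) t = C.adjConn ξ t + C.adjConn η t := by
  funext u
  have h : C.toTM u (C.lift ξ u + C.lift η u) = ξ (C.π u) + η (C.π u) := by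
    rw [toTM_add, toTM_lift, toTM_lift]
  exact (C.adjConn_eq hQ ht (ξ := fun x => ξ x + η x) h).trans (map_add _ _ _)

lemma adjConn_smul_left (hQ : ContMDiff 𝓘(ℝ, EQ) 𝓘(ℝ, EG) ∞ (Subtype.val : Q → G))
    (ht : t ∈ C.ΓA) (f : M → ℝ) :
    C.adjConn (fun x => f x • ξ x) t = fun u => f (C.π u) • C.adjConn ξ t u := by
  funext u
  have h : C.toTM u (f (C.π u) • C.lift ξ u) = f (C.π u) • ξ (C.π u) := by
    rw [toTM_smul, toTM_lift]
  exact (C.adjConn_eq hQ ht (ξ := fun x => f x • ξ x) h).trans (map_smul _ _ _)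

lemma adjConn_add_right (hs : IsSmooth (E := E𝒢) s) (ht : IsSmooth (E := E𝒢) t) :
    C.adjConn ξ (s + t) = C.adjConn ξ s + C.adjConn ξ t := by
  funext u
  have h := dirDeriv_add (hs.isSmoothAt u) (ht.isSmoothAt u) ((C.cartan u).symm (C.lift ξ u))
  refine (congrArg₂ (· + ·) h (lie_add (C.lift ξ u) (s u) (t u))).trans ?_
  exact add_add_add_comm _ _ _ _

lemma adjConn_sub_right (hs : IsSmooth (E := E𝒢) s) (ht : IsSmooth (E := E𝒢) t) :
    C.adjConn ξ (s - t) = C.adjConn ξ s - C.adjConn ξ t := by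
  have hst : IsSmooth (E := E𝒢) (s - t) :=
    isSmooth_iff.2 fun u => (hs.isSmoothAt u).sub (ht.isSmoothAt u)
  rw [eq_sub_iff_add_eq, ← C.adjConn_add_right ξ hst ht, sub_add_cancel]

lemma adjConn_leibniz {f : M → ℝ} (hf : ContMDiff 𝓘(ℝ, EM) 𝓘(ℝ, ℝ) ∞ f)
    (ht : IsSmooth (E := E𝒢) t) :
    C.adjConn ξ (fun u => f (C.π u) • t u) =
      fun u => fnDeriv f (C.π u) (ξ (C.π u)) • t u + f (C.π u) • C.adjConn ξ t u := by
  funext u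
  have h := dirDeriv_smul (hf.comp C.π_smooth).contMDiffAt (ht.isSmoothAt u)
    ((C.cartan u).symm (C.lift ξ u))
  have h1 : fnDeriv (fun v => f (C.π v)) u ((C.cartan u).symm (C.lift ξ u)) =
      fnDeriv f (C.π u) (ξ (C.π u)) :=
    (fnDeriv_comp rfl (hf.mdifferentiable (by simp) _) (C.mdifferentiableAt_π u) _).trans
      (congrArg (fnDeriv f (C.π u)) (C.toTM_lift ξ u))
  refine (congrArg₂ (· + ·) h (lie_smul (f (C.π u)) (C.lift ξ u) (t u))).trans ?_
  refine (add_assoc _ _ _).trans (congrArg₂ (· + ·) (congrArg (· • t u) h1) ?_)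
  exact (smul_add _ _ _).symm

end AdjConn

lemma adjConn_Pi (hQ : ContMDiff 𝓘(ℝ, EQ) 𝓘(ℝ, EG) ∞ (Subtype.val : Q → G))
    {s t : 𝒢 → GroupLieAlgebra 𝓘(ℝ, EG) G} (hs : s ∈ C.ΓA) (ht : t ∈ C.ΓA) :
    C.adjConn (C.Pi s) t = fun u => C.fundDeriv s t u + ⁅s u, t u⁆ :=
  funext fun u => C.adjConn_eq hQ ht (C.Pi_π hs.2 u).symm

/-- A linear retraction of `𝔤` onto the subspace transfers smoothness. -/
lemma isSmooth_subtype {i : ℤ} {t : 𝒢 → GroupLieAlgebra 𝓘(ℝ, EG) G}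
    (ht : IsSmooth (E := E𝒢) t) (h : ∀ u, t u ∈ B.F i) :
    IsSmooth (E := E𝒢) (fun u => (⟨t u, h u⟩ : B.F i)) := by
  obtain ⟨r, hr⟩ := (B.F i).subtype.exists_leftInverse_of_injective (Submodule.ker_subtype _)
  refine isSmooth_iff.2 fun u => ((ht.isSmoothAt u).linear r).congr (Eventually.of_forall fun v => ?_)
  exact (LinearMap.congr_fun hr ⟨t v, h v⟩).symm

lemma proj_mem {i : ℤ} {t : 𝒢 → GroupLieAlgebra 𝓘(ℝ, EG) G}
    (ht : t ∈ C.ΓAF B i) : B.proj i t ht.2 ∈ C.ΓV B i :=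
  ⟨isSmooth_iff.2 fun u => ((isSmooth_subtype B ht.1.1 ht.2).isSmoothAt u).linear (B.cls i),
    fun u q => ⟨⟨t u, ht.2 u⟩, ⟨t (C.act u q), ht.2 _⟩, rfl, rfl, ht.1.2 u q⟩⟩

/-- Differentiation commutes with the projection to the quotient. -/
lemma dirDeriv_proj {i : ℤ} {t : 𝒢 → GroupLieAlgebra 𝓘(ℝ, EG) G} (ht : IsSmooth (E := E𝒢) t)
    (h : ∀ u, t u ∈ B.F i) (u : 𝒢) (X : TangentSpace 𝓘(ℝ, E𝒢) u) :
    dirDeriv (B.proj i t h) u X =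
      B.cls i ⟨dirDeriv t u X, dirDeriv_mem (ht.isSmoothAt u) h X⟩ := by
  have h1 := (isSmooth_subtype B ht h).isSmoothAt u
  refine (dirDeriv_linear h1 (B.cls i) X).trans (congrArg (B.cls i) (Subtype.ext ?_))
  exact (dirDeriv_linear h1 (B.F i).subtype X).symm

/-- This uses `𝔭₊ = 𝔤^(1,*) ⊂ 𝔮`: passing to `𝔭/𝔭₊` loses nothing that is visible in `TM`. -/
lemma toTM_eq_of_cls_eq {A A' : B.F 0} (h : B.cls 0 A = B.cls 0 A') (u : 𝒢) :
    C.toTM u A = C.toTM u A' := by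
  rw [← sub_eq_zero, ← toTM_sub, toTM_eq_zero_iff]
  exact B.F_one_le_range_inclDeriv ((cls_eq_iff B A A').1 h)

lemma cls_surjInv (a : B.V 0) :
    B.cls 0 (Function.surjInv (Submodule.mkQ_surjective _) a) = a :=
  Function.surjInv_eq (Submodule.mkQ_surjective _) a

lemma toTM_relLift {ξ : ∀ x : M, TangentSpace 𝓘(ℝ, EM) x} (hξ : ξ ∈ C.ΓTP B 0) (u : 𝒢) :
    C.toTM u (Function.surjInv (Submodule.mkQ_surjective _) (C.relLift B ξ u) : B.F 0) =
      ξ (C.π u) := by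
  obtain ⟨A, hA⟩ := C.toTM_surjective u (ξ (C.π u))
  have hA0 : A ∈ B.F 0 := by
    rw [← C.mk_toTM_mem_TP_iff B le_rfl u, hA]
    exact hξ.2 _
  obtain ⟨A', hA', hA''⟩ := Classical.epsilon_spec
    (p := fun a => ∃ A : B.F 0, B.cls 0 A = a ∧ C.toTM u A = ξ (C.π u)) ⟨_, ⟨A, hA0⟩, rfl, hA⟩
  rw [← hA'']
  exact C.toTM_eq_of_cls_eq B ((cls_surjInv B _).trans hA'.symm) u

/-- The relative fundamental derivative is well defined. -/
lemma relFundDeriv_proj {i : ℤ} {s t : 𝒢 → GroupLieAlgebra 𝓘(ℝ, EG) G} (hs : ∀ u, s u ∈ B.F 0)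
    (ht : t ∈ C.ΓAF B i) :
    C.relFundDeriv B (B.proj 0 s hs) (B.proj i t ht.2) = C.fundDeriv s (B.proj i t ht.2) := by
  funext u
  let A : B.F 0 := Function.surjInv (Submodule.mkQ_surjective _) (B.proj 0 s hs u)
  have hA : B.cls 0 A = B.cls 0 ⟨s u, hs u⟩ := cls_surjInv B _
  refine (dirDeriv_proj B ht.1.1 ht.2 u _).trans
    (Eq.trans ?_ (dirDeriv_proj B ht.1.1 ht.2 u _).symm)
  rw [cls_eq_iff]
  -- Both representatives give the same tangent vector, so the derivatives differ by `-[A - s u, t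
  -- u]`. As `A - s u` lies in `𝔤^(1,*)`, this vanishes in `𝕍_i`.
  have h1 := C.connAt_congr B.incl_smooth ht.1 (C.toTM_eq_of_cls_eq B hA u)
  rw [connAt_apply, connAt_apply] at h1
  have h2 : dirDeriv t u ((C.cartan u).symm A) - dirDeriv t u ((C.cartan u).symm (s u)) =
      -⁅(A : GroupLieAlgebra 𝓘(ℝ, EG) G) - s u, t u⁆ := by
    rw [sub_lie, neg_sub, sub_eq_sub_iff_add_eq_add, h1]
    exact add_comm _ _
  refine h2 ▸ neg_mem ?_
  have h3 := B.roots.lie_filtration ((cls_eq_iff B A _).1 hA) (ht.2 u)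
  rwa [zero_add, add_comm] at h3

variable [T2Space M] [SecondCountableTopology M]

lemma adjConn_mem {i : ℤ} {ξ : ∀ x : M, TangentSpace 𝓘(ℝ, EM) x} (hξ : ξ ∈ C.ΓTP B 0)
    {t : 𝒢 → GroupLieAlgebra 𝓘(ℝ, EG) G} (ht : t ∈ C.ΓAF B i) : C.adjConn ξ t ∈ C.ΓAF B i := by
  obtain ⟨s, hs, rfl⟩ := C.exists_Pi_eq B le_rfl hξ
  rw [C.adjConn_Pi B.incl_smooth hs.1 ht.1]
  exact C.fundDeriv_add_lie_mem_ΓAF B hs ht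

/-- The adjoint tractor connection induces the relative tractor connection. -/
lemma relConn_proj {i : ℤ} {ξ : ∀ x : M, TangentSpace 𝓘(ℝ, EM) x} (hξ : ξ ∈ C.ΓTP B 0)
    {t : 𝒢 → GroupLieAlgebra 𝓘(ℝ, EG) G} (ht : t ∈ C.ΓAF B i) :
    C.relConn B i ξ (B.proj i t ht.2) =
      B.proj i (C.adjConn ξ t) (C.adjConn_mem B hξ ht).2 := by
  funext u
  let A : B.F 0 := Function.surjInv (Submodule.mkQ_surjective _) (C.relLift B ξ u)
  have hA : B.cls 0 A = C.relLift B ξ u := cls_surjInv B _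
  -- The representative `A` entering the relative connection also lifts `ξ`, so the adjoint
  -- connection may be computed with it.
  have h1 := C.adjConn_eq B.incl_smooth ht.1 (C.toTM_relLift B hξ u)
  have h2 : B.roots.bullet B.Sp B.Sq i (C.relLift B ξ u) (B.proj i t ht.2 u) =
      B.cls i (B.roots.filtrationLie B.Sp B.Sq i A ⟨t u, ht.2 u⟩) := by
    rw [← hA]
    rfl
  refine (congrArg₂ (· + ·) (dirDeriv_proj B ht.1.1 ht.2 u _) h2).trans ?_
  refine ((B.cls i).map_add _ _).symm.trans (congrArg (B.cls i) (Subtype.ext ?_))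
  exact h1.symm

lemma add_mem_ΓTP {ξ η : ∀ x : M, TangentSpace 𝓘(ℝ, EM) x} (hξ : ξ ∈ C.ΓTP B 0)
    (hη : η ∈ C.ΓTP B 0) : (fun x => ξ x + η x) ∈ C.ΓTP B 0 := by
  obtain ⟨s, hs, rfl⟩ := C.exists_Pi_eq B le_rfl hξ
  obtain ⟨t, ht, rfl⟩ := C.exists_Pi_eq B le_rfl hη
  have hst := C.add_mem_ΓAF B hs ht
  convert C.Pi_mem B hst with x
  obtain ⟨u, rfl⟩ := C.π_surjective x
  rw [C.Pi_π hst.1.2, C.Pi_π hs.1.2, C.Pi_π ht.1.2, ← toTM_add]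
  rfl

lemma smul_mem_ΓTP {f : M → ℝ} (hf : ContMDiff 𝓘(ℝ, EM) 𝓘(ℝ, ℝ) ∞ f)
    {ξ : ∀ x : M, TangentSpace 𝓘(ℝ, EM) x} (hξ : ξ ∈ C.ΓTP B 0) :
    (fun x => f x • ξ x) ∈ C.ΓTP B 0 := by
  obtain ⟨s, hs, rfl⟩ := C.exists_Pi_eq B le_rfl hξ
  have hfs := C.smul_mem_ΓAF B hf hs
  convert C.Pi_mem B hfs with x
  obtain ⟨u, rfl⟩ := C.π_surjective x
  rw [C.Pi_π (s := fun u => f (C.π u) • s u) hfs.1.2, C.Pi_π hs.1.2, toTM_smul]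

lemma isPartialConnection_adjConn (i : ℤ) : C.IsPartialConnection B (C.ΓAF B i) C.adjConn where
  mem _ hξ _ ht := C.adjConn_mem B hξ ht
  add_left ξ _ η _ _ ht := C.adjConn_add_left ξ η B.incl_smooth ht.1
  smul_left f _ ξ _ _ ht := C.adjConn_smul_left ξ B.incl_smooth ht.1 f
  add_right ξ _ _ hs _ ht := C.adjConn_add_right ξ hs.1.1 ht.1.1
  leibniz _ hf ξ _ _ ht := C.adjConn_leibniz ξ hf ht.1.1

omit [T2Space M] [SecondCountableTopology M] in
lemma proj_congr {i : ℤ} {s t : 𝒢 → GroupLieAlgebra 𝓘(ℝ, EG) G} (h : s = t)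
    (hs : ∀ u, s u ∈ B.F i) (ht : ∀ u, t u ∈ B.F i) : B.proj i s hs = B.proj i t ht := by
  subst h; rfl

/-- Each axiom is inherited from `adjConn` by lifting sections to `𝒜^(i,*) M` and projecting with
`relConn_proj`. -/
lemma isPartialConnection_relConn {i : ℤ} (hi : i ≤ 0) :
    C.IsPartialConnection B (C.ΓV B i) (C.relConn B i) where
  mem ξ hξ σ hσ := by
    obtain ⟨t, ht, rfl⟩ := C.exists_proj_eq B hi hσ
    rw [C.relConn_proj B hξ ht]
    exact C.proj_mem B (C.adjConn_mem B hξ ht)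
  add_left ξ hξ η hη σ hσ := by
    obtain ⟨t, ht, rfl⟩ := C.exists_proj_eq B hi hσ
    rw [C.relConn_proj B hξ ht, C.relConn_proj B hη ht, C.relConn_proj B (C.add_mem_ΓTP B hξ hη) ht]
    exact proj_congr B (C.adjConn_add_left ξ η B.incl_smooth ht.1) _
      (C.add_mem_ΓAF B (C.adjConn_mem B hξ ht) (C.adjConn_mem B hη ht)).2
  smul_left f hf ξ hξ σ hσ := by
    obtain ⟨t, ht, rfl⟩ := C.exists_proj_eq B hi hσ
    rw [C.relConn_proj B hξ ht, C.relConn_proj B (C.smul_mem_ΓTP B hf hξ) ht]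
    exact proj_congr B (C.adjConn_smul_left ξ B.incl_smooth ht.1 f) _
      (C.smul_mem_ΓAF B hf (C.adjConn_mem B hξ ht)).2
  add_right ξ hξ σ hσ τ hτ := by
    obtain ⟨s, hs, rfl⟩ := C.exists_proj_eq B hi hσ
    obtain ⟨t, ht, rfl⟩ := C.exists_proj_eq B hi hτ
    rw [C.relConn_proj B hξ hs, C.relConn_proj B hξ ht]
    refine (C.relConn_proj B hξ (C.add_mem_ΓAF B hs ht)).trans ?_
    exact proj_congr B (C.adjConn_add_right ξ hs.1.1 ht.1.1) _
      (C.add_mem_ΓAF B (C.adjConn_mem B hξ hs) (C.adjConn_mem B hξ ht)).2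
  leibniz f hf ξ hξ σ hσ := by
    obtain ⟨t, ht, rfl⟩ := C.exists_proj_eq B hi hσ
    rw [C.relConn_proj B hξ ht]
    refine (C.relConn_proj B hξ (C.smul_mem_ΓAF B hf ht)).trans ?_
    exact proj_congr B (C.adjConn_leibniz ξ hf ht.1.1) _ fun u =>
      add_mem (Submodule.smul_mem _ _ (ht.2 u))
        (Submodule.smul_mem _ _ ((C.adjConn_mem B hξ ht).2 u))

lemma relConn_Pi {i : ℤ} (hi : i ≤ 0) {s : 𝒢 → GroupLieAlgebra 𝓘(ℝ, EG) G}
    (hs : s ∈ C.ΓAF B 0) {σ : 𝒢 → B.V i} (hσ : σ ∈ C.ΓV B i) :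
    C.relConn B i (C.Pi s) σ = fun u => C.fundDeriv s σ u +
      B.roots.bullet B.Sp B.Sq i (B.proj 0 s hs.2 u) (σ u) := by
  obtain ⟨t, ht, rfl⟩ := C.exists_proj_eq B hi hσ
  rw [C.relConn_proj B (C.Pi_mem B hs) ht]
  funext u
  refine Eq.trans ?_ (congrArg (· + _) (dirDeriv_proj B ht.1.1 ht.2 u _).symm)
  refine Eq.trans ?_ ((B.cls i).map_add _
    (B.roots.filtrationLie B.Sp B.Sq i ⟨s u, hs.2 u⟩ ⟨t u, ht.2 u⟩))
  exact congrArg (B.cls i) (Subtype.ext (congrFun (C.adjConn_Pi B.incl_smooth hs.1 ht.1) u))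

/-- The operation on sections of `T^{i'}_P M` is well defined modulo sections of `T_ρ M`. -/
lemma Pi_adjConn_sub_mem {i : ℤ} {ξ : ∀ x : M, TangentSpace 𝓘(ℝ, EM) x} (hξ : ξ ∈ C.ΓTP B 0)
    {t t' : 𝒢 → GroupLieAlgebra 𝓘(ℝ, EG) G} (ht : t ∈ C.ΓAF B i) (ht' : t' ∈ C.ΓAF B i)
    (h : C.Pi t - C.Pi t' ∈ C.ΓTP B 0) :
    C.Pi (C.adjConn ξ t) - C.Pi (C.adjConn ξ t') ∈ C.ΓTP B 0 := by
  rw [← C.Pi_sub (C.adjConn_mem B hξ ht).1 (C.adjConn_mem B hξ ht').1,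
    ← C.adjConn_sub_right ξ ht.1.1 ht'.1.1]
  -- The hypothesis says that `t - t'` takes values in `𝔤^(0,*)`, and the connection preserves
  -- sections of `𝒜^(0,*) M`.
  refine C.Pi_mem B (C.adjConn_mem B hξ (C.sub_mem_ΓAF B ht ht' fun u => ?_))
  rw [← C.mk_toTM_mem_TP_iff B le_rfl u, toTM_sub, ← C.Pi_π ht.1.2, ← C.Pi_π ht'.1.2]
  exact h.2 (C.π u)

end CartanGeometry

end RelativeTractorConnection

end

end RelTractor

/-! ### The main theorem -/

theorem theorem3p1
    {EG : Type*} [NormedAddCommGroup EG] [NormedSpace ℝ EG] [FiniteDimensional ℝ EG]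
    {G : Type*} [TopologicalSpace G] [ChartedSpace EG G] [Group G] [LieGroup 𝓘(ℝ, EG) ∞ G]
    [LieAlgebra.IsSemisimple ℝ (GroupLieAlgebra 𝓘(ℝ, EG) G)]
    {EQ : Type*} [NormedAddCommGroup EQ] [NormedSpace ℝ EQ] [FiniteDimensional ℝ EQ]
    {P Q : Subgroup G} [ChartedSpace EQ Q] [LieGroup 𝓘(ℝ, EQ) ∞ Q]
    {ι : Type*} [Fintype ι]
    (B : RelTractor.NestedParabolics (EG := EG) (EQ := EQ) ι P Q)
    {E𝒢 : Type*} [NormedAddCommGroup E𝒢] [NormedSpace ℝ E𝒢] [FiniteDimensional ℝ E𝒢]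
    {𝒢 : Type*} [TopologicalSpace 𝒢] [ChartedSpace E𝒢 𝒢] [IsManifold 𝓘(ℝ, E𝒢) ∞ 𝒢]
    {EM : Type*} [NormedAddCommGroup EM] [NormedSpace ℝ EM] [FiniteDimensional ℝ EM]
    {M : Type*} [TopologicalSpace M] [T2Space M] [SecondCountableTopology M]
    [ChartedSpace EM M] [IsManifold 𝓘(ℝ, EM) ∞ M]
    (C : RelTractor.CartanGeometry EG EQ E𝒢 EM Q 𝒢 M) :
    -- `Π : Γ(𝒜M) → 𝔛(M)` is well defined and the defining equation of `∇^𝒜` holds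
    (∀ s ∈ C.ΓA, RelTractor.IsSmoothVF (C.Pi s) ∧ (∀ u, C.Pi s (C.π u) = C.toTM u (s u)) ∧
      ∀ t ∈ C.ΓA, C.adjConn (C.Pi s) t = fun u => C.fundDeriv s t u + ⁅s u, t u⁆) ∧
    ∀ i' : ℤ, i' ≤ 0 →
      -- `∇^𝒜` in directions `Π(s)` preserves `𝒜^(i', *) M`
      (∀ s ∈ C.ΓAF B 0, ∀ t ∈ C.ΓAF B i', C.adjConn (C.Pi s) t ∈ C.ΓAF B i') ∧
      -- it restricts to a partial connection `Γ(T_ρ M) × Γ(𝒜^(i', *) M) → Γ(𝒜^(i', *) M)`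
      C.IsPartialConnection B (C.ΓAF B i') C.adjConn ∧
      -- sections of `𝒜^(i', *) M` project onto the sections of `T^{i'}_P M`, and on the latter one
      -- obtains an operation that is well defined modulo sections of `T_ρ M`
      (∀ t ∈ C.ΓAF B i', C.Pi t ∈ C.ΓTP B i') ∧
      (∀ η ∈ C.ΓTP B i', ∃ t ∈ C.ΓAF B i', C.Pi t = η) ∧
      (∀ ξ ∈ C.ΓTP B 0, ∀ t ∈ C.ΓAF B i', C.Pi (C.adjConn ξ t) ∈ C.ΓTP B i') ∧
      (∀ ξ ∈ C.ΓTP B 0, ∀ t ∈ C.ΓAF B i', ∀ t' ∈ C.ΓAF B i', C.Pi t - C.Pi t' ∈ C.ΓTP B 0 →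
        C.Pi (C.adjConn ξ t) - C.Pi (C.adjConn ξ t') ∈ C.ΓTP B 0) ∧
      -- the defining equations of `D^ρ` and of the relative tractor connection on `𝒱_{i'} M`
      (∀ s, ∀ hs : s ∈ C.ΓAF B 0, ∀ σ ∈ C.ΓV B i',
        C.relFundDeriv B (B.proj 0 s hs.2) σ = C.fundDeriv s σ ∧
        C.relConn B i' (C.Pi s) σ = fun u => C.relFundDeriv B (B.proj 0 s hs.2) σ u +
          B.roots.bullet B.Sp B.Sq i' (B.proj 0 s hs.2 u) (σ u)) ∧
      -- sections of `𝒱_{i'} M` are exactly the projections of sections of `𝒜^(i', *) M`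
      (∀ t, ∀ ht : t ∈ C.ΓAF B i', B.proj i' t ht.2 ∈ C.ΓV B i') ∧
      (∀ σ ∈ C.ΓV B i', ∃ t, ∃ ht : t ∈ C.ΓAF B i', B.proj i' t ht.2 = σ) ∧
      -- `∇^𝒜` induces a partial connection on `𝒱_{i'} M`, which is the relative tractor connection
      ∃ nab : (∀ x : M, TangentSpace 𝓘(ℝ, EM) x) → (𝒢 → B.V i') → (𝒢 → B.V i'),
        C.IsPartialConnection B (C.ΓV B i') nab ∧
        (∀ ξ ∈ C.ΓTP B 0, ∀ t, ∀ ht : t ∈ C.ΓAF B i',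
          ∃ h : C.adjConn ξ t ∈ C.ΓAF B i',
            nab ξ (B.proj i' t ht.2) = B.proj i' (C.adjConn ξ t) h.2) ∧
        ∀ ξ ∈ C.ΓTP B 0, ∀ σ ∈ C.ΓV B i', nab ξ σ = C.relConn B i' ξ σ := by
  refine ⟨fun s hs => ⟨C.isSmoothVF_of_toTM hs.1 fun u => (C.Pi_π hs.2 u).symm, C.Pi_π hs.2,
    fun t ht => C.adjConn_Pi B.incl_smooth hs ht⟩, fun i' hi => ⟨fun s hs t ht =>
    C.adjConn_mem B (C.Pi_mem B hs) ht, C.isPartialConnection_adjConn B i',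
    fun t ht => C.Pi_mem B ht, fun η hη => C.exists_Pi_eq B hi hη,
    fun ξ hξ t ht => C.Pi_mem B (C.adjConn_mem B hξ ht),
    fun ξ hξ t ht t' ht' h => C.Pi_adjConn_sub_mem B hξ ht ht' h, fun s hs σ hσ => ?_,
    fun t ht => C.proj_mem B ht, fun σ hσ => C.exists_proj_eq B hi hσ,
    -- The relative tractor connection itself is taken as the induced operation, so the asserted
    -- coincidence holds by `rfl`; the content is in `relConn_proj`.
    C.relConn B i', C.isPartialConnection_relConn B hi,
    fun ξ hξ t ht => ⟨C.adjConn_mem B hξ ht, C.relConn_proj B hξ ht⟩, fun _ _ _ _ => rfl⟩⟩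
  have h : C.relFundDeriv B (B.proj 0 s hs.2) σ = C.fundDeriv s σ := by
    obtain ⟨t, ht, rfl⟩ := C.exists_proj_eq B hi hσ
    exact C.relFundDeriv_proj B hs.2 ht
  exact ⟨h, by rw [h]; exact C.relConn_Pi B hi hs hσ⟩
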